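/- Let $C\subset\mathbb R^3$ be a (possibly non-convex) polyhedron: a compact regular closed set whose boundary is a finite union of planar polygonal faces $F_k$ (closed regions bounded by closed polygons without self-intersections), where distinct faces meet at most along their boundaries. Let $n_k$ be the outer unit normal and $x_{k,1}$ the first vertex of $F_k$. Let $\varphi$ be a level-set function, continuous on $C$, and put $\Gamma=\{x\in C:\varphi(x)=0\}$, $C^-=\{x\in C:\varphi(x)\le 0\}$, $F_k^-=\{x\in F_k:\varphi(x)\le 0\}$. Assume that $\varphi$ is $C^2$ near every point of $\Gamma$, with $\nabla\varphi\neq0$ on $\Gamma$, and put $n_\Gamma=\nabla\varphi/|\nabla\varphi|$. Let $x_0\in\Gamma$, $n_0=n_\Gamma(x_0)$, and let $\tau=[\tau_1,\tau_2]$ complete $n_0$ to an orthonormal basis. Let $S_\Gamma=\{\tau^{\mathsf T}(x-x_0):x\in\Gamma\}\subset\mathbb R^2$ be the graph base, and assume: * $\Gamma$ is a graph over its tangent plane at $x_0$: $\Gamma=f_\Gamma(S_\Gamma)$ with $f_\Gamma(t)=x_0+\tau t+h(t)n_0$, where $h$ is $C^2$ near every point of $S_\Gamma$, and the normal is the upward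 one, $n_\Gamma=(n_0-\tau\nabla h)/\sqrt{1+|\nabla h|^2}$ (i.e. $\langle n_\Gamma,n_0\rangle>0$ on $\Gamma$); * $\Gamma\cap F_k$ has zero area for every $k$; * $S_\Gamma$ is the closure of its interior and has a piecewise $C^1$ boundary, decomposed by faces: $\partial S_\Gamma=\bigcup_k\partial S_{\Gamma,k}$, where each $\partial S_{\Gamma,k}$ is a finite union of regular $C^1$ arcs and $f_\Gamma(\partial S_{\Gamma,k})\subset F_k$, and all these arcs are simple and meet one another at most in end points (an arc that is mapped into a common edge of two faces is attributed to one of them). Let $n_S$ be the outer unit normal to $\partial S_\Gamma$ (away from end points of arcs). **(a)** Let $x_{\mathrm{ref}}\in\mathbb R^3$ be arbitrary and define the reduced height function $$\hat h(t)=h-\langle\nabla h,t\rangle+\langle x_0-x_{\mathrm{ref}},\,n_0-\tau\nabla h\rangle .$$ There is a planar field $H$, $C^1$ near every point of $S_\Gamma$, with $\operatorname{div}H=\hat h$ on $S_\Gamma$; and for every such $H$, $$|C^-|=\frac13\sum_k\Big[\langle x_{k,1}-x_{\mathrm{ref}},n_k\rangle\,|F_k^-|+\int_{\partial S_{\Gamma,k}}\langle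 H,n_S\rangle\,dt\Big],$$ with $|F_k^-|$ the area of $F_k^-$ and $dt$ the arc length. **(b)** Suppose that $\tau_1,\tau_2$ are principal tangents of $\Gamma$ at $x_0$ with principal curvatures $\kappa_1,\kappa_2$, i.e. $-Dn_\Gamma(x_0)\tau_i=\kappa_i\tau_i$. Let $\tilde h(t)=\tfrac12(\kappa_1t_1^2+\kappa_2t_2^2)$ be the height of the osculating paraboloid, with level-set function $\tilde\varphi(x)=\langle x-x_0,n_0\rangle-\tilde h(\tau^{\mathsf T}(x-x_0))$. Then $\tilde h(t)-h(t)=o(|t|^2)$ as $t\to0$. For $x_{\mathrm{ref}}=x_0$ the field $\tilde H(t)=-\tfrac16(\kappa_1t_1^3+3\kappa_2t_1t_2^2)\,e_1$ is a primitive on $\mathbb R^2$ of the reduced height function of $\tilde h$. If $\tilde\Gamma=\{x\in C:\tilde\varphi(x)=0\}$ meets every face in a set of zero area and its graph base $S_{\tilde\Gamma}$ is regular closed with a piecewise $C^1$ boundary decomposed by faces as above, then, with $\tilde C^-=\{x\in C:\tilde\varphi(x)\le0\}$ and $\tilde F_k^-=\{x\in F_k:\tilde\varphi(x)\le0\}$,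 $$|\tilde C^-|=\frac13\sum_k\Big[\langle x_{k,1}-x_0,n_k\rangle\,|\tilde F_k^-|+\int_{\partial S_{\tilde\Gamma,k}}-\tfrac16\big(\kappa_1t_1^3+3\kappa_2t_1t_2^2\big)\,\langle e_1,n_S\rangle\,dt\Big].$$ -/

import Mathlib

open Set Filter Topology MeasureTheory

noncomputable section

/-- The plane of tangential coordinates. -/
abbrev E2 : Type := EuclideanSpace ℝ (Fin 2)

/-- The ambient space. -/
abbrev E3 : Type := EuclideanSpace ℝ (Fin 3)

/-- A planar, possibly non-convex, polygonal face in space: the closed region enclosed by a closed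
polygon without self-intersections, together with a choice of unit normal. The compact region is
determined by its polygon: relative to its plane it is regular closed, and its relative boundary is
the union of the edges. -/
structure PolygonalFace where
  /-- the face has `extra + 3` vertices -/
  extra : ℕ
  /-- the cyclically indexed vertices; `poly 0` is the first one -/
  poly : Polygon E3 (extra + 3)
  simple : ∀ i j, ∀ s ∈ Ico (0 : ℝ) 1, ∀ t ∈ Ico (0 : ℝ) 1,
    poly.edgePath ℝ i s = poly.edgePath ℝ j t → i = j ∧ s = t
  region : Set E3
  isCompact : IsCompact region
  planar : Module.finrank ℝ (vectorSpan ℝ region) = 2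
  regular : closure (intrinsicInterior ℝ region) = region
  frontier_eq : intrinsicFrontier ℝ region = poly.boundary ℝ
  normal : E3
  norm_normal : ‖normal‖ = 1
  normal_orthogonal : ∀ x ∈ region, inner ℝ (x - poly 0) normal = 0

/-- The first vertex of a face. -/
def PolygonalFace.first (F : PolygonalFace) : E3 := F.poly 0

/-- A possibly non-convex polyhedron, bounded by finitely many polygonal faces that meet each other
at most along their boundaries; the normals of the faces are the outer ones. -/
structure Polyhedron where
  numFaces : ℕ
  face : Fin numFaces → PolygonalFace
  carrier : Set E3
  isCompact : IsCompact carrier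
  regular : closure (interior carrier) = carrier
  frontier_eq : frontier carrier = ⋃ k, (face k).region
  face_inter : ∀ j k, j ≠ k → (face j).region ∩ (face k).region ⊆ (face j).poly.boundary ℝ
  outward : ∀ k, ∀ x ∈ intrinsicInterior ℝ (face k).region,
    ∀ᶠ ε in 𝓝[>] (0 : ℝ), x + ε • (face k).normal ∉ carrier

/-- The immersed part `{x ∈ A : φ x ≤ 0}` of a set (a cell, or one of its faces). -/
def immersed (φ : E3 → ℝ) (A : Set E3) : Set E3 := {x ∈ A | φ x ≤ 0}

/-- The patch of the zero level set of `φ` inside a set. -/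
def patch (φ : E3 → ℝ) (A : Set E3) : Set E3 := {x ∈ A | φ x = 0}

/-- The unit normal `∇φ / |∇φ|` of the level sets of `φ`; on the zero level set it points out of
`{φ ≤ 0}`. -/
def unitNormal (φ : E3 → ℝ) (x : E3) : E3 := ‖gradient φ x‖⁻¹ • gradient φ x

/-- A base point with an orthonormal basis; `basis 0` and `basis 1` are the tangents `τ₁`, `τ₂` and
`basis 2` is the normal `n₀`. -/
structure Frame where
  base : E3
  basis : OrthonormalBasis (Fin 3) ℝ E3

namespace Frame

/-- The tangential coordinates `t = τᵀ (x - x₀)`. -/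
def tangential (B : Frame) (x : E3) : E2 :=
  !₂[inner ℝ (B.basis 0) (x - B.base), inner ℝ (B.basis 1) (x - B.base)]

/-- The parametrization `t ↦ x₀ + τ t + h(t) n₀` of the graph of a height function. -/
def graphMap (B : Frame) (h : E2 → ℝ) (t : E2) : E3 :=
  B.base + (t 0 • B.basis 0 + t 1 • B.basis 1) + h t • B.basis 2

/-- The graph base: the tangential projection of the patch. -/
def graphBase (B : Frame) (φ : E3 → ℝ) (A : Set E3) : Set E2 := B.tangential '' patch φ A

/-- The reduced height function
`ĥ = h - ⟨∇h, t⟩ + ⟨x₀ - x_ref, n₀ - τ ∇h⟩`. -/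
def reducedHeight (B : Frame) (h : E2 → ℝ) (xref : E3) (t : E2) : ℝ :=
  h t - inner ℝ (gradient h t) t +
    inner ℝ (B.base - xref)
      (B.basis 2 - ((gradient h t) 0 • B.basis 0 + (gradient h t) 1 • B.basis 1))

end Frame

/-- The patch in `A` of the zero level set of `φ` is a `C²` hypersurface that is the graph of `h`
over the plane of the frame, and its normal `∇φ / |∇φ|` is the upward normal
`(n₀ - τ ∇h) / √(1 + |∇h|²)` of the graph (only its sign has to be prescribed). -/
structure IsGraphPatch (B : Frame) (φ : E3 → ℝ) (h : E2 → ℝ) (A : Set E3) : Prop where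
  continuousOn : ContinuousOn φ A
  contDiffAt : ∀ x ∈ patch φ A, ContDiffAt ℝ 2 φ x
  oriented : ∀ x ∈ patch φ A, 0 < inner ℝ (unitNormal φ x) (B.basis 2)
  height_contDiffAt : ∀ t ∈ B.graphBase φ A, ContDiffAt ℝ 2 h t
  eq_graph : patch φ A = B.graphMap h '' B.graphBase φ A

/-- The planar divergence. -/
def planarDiv (H : E2 → E2) (t : E2) : ℝ :=
  ∑ i, (fderiv ℝ H t (EuclideanSpace.single i 1)) i

/-- `H` is a (`C¹`) primitive of `g` on `S`: `div H = g`. -/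
def IsPlanarPrimitive (S : Set E2) (g : E2 → ℝ) (H : E2 → E2) : Prop :=
  ∀ t ∈ S, ContDiffAt ℝ 1 H t ∧ planarDiv H t = g t

/-- A piecewise `C¹` boundary of a planar domain `S`, decomposed into `N` parts: the `k`-th part is
the union of the finitely many regular `C¹` arcs `arc k m`, and it lies in the set `piece k`.
Distinct arcs meet at most in end points. The field `normal` is the outer unit normal at all points
other than end points of arcs. -/
structure PiecewiseBoundary (S : Set E2) {N : ℕ} (piece : Fin N → Set E2) where
  regular : closure (interior S) = S
  count : Fin N → ℕ
  arc : (k : Fin N) → Fin (count k) → ℝ → E2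
  contDiffOn : ∀ k m, ContDiffOn ℝ 1 (arc k m) (Icc 0 1)
  deriv_ne_zero : ∀ k m, ∀ s ∈ Icc (0 : ℝ) 1, derivWithin (arc k m) (Icc 0 1) s ≠ 0
  simple : ∀ k m k' m', ∀ s ∈ Ioo (0 : ℝ) 1, ∀ s' ∈ Icc (0 : ℝ) 1,
    arc k m s = arc k' m' s' →
      (⟨k, m⟩ : (k : Fin N) × Fin (count k)) = ⟨k', m'⟩ ∧ s = s'
  arc_mem : ∀ k m, ∀ s ∈ Icc (0 : ℝ) 1, arc k m s ∈ piece k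
  cover : frontier S = ⋃ k, ⋃ m, arc k m '' Icc 0 1
  normal : E2 → E2
  norm_normal : ∀ k m, ∀ s ∈ Ioo (0 : ℝ) 1, ‖normal (arc k m s)‖ = 1
  normal_orthogonal : ∀ k m, ∀ s ∈ Ioo (0 : ℝ) 1,
    inner ℝ (normal (arc k m s)) (deriv (arc k m) s) = 0
  outward : ∀ k m, ∀ s ∈ Ioo (0 : ℝ) 1,
    ∀ᶠ ε in 𝓝[>] (0 : ℝ), arc k m s + ε • normal (arc k m s) ∉ S

/-- The line integral of `g` over the `k`-th part of the boundary, with respect to arc length. -/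
def PiecewiseBoundary.lineIntegral {S : Set E2} {N : ℕ} {piece : Fin N → Set E2}
    (D : PiecewiseBoundary S piece) (k : Fin N) (g : E2 → ℝ) : ℝ :=
  ∑ m, ∫ s in (0 : ℝ)..1, g (D.arc k m s) * ‖deriv (D.arc k m) s‖

/-- Boundary of the graph base of the patch in a polyhedron `C`, decomposed face by face: the `k`-th
part is mapped into the `k`-th face by the parametrization of the graph. -/
abbrev FaceBoundary (C : Polyhedron) (B : Frame) (φ : E3 → ℝ) (h : E2 → ℝ) : Type :=
  PiecewiseBoundary (B.graphBase φ C.carrier) fun k => B.graphMap h ⁻¹' (C.face k).region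

/-- The level set of `φ` meets every face of `C` in a set of zero area. -/
def MeetsFacesInNullSets (C : Polyhedron) (φ : E3 → ℝ) : Prop :=
  ∀ k, (μHE[2] : Measure E3) (patch φ (C.face k).region) = 0

/-- `τ₁`, `τ₂` are principal tangents of the level set of `φ` at the base point of the frame, with
principal curvatures `κ 0`, `κ 1`: they are eigenvectors of the Weingarten map `-Dn`. -/
def IsPrincipal (B : Frame) (φ : E3 → ℝ) (κ : Fin 2 → ℝ) : Prop :=
  -fderiv ℝ (unitNormal φ) B.base (B.basis 0) = κ 0 • B.basis 0 ∧
    -fderiv ℝ (unitNormal φ) B.base (B.basis 1) = κ 1 • B.basis 1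

/-- The height `(κ₁ t₁² + κ₂ t₂²) / 2` of a paraboloid. -/
def paraboloidHeight (κ : Fin 2 → ℝ) (t : E2) : ℝ := (κ 0 * t 0 ^ 2 + κ 1 * t 1 ^ 2) / 2

/-- The level-set function of a paraboloid,
`⟨x - x₀, n₀⟩ - (κ₁ t₁² + κ₂ t₂²) / 2` with `t = τᵀ (x - x₀)`. -/
def paraboloidLevel (B : Frame) (κ : Fin 2 → ℝ) (x : E3) : ℝ :=
  inner ℝ (x - B.base) (B.basis 2) - paraboloidHeight κ (B.tangential x)

/-- The planar field `-(1/6) (κ₁ t₁³ + 3 κ₂ t₁ t₂²) e₁`. -/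
def paraboloidPrimitive (κ : Fin 2 → ℝ) (t : E2) : E2 :=
  !₂[-(1 / 6) * (κ 0 * t 0 ^ 3 + 3 * κ 1 * t 0 * t 1 ^ 2), 0]

end

/-! Part (a) is the divergence theorem used twice. On `C⁻` the field `x - xref` has divergence 3.
Its normal component on a planar face is the constant `⟨first - xref, normal⟩`, and on the patch `⟨x
- xref, n_Γ⟩` times the area element `√(1 + |∇h|²) dt` is `ĥ dt`, with `ĥ` the reduced height. So
`3|C⁻|` is a sum over the faces plus `∫ ĥ` over the graph base, and the planar divergence theorem
for a primitive of `ĥ` moves this integral to the boundary arcs.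

The set `C⁻` is never treated as a domain with boundary. The indicator of `φ ≤ 0` is replaced by
`u_ε = smoothStep (φ / ε)`, and the divergence theorem is applied on the whole polyhedron to `u_ε (x
- xref)` (`Polyhedron.setIntegral_radial`). As `ε → 0+`, `u_ε` tends to the indicator while its
derivative concentrates on the patch: Fubini along `n₀` and dominated convergence give the limit `-∫
ĥ` for `∫ Du_ε (x - xref)` (`IsGraphPatch.tendsto_integral_stepDeriv`). The outcome is
`IsGraphPatch.three_mul_volume_immersed`.

Both divergence theorems (`Polyhedron.setIntegral_lineDeriv`,
`PiecewiseBoundary.setIntegral_partial`) reduce to the fundamental theorem of calculus on almost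
every line of a fixed direction. Such a line meets the domain in finitely many intervals that end in
transversal crossings of the boundary; the sign of the normal component tells exit from entry, and
an area formula turns the integral over the lines into a boundary integral.

A primitive exists because `ĥ` is `C¹` near the compact base: cut off and integrate in one
coordinate. For (b), the tangency identity `⟨n, τw⟩ + Dh(w) ⟨n, n₀⟩ = 0` is differentiated along the
graph at the base point, where `Dh = 0`; the Hessian of `h` there is `diag(κ₁, κ₂)`, that of the
paraboloid. The paraboloid is itself a graph patch, so the formula of (a) applies to it with an
explicit primitive. -/

noncomputable section

/-! ### Sets near a two-sided piece of their frontier -/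

/-- Off the frontier the space is the disjoint union of the open sets `interior C` and `(closure
C)ᶜ`, and a connected set cannot meet both. -/
theorem IsPreconnected.subset_interior_of_disjoint_frontier {X : Type*} [TopologicalSpace X]
    {C T : Set X} (hT : IsPreconnected T) (hd : Disjoint T (frontier C))
    (hne : (T ∩ C).Nonempty) : T ⊆ interior C := by
  have hsub : T ⊆ interior C ∪ (closure C)ᶜ := by
    intro x hx
    by_cases hc : x ∈ closure C
    · by_contra h
      exact hd.le_bot ⟨hx, hc, fun hi => h (Or.inl hi)⟩
    · exact Or.inr hc
  refine hT.subset_left_of_subset_union isOpen_interior isClosed_closure.isOpen_compl ?_ hsub ?_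
  · exact disjoint_compl_right.mono_left (interior_subset.trans subset_closure)
  · obtain ⟨x, hx, hxC⟩ := hne
    rcases hsub hx with h | h
    · exact ⟨x, hx, h⟩
    · exact absurd (subset_closure hxC) h

/-- If a neighbourhood of a point of a regular closed set `C` consists of two connected sides `T₁`,
`T₂` that avoid the frontier and of points of the frontier, and if `T₁` is not contained in `C`,
then `T₁` is outside `C` and `T₂` is inside. -/
theorem disjoint_and_subset_interior_of_sides {X : Type*} [TopologicalSpace X]
    {C T₁ T₂ U : Set X} {x : X} (hreg : closure (interior C) = C) (hx : x ∈ C) (hU : U ∈ 𝓝 x)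
    (hcov : U ⊆ T₁ ∪ T₂ ∪ frontier C) (h₁ : IsPreconnected T₁) (h₂ : IsPreconnected T₂)
    (hd₁ : Disjoint T₁ (frontier C)) (hd₂ : Disjoint T₂ (frontier C))
    (hout : ∃ y ∈ T₁, y ∉ C) : Disjoint T₁ C ∧ T₂ ⊆ interior C := by
  have hT₁ : Disjoint T₁ C := by
    rw [Set.disjoint_iff_inter_eq_empty, ← Set.not_nonempty_iff_eq_empty]
    intro hne
    obtain ⟨y, hy, hyC⟩ := hout
    exact hyC (interior_subset (h₁.subset_interior_of_disjoint_frontier hd₁ hne hy))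
  refine ⟨hT₁, h₂.subset_interior_of_disjoint_frontier hd₂ ?_⟩
  -- If `T₂` missed `C` as well, `U` would contain no interior point of `C`, although regular
  -- closedness puts such points arbitrarily close to `x`.
  by_contra hne
  rw [← hreg, mem_closure_iff_nhds] at hx
  obtain ⟨y, hyU, hyi⟩ := hx U hU
  rcases hcov hyU with (h | h) | h
  · exact hT₁.le_bot ⟨h, interior_subset hyi⟩
  · exact hne ⟨y, h, interior_subset hyi⟩
  · exact h.2 hyi

/-! ### The fundamental theorem of calculus on a finite union of intervals -/

/-- Near `p`, the set `K ⊆ ℝ` is a half-line that ends in `p`; the sign `σ` points outward. -/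
def IsEndpoint (K : Set ℝ) (p σ : ℝ) : Prop :=
  (σ = 1 ∨ σ = -1) ∧ ∀ᶠ ε in 𝓝[>] (0 : ℝ), p + σ * ε ∉ K ∧ p - σ * ε ∈ K

theorem IsEndpoint.mem {K : Set ℝ} {p σ : ℝ} (h : IsEndpoint K p σ) (hK : IsClosed K) : p ∈ K := by
  have ht : Tendsto (fun ε : ℝ => p - σ * ε) (𝓝[>] 0) (𝓝 p) := by
    have : Continuous fun ε : ℝ => p - σ * ε := by fun_prop
    simpa using (this.tendsto 0).mono_left nhdsWithin_le_nhds
  exact hK.mem_of_tendsto ht (h.2.mono fun _ h => h.2)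

/-- Strong induction on the set of endpoints. `IsEndpoint` rules out isolated points and touching
intervals, so the two greatest endpoints `a < b` bound the last interval of `K`. The fundamental
theorem applies there, and the rest of `K` has the endpoints `P \ {a, b}`. -/
theorem setIntegral_eq_sum_endpoints (f f' σ : ℝ → ℝ) (P : Finset ℝ) :
    ∀ K : Set ℝ, IsCompact K → frontier K ⊆ P → (∀ p ∈ P, IsEndpoint K p (σ p)) →
      ContinuousOn f K → (∀ z ∈ K, z ∉ P → HasDerivAt f (f' z) z) → IntegrableOn f' K →
      ∫ z in K, f' z = ∑ p ∈ P, σ p * f p := by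
  induction P using Finset.strongInduction with
  | H P ih =>
  intro K hK hfr hend hf hf' hint
  rcases K.eq_empty_or_nonempty with rfl | hne
  · have : P = ∅ := by
      rw [Finset.eq_empty_iff_forall_notMem]
      intro p hp
      exact (hend p hp).mem isClosed_empty
    simp [this]
  have hKc := hK.isClosed
  -- the greatest point
  obtain ⟨b, hbK, hb⟩ := hK.exists_isGreatest hne
  have hlarge : ∀ z, b < z → z ∉ K := fun z hz hzK => absurd (hb hzK) (not_le.2 hz)
  have hbP : b ∈ P := by
    apply hfr
    rw [hKc.frontier_eq]
    refine ⟨hbK, fun hi => ?_⟩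
    have h1 : ∀ᶠ z in 𝓝[>] b, z ∈ K := nhdsWithin_le_nhds (mem_interior_iff_mem_nhds.1 hi)
    obtain ⟨z, hz, hzK⟩ := (h1.and self_mem_nhdsWithin).exists
    exact hlarge z hzK hz
  have pos : ∀ᶠ ε in 𝓝[>] (0 : ℝ), 0 < ε := self_mem_nhdsWithin
  -- Nothing of `K` lies to the right of its greatest point, so the outward direction at `b` is the
  -- positive one.
  have hσb : σ b = 1 := by
    rcases (hend b hbP).1 with h | h
    · exact h
    · obtain ⟨ε, h1, h2⟩ := ((hend b hbP).2.and pos).exists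
      rw [h] at h1
      exact absurd h1.2 (hlarge _ (by linarith))
  have hbleft : ∀ᶠ ε in 𝓝[>] (0 : ℝ), b - ε ∈ K := by
    filter_upwards [(hend b hbP).2] with ε h
    simpa [hσb] using h.2
  -- the least point
  obtain ⟨c, hcK, hc⟩ := hK.exists_isLeast hne
  have hcP : c ∈ P := by
    apply hfr
    rw [hKc.frontier_eq]
    refine ⟨hcK, fun hi => ?_⟩
    have h1 : ∀ᶠ z in 𝓝[<] c, z ∈ K := nhdsWithin_le_nhds (mem_interior_iff_mem_nhds.1 hi)
    obtain ⟨z, hz, hzK⟩ := (h1.and self_mem_nhdsWithin).exists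
    exact absurd (hc hz) (not_le.2 hzK)
  have hcb : c < b := by
    obtain ⟨ε, h1, h2⟩ := (hbleft.and pos).exists
    have := hc h1
    linarith
  have hPe : (P.erase b).Nonempty := ⟨c, Finset.mem_erase.2 ⟨hcb.ne, hcP⟩⟩
  obtain ⟨a, ha, hamax⟩ : ∃ a ∈ P.erase b, ∀ x ∈ P.erase b, x ≤ a :=
    ⟨_, Finset.max'_mem _ hPe, fun x hx => Finset.le_max' _ x hx⟩
  have haP := Finset.mem_of_mem_erase ha
  have hab : a < b := lt_of_le_of_ne (hb ((hend a haP).mem hKc)) (Finset.ne_of_mem_erase ha)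
  -- No endpoint lies strictly between `a` and `b`, and `K` contains points just to the left of `b`.
  have hIoo : Ioo a b ⊆ interior K := by
    apply isPreconnected_Ioo.subset_interior_of_disjoint_frontier
    · rw [Set.disjoint_left]
      intro z hz hzf
      exact absurd (hamax z (Finset.mem_erase.2 ⟨hz.2.ne, hfr hzf⟩)) (not_le.2 hz.1)
    · have h1 : ∀ᶠ ε in 𝓝[>] (0 : ℝ), ε < b - a :=
        nhdsWithin_le_nhds (Iio_mem_nhds (by linarith))
      obtain ⟨ε, ⟨h1, h2⟩, h3⟩ := ((hbleft.and pos).and h1).exists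
      exact ⟨b - ε, ⟨by linarith, by linarith⟩, h1⟩
  have hIcc : Icc a b ⊆ K := by
    rw [← closure_Ioo hab.ne]
    exact closure_minimal (hIoo.trans interior_subset) hKc
  have hσa : σ a = -1 := by
    rcases (hend a haP).1 with h | h
    · have h1 : ∀ᶠ ε in 𝓝[>] (0 : ℝ), ε < b - a :=
        nhdsWithin_le_nhds (Iio_mem_nhds (by linarith))
      obtain ⟨ε, ⟨h1, h2⟩, h3⟩ := (((hend a haP).2.and pos).and h1).exists
      rw [h] at h1
      exact absurd (hIcc ⟨by linarith, by linarith⟩) h1.1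
    · exact h
  -- There is a gap of `K` to the left of `a`; because of it the remainder `K ∩ Iio a` is still
  -- compact.
  obtain ⟨δ, hδ0, hδ⟩ : ∃ δ > 0, ∀ ε ∈ Ioo 0 δ, a - ε ∉ K := by
    have : ∀ᶠ ε in 𝓝[>] (0 : ℝ), a - ε ∉ K := by
      filter_upwards [(hend a haP).2] with ε h
      have := h.1
      rw [hσa] at this
      convert this using 2
      ring
    obtain ⟨δ, h0, h1⟩ := mem_nhdsGT_iff_exists_Ioo_subset.1 this
    exact ⟨δ, h0, h1⟩
  have hK'eq : K ∩ Iio a = K ∩ Iic (a - δ) := by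
    ext z
    refine ⟨fun ⟨h1, h2⟩ => ⟨h1, ?_⟩, fun ⟨h1, h2⟩ => ⟨h1, ?_⟩⟩
    · by_contra h3
      simp only [mem_Iio, mem_Iic, not_le] at h2 h3
      exact hδ (a - z) ⟨by linarith, by linarith⟩ (by simpa using h1)
    · simp only [mem_Iic, mem_Iio] at h2 ⊢
      linarith
  have hK'c : IsCompact (K ∩ Iio a) := by
    rw [hK'eq]; exact hK.inter_right isClosed_Iic
  have hsplit : K = (K ∩ Iio a) ∪ Icc a b := by
    ext z
    refine ⟨fun h => ?_, fun h => h.elim (fun h => h.1) fun h => hIcc h⟩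
    rcases lt_or_ge z a with h1 | h1
    · exact Or.inl ⟨h, h1⟩
    · exact Or.inr ⟨h1, hb h⟩
  have hdisj : Disjoint (K ∩ Iio a) (Icc a b) := by
    rw [Set.disjoint_left]
    exact fun z h1 h2 => absurd h1.2 (not_lt.2 h2.1)
  have hlt : ∀ p ∈ (P.erase b).erase a, p < a := fun p hp =>
    lt_of_le_of_ne (hamax p (Finset.mem_of_mem_erase hp)) (Finset.ne_of_mem_erase hp)
  have key := ih ((P.erase b).erase a)
    ((Finset.erase_subset _ _).trans_ssubset (Finset.erase_ssubset hbP)) (K ∩ Iio a) hK'c ?_ ?_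
    (hf.mono inter_subset_left) ?_ (hint.mono_set inter_subset_left)
  · have hI : ∫ z in Icc a b, f' z = f b - f a := by
      rw [integral_Icc_eq_integral_Ioc, ← intervalIntegral.integral_of_le hab.le]
      apply intervalIntegral.integral_eq_sub_of_hasDerivAt_of_le hab.le (hf.mono hIcc)
      · intro z hz
        refine hf' z (hIcc (Ioo_subset_Icc_self hz)) fun hzP => ?_
        exact absurd (hamax z (Finset.mem_erase.2 ⟨hz.2.ne, hzP⟩)) (not_le.2 hz.1)
      · rw [intervalIntegrable_iff_integrableOn_Icc_of_le hab.le]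
        exact hint.mono_set hIcc
    rw [hsplit, setIntegral_union hdisj measurableSet_Icc (hint.mono_set inter_subset_left)
      (hint.mono_set hIcc), key, hI, ← Finset.add_sum_erase P _ hbP, ← Finset.add_sum_erase _ _ ha,
      hσa, hσb]
    ring
  · intro z hz
    have hzK' := hK'c.isClosed.frontier_subset hz
    have hzf : z ∈ frontier K := by
      rw [hKc.frontier_eq]
      refine ⟨hzK'.1, fun hi => ?_⟩
      have : z ∈ interior (K ∩ Iio a) := by
        rw [interior_inter]
        exact ⟨hi, by rw [interior_Iio]; exact hzK'.2⟩
      exact hz.2 this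
    have hza : z < a := hzK'.2
    exact Finset.mem_erase.2 ⟨hza.ne, Finset.mem_erase.2 ⟨(hza.trans hab).ne, hfr hzf⟩⟩
  · intro p hp
    have hpa := hlt p hp
    have hpP := Finset.mem_of_mem_erase (Finset.mem_of_mem_erase hp)
    refine ⟨(hend p hpP).1, ?_⟩
    have hc : Tendsto (fun ε : ℝ => p - σ p * ε) (𝓝[>] 0) (𝓝 p) := by
      have : Continuous fun ε : ℝ => p - σ p * ε := by fun_prop
      simpa using (this.tendsto 0).mono_left nhdsWithin_le_nhds
    filter_upwards [(hend p hpP).2, hc (Iio_mem_nhds hpa)] with ε h1 h2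
    exact ⟨fun h => h1.1 h.1, h1.2, h2⟩
  · intro z hz hzP
    refine hf' z hz.1 fun h => hzP ?_
    have hza : z < a := hz.2
    exact Finset.mem_erase.2 ⟨hza.ne, Finset.mem_erase.2 ⟨(hza.trans hab).ne, h⟩⟩

/-- In the applications the endpoints are crossings labelled by faces or by arc parameters. Distinct
labels give distinct points, so signs and sums can be transported along `pos`. -/
theorem setIntegral_eq_sum_indexed_endpoints {ι : Type*} (T : Finset ι) (pos sgn : ι → ℝ)
    (hinj : Set.InjOn pos T) {f f' : ℝ → ℝ} {K : Set ℝ} (hK : IsCompact K)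
    (hfr : ∀ z ∈ frontier K, ∃ i ∈ T, pos i = z) (hend : ∀ i ∈ T, IsEndpoint K (pos i) (sgn i))
    (hf : ContinuousOn f K) (hf' : ∀ z ∈ K, (∀ i ∈ T, pos i ≠ z) → HasDerivAt f (f' z) z)
    (hint : IntegrableOn f' K) :
    ∫ z in K, f' z = ∑ i ∈ T, sgn i * f (pos i) := by
  classical
  -- `Function.invFunOn` needs an inhabited index type, hence the separate empty case.
  rcases T.eq_empty_or_nonempty with rfl | ⟨i₀, hi₀⟩
  · rw [setIntegral_eq_sum_endpoints f f' (fun _ => 0) ∅ K hK (fun z hz => by simpa using hfr z hz)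
      (by simp) hf (fun z hz _ => hf' z hz (by simp)) hint]
    simp
  have : Nonempty ι := ⟨i₀⟩
  have hinv : ∀ i ∈ T, Function.invFunOn pos (T : Set ι) (pos i) = i := fun i hi =>
    hinj (Function.invFunOn_mem ⟨i, hi, rfl⟩) hi (Function.invFunOn_eq ⟨i, hi, rfl⟩)
  rw [setIntegral_eq_sum_endpoints f f' (fun z => sgn (Function.invFunOn pos (T : Set ι) z))
    (T.image pos) K hK ?_ ?_ hf ?_ hint, Finset.sum_image hinj]
  · exact Finset.sum_congr rfl fun i hi => by rw [hinv i hi]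
  · intro z hz
    obtain ⟨i, hi, rfl⟩ := hfr z hz
    exact Finset.mem_coe.2 (Finset.mem_image_of_mem pos hi)
  · intro p hp
    obtain ⟨i, hi, rfl⟩ := Finset.mem_image.1 hp
    rw [hinv i hi]
    exact hend i hi
  · intro z hz hzP
    exact hf' z hz fun i hi h => hzP (Finset.mem_image.2 ⟨i, hi, h⟩)

/-! ### Coordinates of a frame -/

namespace Frame

/-- The point with given tangential coordinates and height. -/
def chart (B : Frame) (p : E2 × ℝ) : E3 :=
  B.base + (p.1 0 • B.basis 0 + p.1 1 • B.basis 1) + p.2 • B.basis 2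

/-- The height of a point over the plane of the frame. -/
def height (B : Frame) (x : E3) : ℝ := inner ℝ (B.basis 2) (x - B.base)

theorem inner_basis (B : Frame) (i j : Fin 3) :
    inner ℝ (B.basis i) (B.basis j) = if i = j then (1 : ℝ) else 0 :=
  orthonormal_iff_ite.1 B.basis.orthonormal i j

theorem sum_inner_basis (B : Frame) (v : E3) :
    inner ℝ (B.basis 0) v • B.basis 0 + inner ℝ (B.basis 1) v • B.basis 1 +
      inner ℝ (B.basis 2) v • B.basis 2 = v := by
  have := B.basis.sum_repr' v
  rwa [Fin.sum_univ_three] at this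

theorem inner_eq_sum (B : Frame) (v w : E3) :
    inner ℝ v w = inner ℝ (B.basis 0) v * inner ℝ (B.basis 0) w +
      inner ℝ (B.basis 1) v * inner ℝ (B.basis 1) w +
      inner ℝ (B.basis 2) v * (inner ℝ (B.basis 2) w : ℝ) := by
  rw [← B.basis.sum_inner_mul_inner v w, Fin.sum_univ_three]
  simp only [real_inner_comm]

@[simp] theorem tangential_chart (B : Frame) (p : E2 × ℝ) : B.tangential (B.chart p) = p.1 := by
  ext i
  fin_cases i <;>
    simp [tangential, chart, add_assoc, inner_add_right, inner_smul_right, B.inner_basis]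

@[simp] theorem height_chart (B : Frame) (p : E2 × ℝ) : B.height (B.chart p) = p.2 := by
  simp [height, chart, add_assoc, inner_add_right, inner_smul_right, B.inner_basis]

@[simp] theorem chart_coordinates (B : Frame) (x : E3) :
    B.chart (B.tangential x, B.height x) = x := by
  have := B.sum_inner_basis (x - B.base)
  simp only [chart, tangential, height]
  simp only [Matrix.cons_val_zero, Matrix.cons_val_one]
  rw [add_assoc, this]
  abel

theorem continuous_chart (B : Frame) : Continuous B.chart := by
  unfold chart; fun_prop

theorem continuous_tangential (B : Frame) : Continuous B.tangential := by
  unfold tangential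
  refine (PiLp.continuous_toLp 2 _).comp (continuous_pi fun i => ?_)
  fin_cases i <;> simp <;> fun_prop

theorem continuous_height (B : Frame) : Continuous B.height := by
  unfold height; fun_prop

/-- The chart as a homeomorphism. -/
def chartHomeomorph (B : Frame) : E2 × ℝ ≃ₜ E3 where
  toFun := B.chart
  invFun x := (B.tangential x, B.height x)
  left_inv p := by simp
  right_inv x := by simp
  continuous_toFun := B.continuous_chart
  continuous_invFun := B.continuous_tangential.prodMk B.continuous_height

/-- The chart is a composition of volume-preserving maps: a swap of factors, the identification of
`ℝ × ℝ²` with `ℝ³` that puts the height in slot 2, the isometry of the orthonormal basis, and a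
translation. -/
theorem measurePreserving_chart (B : Frame) : MeasurePreserving B.chart := by
  have h1 : MeasurePreserving (fun p : E2 × ℝ => (p.2, (WithLp.ofLp p.1 : Fin 2 → ℝ))) :=
    ((MeasurePreserving.id (volume : Measure ℝ)).prod
      (PiLp.volume_preserving_ofLp (Fin 2))).comp Measure.measurePreserving_swap
  have h2 := (volume_preserving_piFinSuccAbove (fun _ : Fin 3 => ℝ) 2).symm
  have h3 := PiLp.volume_preserving_toLp (Fin 3)
  have h4 := B.basis.measurePreserving_repr_symm
  have h5 := measurePreserving_add_left (volume : Measure E3) B.base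
  have h := h5.comp (h4.comp (h3.comp (h2.comp h1)))
  refine (congrArg (fun f => MeasurePreserving f volume volume) (funext fun p => ?_)).mpr h
  simp only [Function.comp_apply, chart, add_assoc]
  congr 1
  rw [← B.basis.sum_repr_symm, Fin.sum_univ_three]
  change _ = (2 : Fin 3).insertNth (α := fun _ => ℝ) p.2 (WithLp.ofLp p.1) 0 • _ +
    (2 : Fin 3).insertNth (α := fun _ => ℝ) p.2 (WithLp.ofLp p.1) 1 • _ +
    (2 : Fin 3).insertNth (α := fun _ => ℝ) p.2 (WithLp.ofLp p.1) 2 • _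
  have e0 : (2 : Fin 3).insertNth (α := fun _ => ℝ) p.2 (WithLp.ofLp p.1) 0 = p.1 0 := rfl
  have e1 : (2 : Fin 3).insertNth (α := fun _ => ℝ) p.2 (WithLp.ofLp p.1) 1 = p.1 1 := rfl
  have e2 : (2 : Fin 3).insertNth (α := fun _ => ℝ) p.2 (WithLp.ofLp p.1) 2 = p.2 := rfl
  rw [e0, e1, e2, add_assoc]

/-- The part of the vertical line over `t` in a set. -/
def fiber (B : Frame) (C : Set E3) (t : E2) : Set ℝ := {z | B.chart (t, z) ∈ C}

theorem continuous_chart_fiber (B : Frame) (t : E2) : Continuous fun z => B.chart (t, z) :=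
  B.continuous_chart.comp (by fun_prop)

theorem isCompact_fiber (B : Frame) {C : Set E3} (hC : IsCompact C) (t : E2) :
    IsCompact (B.fiber C t) := by
  refine (hC.image B.continuous_height).of_isClosed_subset
    (hC.isClosed.preimage (B.continuous_chart_fiber t)) fun z hz => ⟨_, hz, by simp⟩

theorem measurableSet_fiber (B : Frame) {C : Set E3} (hC : IsCompact C) (t : E2) :
    MeasurableSet (B.fiber C t) :=
  (B.isCompact_fiber hC t).measurableSet

theorem integrableOn_chart (B : Frame) {C : Set E3} {g : E3 → ℝ} (hg : IntegrableOn g C) :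
    IntegrableOn (g ∘ B.chart) (B.chart ⁻¹' C) :=
  (B.measurePreserving_chart.integrableOn_comp_preimage
    B.chartHomeomorph.measurableEmbedding).2 hg

theorem integrableOn_fiber (B : Frame) {C : Set E3} (hC : IsCompact C) {g : E3 → ℝ}
    (hg : IntegrableOn g C) :
    ∀ᵐ t : E2, IntegrableOn (fun z => g (B.chart (t, z))) (B.fiber C t) := by
  have hm : MeasurableSet (B.chart ⁻¹' C) := (hC.isClosed.preimage B.continuous_chart).measurableSet
  have h := (integrable_indicator_iff hm).2 (B.integrableOn_chart hg)
  filter_upwards [h.prod_right_ae] with t ht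
  rwa [← integrable_indicator_iff (B.measurableSet_fiber hC t)]

theorem setIntegral_eq_integral_fiber (B : Frame) {C : Set E3} (hC : IsCompact C) {g : E3 → ℝ}
    (hg : IntegrableOn g C) :
    ∫ x in C, g x = ∫ t : E2, ∫ z in B.fiber C t, g (B.chart (t, z)) := by
  have hm : MeasurableSet (B.chart ⁻¹' C) := (hC.isClosed.preimage B.continuous_chart).measurableSet
  rw [← B.measurePreserving_chart.setIntegral_preimage_emb B.chartHomeomorph.measurableEmbedding,
    ← integral_indicator hm, Measure.volume_eq_prod, integral_prod]
  · congr 1 with t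
    rw [← integral_indicator (B.measurableSet_fiber hC t)]
    rfl
  · exact (integrable_indicator_iff hm).2 (B.integrableOn_chart hg)

theorem integrable_integral_fiber (B : Frame) {C : Set E3} (hC : IsCompact C) {g : E3 → ℝ}
    (hg : IntegrableOn g C) :
    Integrable fun t : E2 => ∫ z in B.fiber C t, g (B.chart (t, z)) := by
  have hm : MeasurableSet (B.chart ⁻¹' C) := (hC.isClosed.preimage B.continuous_chart).measurableSet
  have h := ((integrable_indicator_iff hm).2 (B.integrableOn_chart hg)).integral_prod_left
  refine h.congr (Eventually.of_forall fun t => ?_)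
  dsimp only
  rw [← integral_indicator (B.measurableSet_fiber hC t)]
  rfl

/-! ### Areas in planes -/

/-- The plane of a frame. -/
def plane (A : Frame) : Set E3 := {x | A.height x = 0}

/-- The isometric parametrization of the plane of a frame. -/
def flat (A : Frame) (s : E2) : E3 := A.chart (s, 0)

theorem continuous_flat (A : Frame) : Continuous A.flat :=
  A.continuous_chart.comp (by fun_prop)

theorem flat_tangential (A : Frame) {x : E3} (hx : x ∈ A.plane) : A.flat (A.tangential x) = x := by
  have := A.chart_coordinates x
  rwa [show A.height x = 0 from hx] at this

theorem range_flat (A : Frame) : range A.flat = A.plane := by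
  ext x
  constructor
  · rintro ⟨s, rfl⟩
    exact A.height_chart (s, 0)
  · exact fun hx => ⟨_, A.flat_tangential hx⟩

theorem isometry_flat (A : Frame) : Isometry A.flat := by
  refine Isometry.of_dist_eq fun s s' => ?_
  rw [dist_eq_norm, dist_eq_norm, ← sq_eq_sq₀ (norm_nonneg _) (norm_nonneg _),
    EuclideanSpace.real_norm_sq_eq (s - s'), ← real_inner_self_eq_norm_sq, A.inner_eq_sum,
    Fin.sum_univ_two]
  have : A.flat s - A.flat s' =
      (s 0 - s' 0) • A.basis 0 + (s 1 - s' 1) • A.basis 1 := by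
    simp only [flat, chart]; module
  simp [this, inner_add_right, inner_smul_right, A.inner_basis]
  ring

/-- `μHE[2]` is invariant under isometries and is normalised to be Lebesgue measure on `E2`, so
areas in a plane are computed in its isometric parametrization. -/
theorem setIntegral_plane (A : Frame) {R : Set E3} (hR : R ⊆ A.plane) (hm : MeasurableSet R)
    (g : E3 → ℝ) :
    ∫ x in R, g x ∂(μHE[2] : Measure E3) = ∫ s in A.flat ⁻¹' R, g (A.flat s) := by
  have h := A.isometry_flat.map_euclideanHausdorffMeasure (d := 2)
  have he : MeasurableEmbedding A.flat := A.isometry_flat.isClosedEmbedding.measurableEmbedding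
  rw [EuclideanSpace.euclideanHausdorffMeasure_eq_volume] at h
  rw [← he.setIntegral_map, h, A.range_flat, Measure.restrict_restrict hm,
    inter_eq_self_of_subset_left hR]

theorem measure_plane (A : Frame) {R : Set E3} (hR : R ⊆ A.plane) :
    (μHE[2] : Measure E3) R = volume (A.flat ⁻¹' R) := by
  rw [← EuclideanSpace.euclideanHausdorffMeasure_eq_volume,
    A.isometry_flat.euclideanHausdorffMeasure_preimage, A.range_flat,
    inter_eq_self_of_subset_left hR]

/-- The matrix of inner products of two bases. -/
def transition (A B : Frame) : Matrix (Fin 3) (Fin 3) ℝ :=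
  Matrix.of fun i j => inner ℝ (B.basis i) (A.basis j)

theorem transition_mul_transpose (A B : Frame) :
    A.transition B * (A.transition B).transpose = 1 := by
  ext i j
  rw [Matrix.mul_apply, Matrix.one_apply, ← B.inner_basis]
  simp only [transition, Matrix.of_apply, Matrix.transpose_apply]
  rw [← A.basis.sum_inner_mul_inner (B.basis i) (B.basis j)]
  exact Finset.sum_congr rfl fun k _ => by rw [real_inner_comm (B.basis j)]

/-- An orthogonal matrix `M` satisfies `adjugate M = det M • Mᵀ` with `|det M| = 1`, so each minor
is, up to sign, the complementary entry. This is the statement that orthogonal projection between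
two planes scales area by the cosine of their angle. -/
theorem abs_minor_transition (A B : Frame) :
    |inner ℝ (B.basis 0) (A.basis 0) * inner ℝ (B.basis 1) (A.basis 1) -
      inner ℝ (B.basis 0) (A.basis 1) * inner ℝ (B.basis 1) (A.basis 0)| =
      |(inner ℝ (A.basis 2) (B.basis 2) : ℝ)| := by
  set M := A.transition B with hM
  have h1 : M * M.transpose = 1 := A.transition_mul_transpose B
  have hdet : |M.det| = 1 := by
    have := congrArg Matrix.det h1
    rw [Matrix.det_mul, Matrix.det_transpose, Matrix.det_one] at this
    rw [abs_eq (by norm_num)]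
    exact mul_self_eq_one_iff.1 this
  have hadj : M.adjugate = M.det • M.transpose := by
    calc M.adjugate = M.adjugate * (M * M.transpose) := by rw [h1, mul_one]
      _ = M.det • M.transpose := by
        rw [← mul_assoc, Matrix.adjugate_mul, Matrix.smul_mul, one_mul]
  have h22 := congrFun (congrFun hadj 2) 2
  rw [Matrix.adjugate_fin_three] at h22
  simp only [Matrix.smul_apply, Matrix.transpose_apply, smul_eq_mul] at h22
  rw [show (inner ℝ (A.basis 2) (B.basis 2) : ℝ) = M 2 2 from real_inner_comm _ _]
  have : |M 2 2| = |M.det * M 2 2| := by rw [abs_mul, hdet, one_mul]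
  rw [this, ← h22]
  rfl

/-- The projection of one plane to another, in coordinates: linear part. -/
def projLinear (A B : Frame) : E2 →L[ℝ] E2 :=
  LinearMap.toContinuousLinearMap (Matrix.toLpLin 2 2 (Matrix.of fun i j : Fin 2 =>
    inner ℝ (B.basis i.castSucc) (A.basis j.castSucc)))

theorem abs_det_projLinear (A B : Frame) :
    |(A.projLinear B).det| = |(inner ℝ (A.basis 2) (B.basis 2) : ℝ)| := by
  rw [← A.abs_minor_transition B]
  have : (A.projLinear B).det = LinearMap.det (Matrix.toLpLin 2 2 (Matrix.of fun i j : Fin 2 =>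
    (inner ℝ (B.basis i.castSucc) (A.basis j.castSucc) : ℝ))) := rfl
  rw [this, LinearMap.det_toLpLin, Matrix.det_fin_two]
  rfl

theorem tangential_flat (A B : Frame) (s : E2) :
    B.tangential (A.flat s) = B.tangential A.base + A.projLinear B s := by
  ext i
  fin_cases i <;>
  · simp [tangential, flat, chart, projLinear, Matrix.toLpLin_apply, inner_add_right, inner_sub_right, inner_smul_right]
    ring

theorem hasFDerivAt_tangential_flat (A B : Frame) (s : E2) :
    HasFDerivAt (fun s => B.tangential (A.flat s)) (A.projLinear B) s := by
  simp only [tangential_flat]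
  exact (A.projLinear B).hasFDerivAt.const_add _

theorem image_tangential_eq (A B : Frame) {R : Set E3} (hR : R ⊆ A.plane) :
    B.tangential '' R = (fun s => B.tangential (A.flat s)) '' (A.flat ⁻¹' R) := by
  ext t
  constructor
  · rintro ⟨x, hx, rfl⟩
    refine ⟨A.tangential x, ?_, ?_⟩
    · simpa [A.flat_tangential (hR hx)] using hx
    · simp [A.flat_tangential (hR hx)]
  · rintro ⟨s, hs, rfl⟩
    exact ⟨_, hs, rfl⟩

/-- The projection of a vertical plane is a null set. -/
theorem volume_image_tangential_eq_zero (A B : Frame) {R : Set E3} (hR : R ⊆ A.plane)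
    (hn : inner ℝ (A.basis 2) (B.basis 2) = (0 : ℝ)) : volume (B.tangential '' R) = 0 := by
  rw [A.image_tangential_eq B hR]
  refine addHaar_image_eq_zero_of_det_fderivWithin_eq_zero _
    (fun s _ => (A.hasFDerivAt_tangential_flat B s).hasFDerivWithinAt) fun s _ => ?_
  rw [← abs_eq_zero, A.abs_det_projLinear B, hn, abs_zero]

/-- The height in `B` of the point of the plane of `A` over `t`. -/
def planeHeight (A B : Frame) (t : E2) : ℝ :=
  inner ℝ (A.basis 2) (A.base - B.chart (t, 0)) / inner ℝ (A.basis 2) (B.basis 2)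

theorem continuous_planeHeight (A B : Frame) : Continuous (A.planeHeight B) := by
  have : Continuous fun t : E2 => B.chart (t, 0) := B.continuous_flat
  unfold planeHeight
  fun_prop

theorem height_chart_eq (A B : Frame) (t : E2) (z : ℝ) :
    A.height (B.chart (t, z)) = z * inner ℝ (A.basis 2) (B.basis 2) -
      inner ℝ (A.basis 2) (A.base - B.chart (t, 0)) := by
  have : B.chart (t, z) = B.chart (t, 0) + z • B.basis 2 := by simp [chart]
  rw [height, this, ← inner_smul_right, ← inner_sub_right]
  congr 1
  abel

theorem chart_mem_plane_iff (A B : Frame) (hn : inner ℝ (A.basis 2) (B.basis 2) ≠ (0 : ℝ)) (t : E2)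
    (z : ℝ) : B.chart (t, z) ∈ A.plane ↔ z = A.planeHeight B t := by
  rw [plane, mem_ofPred_eq, A.height_chart_eq, planeHeight, eq_div_iff hn, sub_eq_zero]

theorem chart_planeHeight (A B : Frame) (hn : inner ℝ (A.basis 2) (B.basis 2) ≠ (0 : ℝ))
    {x : E3} (hx : x ∈ A.plane) :
    B.chart (B.tangential x, A.planeHeight B (B.tangential x)) = x := by
  have h : B.chart (B.tangential x, B.height x) ∈ A.plane := by simpa using hx
  rw [A.chart_mem_plane_iff B hn] at h
  rw [← h, B.chart_coordinates]

theorem injective_tangential_flat (A B : Frame)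
    (hn : inner ℝ (A.basis 2) (B.basis 2) ≠ (0 : ℝ)) :
    Function.Injective fun s => B.tangential (A.flat s) := by
  intro s s' h
  have hp : ∀ s, A.flat s ∈ A.plane := fun s => A.height_chart (s, 0)
  apply A.isometry_flat.injective
  rw [← A.chart_planeHeight B hn (hp s), ← A.chart_planeHeight B hn (hp s')]
  simp only at h
  rw [h]

/-- The area formula for the projection of a planar set. -/
theorem setIntegral_image_tangential (A B : Frame)
    (hn : inner ℝ (A.basis 2) (B.basis 2) ≠ (0 : ℝ)) {R : Set E3} (hR : R ⊆ A.plane)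
    (hm : MeasurableSet R) (g : E3 → ℝ) :
    ∫ t in B.tangential '' R, g (B.chart (t, A.planeHeight B t)) =
      |(inner ℝ (A.basis 2) (B.basis 2) : ℝ)| * ∫ x in R, g x ∂(μHE[2] : Measure E3) := by
  have hp : ∀ s, A.flat s ∈ A.plane := fun s => A.height_chart (s, 0)
  rw [A.image_tangential_eq B hR, integral_image_eq_integral_abs_det_fderiv_smul volume
    (A.continuous_flat.measurable hm)
    (fun s _ => (A.hasFDerivAt_tangential_flat B s).hasFDerivWithinAt)
    (A.injective_tangential_flat B hn).injOn, A.setIntegral_plane hR hm, ← integral_const_mul]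
  congr 1 with s
  rw [A.chart_planeHeight B hn (hp s), A.abs_det_projLinear B, smul_eq_mul]

/-- The image of a null set in a plane under the projection is a null set. -/
theorem volume_image_tangential_null (A B : Frame) {R : Set E3} (hR : R ⊆ A.plane)
    (h0 : (μHE[2] : Measure E3) R = 0) : volume (B.tangential '' R) = 0 := by
  rw [A.image_tangential_eq B hR]
  refine addHaar_image_eq_zero_of_differentiableOn_of_addHaar_eq_zero volume
    (fun s _ => (A.hasFDerivAt_tangential_flat B s).differentiableAt.differentiableWithinAt) ?_
  rwa [← A.measure_plane hR]

/-- The image lies in a line or a point, of dimension at most 1 in the plane. Hence almost every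
vertical line misses all edges of the polyhedron. -/
theorem volume_image_tangential_segment (B : Frame) (p q : E3) :
    volume (B.tangential '' affineSegment ℝ p q) = 0 := by
  have : B.tangential '' affineSegment ℝ p q ⊆ line[ℝ, B.tangential p, B.tangential q] := by
    rintro _ ⟨_, ⟨c, _, rfl⟩, rfl⟩
    have : B.tangential (AffineMap.lineMap p q c) =
        AffineMap.lineMap (B.tangential p) (B.tangential q) c := by
      ext i
      fin_cases i <;> simp [tangential, AffineMap.lineMap_apply, inner_add_right, inner_sub_right,
        inner_smul_right] <;> ring
    rw [this]
    exact AffineMap.lineMap_mem_affineSpan_pair _ _ _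
  refine measure_mono_null this (Measure.addHaar_affineSubspace _ _ fun htop => ?_)
  have h2 : Module.finrank ℝ (vectorSpan ℝ ({B.tangential p, B.tangential q} : Set E2)) ≤ 1 := by
    exact collinear_iff_finrank_le_one.1 (collinear_pair ℝ _ _)
  rw [← direction_affineSpan, htop, AffineSubspace.direction_top, finrank_top,
    finrank_euclideanSpace_fin] at h2
  omega

end Frame

theorem Real.sign_mul_self_eq_abs (r : ℝ) : Real.sign r * r = |r| := by
  rcases lt_trichotomy r 0 with h | h | h
  · simp [Real.sign_of_neg h, abs_of_neg h]
  · simp [h]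
  · simp [Real.sign_of_pos h, abs_of_pos h]

theorem Real.sign_mul_abs_eq_self (r : ℝ) : Real.sign r * |r| = r := by
  rcases lt_trichotomy r 0 with h | h | h
  · simp [Real.sign_of_neg h, abs_of_neg h]
  · simp [h]
  · simp [Real.sign_of_pos h, abs_of_pos h]

/-! ### Faces of a polyhedron -/

theorem disjoint_intrinsicInterior_intrinsicFrontier {V : Type*} [NormedAddCommGroup V]
    [NormedSpace ℝ V] (s : Set V) : Disjoint (intrinsicInterior ℝ s) (intrinsicFrontier ℝ s) :=
  (Set.disjoint_image_iff Subtype.val_injective).2 disjoint_interior_frontier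

namespace PolygonalFace

theorem exists_frame (F : PolygonalFace) : ∃ A : Frame, A.base = F.first ∧ A.basis 2 = F.normal := by
  have h : Orthonormal ℝ (({2} : Set (Fin 3)).domRestrict fun _ => F.normal) := by
    refine ⟨fun _ => F.norm_normal, fun i j hij => absurd (Subsingleton.elim i j) hij⟩
  obtain ⟨b, hb⟩ := h.exists_orthonormalBasis_extension_of_card_eq (by simp)
  exact ⟨⟨F.first, b⟩, rfl, hb 2 rfl⟩

/-- A frame in the plane of the face. -/
def frame (F : PolygonalFace) : Frame := F.exists_frame.choose

theorem frame_base (F : PolygonalFace) : F.frame.base = F.first := F.exists_frame.choose_spec.1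

theorem frame_normal (F : PolygonalFace) : F.frame.basis 2 = F.normal :=
  F.exists_frame.choose_spec.2

theorem region_subset_plane (F : PolygonalFace) : F.region ⊆ F.frame.plane := by
  intro x hx
  have := F.normal_orthogonal x hx
  rw [Frame.plane, mem_ofPred_eq, Frame.height, F.frame_base, F.frame_normal, real_inner_comm]
  exact this

theorem measurableSet_region (F : PolygonalFace) : MeasurableSet F.region :=
  F.isCompact.measurableSet

theorem hausdorffMeasure_region_lt_top (F : PolygonalFace) :
    (μHE[2] : Measure E3) F.region < ⊤ := by
  rw [F.frame.measure_plane F.region_subset_plane]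
  exact (F.frame.isometry_flat.isClosedEmbedding.isCompact_preimage F.isCompact).measure_lt_top

/-- The flux density of the radial field is constant on a face, which is why only the area of the
immersed part of the face enters the final formula. -/
theorem inner_sub_normal (F : PolygonalFace) {x : E3} (hx : x ∈ F.region) (y : E3) :
    inner ℝ (x - y) F.normal = (inner ℝ (F.first - y) F.normal : ℝ) := by
  have h1 : inner ℝ (x - F.first) F.normal = (0 : ℝ) := F.normal_orthogonal x hx
  rw [← sub_add_sub_cancel x F.first y, inner_add_left, h1, zero_add]

theorem boundary_union_intrinsicInterior (F : PolygonalFace) :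
    F.poly.boundary ℝ ∪ intrinsicInterior ℝ F.region = F.region := by
  rw [← F.frontier_eq, intrinsicFrontier_union_intrinsicInterior,
    intrinsicClosure_eq_closure, F.isCompact.isClosed.closure_eq]

theorem notMem_boundary (F : PolygonalFace) {x : E3} (hx : x ∈ intrinsicInterior ℝ F.region) :
    x ∉ F.poly.boundary ℝ := by
  rw [← F.frontier_eq]
  exact (disjoint_intrinsicInterior_intrinsicFrontier _).notMem_of_mem_left hx

/-- Orthogonality gives one inclusion, and both spaces have dimension 2. Thus the affine span used
by `intrinsicInterior` is the whole plane of the face. -/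
theorem vectorSpan_eq (F : PolygonalFace) : vectorSpan ℝ F.region = (ℝ ∙ F.normal)ᗮ := by
  have hne : F.normal ≠ 0 := by
    intro h
    have := F.norm_normal
    simp [h] at this
  apply Submodule.eq_of_le_of_finrank_eq
  · rw [vectorSpan_def, Submodule.span_le]
    rintro _ ⟨x, hx, y, hy, rfl⟩
    rw [SetLike.mem_coe, Submodule.mem_orthogonal_singleton_iff_inner_left]
    change inner ℝ (x - y) F.normal = 0
    rw [F.inner_sub_normal hx]
    have := F.inner_sub_normal hy y
    rw [sub_self, inner_zero_left] at this
    exact this.symm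
  · rw [F.planar]
    have : Fact (Module.finrank ℝ E3 = 2 + 1) := ⟨by simp⟩
    exact (Submodule.finrank_orthogonal_span_singleton hne).symm

theorem exists_ball_inter_plane_subset (F : PolygonalFace) {x : E3}
    (hx : x ∈ intrinsicInterior ℝ F.region) :
    ∃ r > 0, ∀ y ∈ Metric.ball x r, y ∈ F.frame.plane → y ∈ F.region := by
  have hxF := intrinsicInterior_subset hx
  obtain ⟨w, hw, rfl⟩ := mem_intrinsicInterior.1 hx
  obtain ⟨r, hr, hball⟩ := Metric.mem_nhds_iff.1 (mem_interior_iff_mem_nhds.1 hw)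
  refine ⟨r, hr, fun y hy hyp => ?_⟩
  have hmem : y ∈ affineSpan ℝ F.region := by
    have hd : y -ᵥ (w : E3) ∈ (affineSpan ℝ F.region).direction := by
      rw [direction_affineSpan, F.vectorSpan_eq, Submodule.mem_orthogonal_singleton_iff_inner_left,
        vsub_eq_sub]
      have h1 : inner ℝ (y - F.first) F.normal = (0 : ℝ) := by
        rw [real_inner_comm, ← F.frame_normal, ← F.frame_base]
        exact hyp
      have h2 : inner ℝ ((w : E3) - F.first) F.normal = (0 : ℝ) := F.normal_orthogonal _ hxF
      rw [← sub_sub_sub_cancel_right y (w : E3) F.first, inner_sub_left, h1, h2, sub_zero]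
    have := AffineSubspace.vadd_mem_of_mem_direction hd w.2
    simpa using this
  exact hball (show (⟨y, hmem⟩ : affineSpan ℝ F.region) ∈ Metric.ball w r from hy)

end PolygonalFace

namespace Polyhedron

theorem eq_of_mem_of_mem (C : Polyhedron) {j k : Fin C.numFaces} {x : E3}
    (hj : x ∈ (C.face j).region) (hk : x ∈ (C.face k).region)
    (hx : x ∉ (C.face j).poly.boundary ℝ) : j = k := by
  by_contra h
  exact hx (C.face_inter j k h ⟨hj, hk⟩)

theorem region_subset_frontier (C : Polyhedron) (k : Fin C.numFaces) :
    (C.face k).region ⊆ frontier C.carrier := by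
  rw [C.frontier_eq]
  exact subset_iUnion (fun k => (C.face k).region) k

theorem region_subset (C : Polyhedron) (k : Fin C.numFaces) :
    (C.face k).region ⊆ C.carrier :=
  (C.region_subset_frontier k).trans C.isCompact.isClosed.frontier_subset

/-- Near a relative interior point of a face the polyhedron is a half-space. -/
theorem exists_halfBall (C : Polyhedron) (k : Fin C.numFaces) {x : E3}
    (hx : x ∈ intrinsicInterior ℝ (C.face k).region) :
    ∃ r > 0, (∀ y ∈ Metric.ball x r, 0 < (C.face k).frame.height y → y ∉ C.carrier) ∧
      ∀ y ∈ Metric.ball x r, (C.face k).frame.height y < 0 → y ∈ C.carrier := by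
  set F := C.face k with hF
  have hxF := intrinsicInterior_subset hx
  obtain ⟨r₁, hr₁, h₁⟩ := F.exists_ball_inter_plane_subset hx
  -- The other faces are closed and do not contain `x`, since faces meet only along their
  -- boundaries. So the frontier near `x` is contained in a single plane.
  have hother : ∀ᶠ y in 𝓝 x, ∀ j, j ≠ k → y ∉ (C.face j).region := by
    rw [eventually_all]
    intro j
    by_cases hj : j = k
    · simp [hj]
    · have : x ∉ (C.face j).region := fun h =>
        hj (C.eq_of_mem_of_mem hxF h (F.notMem_boundary hx)).symm
      filter_upwards [(C.face j).isCompact.isClosed.isOpen_compl.mem_nhds this] with y hy _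
      exact hy
  obtain ⟨r₂, hr₂, h₂⟩ := Metric.eventually_nhds_iff_ball.1 hother
  have hfr : ∀ y ∈ Metric.ball x (min r₁ r₂), y ∈ frontier C.carrier → F.frame.height y = 0 := by
    intro y hy hyf
    rw [C.frontier_eq] at hyf
    obtain ⟨j, hj⟩ := mem_iUnion.1 hyf
    have hjk : j = k := by
      by_contra h
      exact h₂ y (Metric.ball_subset_ball (min_le_right _ _) hy) j h hj
    rw [hjk] at hj
    exact F.region_subset_plane hj
  have hlin : ∀ y z : E3, ∀ a b : ℝ, a + b = 1 →
      F.frame.height (a • y + b • z) = a * F.frame.height y + b * F.frame.height z := by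
    intro y z a b hab
    simp only [Frame.height, inner_sub_right, inner_add_right, inner_smul_right]
    linear_combination (inner ℝ (F.frame.basis 2) F.frame.base) * hab
  have hT : ∀ σ : ℝ, IsPreconnected (Metric.ball x (min r₁ r₂) ∩ {y | 0 < σ * F.frame.height y}) := by
    intro σ
    apply Convex.isPreconnected
    refine (convex_ball _ _).inter fun y hy z hz a b ha hb hab => ?_
    simp only [mem_ofPred_eq] at hy hz ⊢
    rw [hlin y z a b hab]
    rcases ha.eq_or_lt with rfl | ha
    · have : b = 1 := by linarith
      simpa [this] using hz
    · nlinarith [mul_pos ha hy, mul_nonneg hb hz.le]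
  have hd : ∀ σ : ℝ, Disjoint (Metric.ball x (min r₁ r₂) ∩ {y | 0 < σ * F.frame.height y})
      (frontier C.carrier) := by
    intro σ
    rw [Set.disjoint_left]
    rintro y ⟨hy, hy'⟩ hyf
    simp [hfr y hy hyf] at hy'
  have hr : 0 < min r₁ r₂ := lt_min hr₁ hr₂
  -- The sides are the two open half-balls, convex and free of frontier points. The outer normal
  -- shows that the positive one is not contained in the polyhedron.
  have key := disjoint_and_subset_interior_of_sides C.regular (C.region_subset k hxF)
    (Metric.ball_mem_nhds x hr) ?_ (hT 1) (hT (-1)) (hd 1) (hd (-1)) ?_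
  · refine ⟨min r₁ r₂, hr, fun y hy hh hC => ?_, fun y hy hh => ?_⟩
    · exact key.1.le_bot ⟨⟨hy, by simpa using hh⟩, hC⟩
    · exact interior_subset (key.2 ⟨hy, by simpa using hh⟩)
  · intro y hy
    rcases lt_trichotomy (F.frame.height y) 0 with h | h | h
    · exact Or.inl (Or.inr ⟨hy, by simpa using h⟩)
    · refine Or.inr (C.region_subset_frontier k ?_)
      exact h₁ y (Metric.ball_subset_ball (min_le_left _ _) hy) h
    · exact Or.inl (Or.inl ⟨hy, by simpa using h⟩)
  · have hc : Tendsto (fun ε : ℝ => x + ε • F.normal) (𝓝[>] 0) (𝓝 x) := by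
      have : Continuous fun ε : ℝ => x + ε • F.normal := by fun_prop
      simpa using (this.tendsto 0).mono_left nhdsWithin_le_nhds
    obtain ⟨ε, ⟨h3, h4⟩, h5⟩ := (((C.outward k x hx).and (hc (Metric.ball_mem_nhds x hr))).and
      self_mem_nhdsWithin).exists
    refine ⟨_, ⟨h4, ?_⟩, h3⟩
    have h0 : F.frame.height x = 0 := F.region_subset_plane hxF
    have : F.frame.height (x + ε • F.normal) = ε := by
      rw [Frame.height, add_sub_right_comm, inner_add_right, inner_smul_right]
      change F.frame.height x + _ = _
      rw [h0, F.frame_normal, real_inner_self_eq_norm_sq, F.norm_normal]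
      ring
    simpa [this] using h5

/-- A vertical line that crosses a face transversally enters or leaves the polyhedron there. -/
theorem isEndpoint_fiber (C : Polyhedron) (B : Frame) (k : Fin C.numFaces) {t : E2} {z : ℝ}
    (hx : B.chart (t, z) ∈ intrinsicInterior ℝ (C.face k).region)
    (hn : inner ℝ (C.face k).normal (B.basis 2) ≠ (0 : ℝ)) :
    IsEndpoint (B.fiber C.carrier t) z (Real.sign (inner ℝ (C.face k).normal (B.basis 2))) := by
  set F := C.face k with hF
  set ν : ℝ := inner ℝ F.normal (B.basis 2) with hν
  refine ⟨(Real.sign_apply_eq_of_ne_zero ν hn).symm, ?_⟩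
  obtain ⟨r, hr, hout, hin⟩ := C.exists_halfBall k hx
  have h0 : F.frame.height (B.chart (t, z)) = 0 :=
    F.region_subset_plane (intrinsicInterior_subset hx)
  have hh : ∀ d : ℝ, F.frame.height (B.chart (t, z + d)) = d * ν := by
    intro d
    rw [F.frame.height_chart_eq B, F.frame_normal] at h0 ⊢
    linear_combination h0
  have hc : ∀ σ : ℝ, ∀ᶠ ε in 𝓝[>] (0 : ℝ), B.chart (t, z + σ * ε) ∈ Metric.ball (B.chart (t, z)) r := by
    intro σ
    have : Continuous fun ε : ℝ => B.chart (t, z + σ * ε) := B.continuous_chart.comp (by fun_prop)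
    have h := (this.tendsto 0).mono_left (nhdsWithin_le_nhds (s := Ioi 0))
    simp only [mul_zero, add_zero] at h
    exact h (Metric.ball_mem_nhds _ hr)
  filter_upwards [hc (Real.sign ν), hc (-Real.sign ν), self_mem_nhdsWithin] with ε h1 h2 h3
  have hpos : 0 < ε * |ν| := mul_pos h3 (abs_pos.2 hn)
  have habs : Real.sign ν * ν = |ν| := Real.sign_mul_self_eq_abs ν
  refine ⟨hout _ h1 ?_, ?_⟩
  · rw [hh, mul_right_comm, habs, mul_comm]
    exact hpos
  · have := hin _ h2 (by rw [hh, neg_mul, neg_mul, mul_right_comm, habs, mul_comm]; linarith)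
    rwa [neg_mul, ← sub_eq_add_neg] at this

/-- The divergence theorem in a polyhedron for a field of constant direction. -/
theorem setIntegral_lineDeriv (C : Polyhedron) (B : Frame) {V V' : E3 → ℝ}
    (hV : ContinuousOn V C.carrier)
    (hV' : ∀ x ∈ interior C.carrier,
      HasDerivAt (fun s : ℝ => V (x + s • B.basis 2)) (V' x) 0)
    (hint : IntegrableOn V' C.carrier) :
    ∫ x in C.carrier, V' x = ∑ k, inner ℝ (C.face k).normal (B.basis 2) *
      ∫ x in (C.face k).region, V x ∂(μHE[2] : Measure E3) := by
  classical
  set ν : Fin C.numFaces → ℝ := fun k => inner ℝ (C.face k).normal (B.basis 2) with hν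
  have hνf : ∀ k, inner ℝ ((C.face k).frame.basis 2) (B.basis 2) = ν k := fun k => by
    rw [(C.face k).frame_normal]
  set a : Fin C.numFaces → E2 → ℝ := fun k => (C.face k).frame.planeHeight B with ha
  have hpt : ∀ k, ν k ≠ 0 → ∀ t ∈ B.tangential '' (C.face k).region,
      B.chart (t, a k t) ∈ (C.face k).region := by
    rintro k hk _ ⟨x, hx, rfl⟩
    rw [ha, (C.face k).frame.chart_planeHeight B (by rwa [hνf])
      ((C.face k).region_subset_plane hx)]
    exact hx
  -- Almost every vertical line misses the edges and the vertical faces. The remaining lines cross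
  -- faces transversally and only in relative interior points.
  have hedge : ∀ᵐ t : E2, ∀ k, t ∉ B.tangential '' (C.face k).poly.boundary ℝ := by
    rw [ae_all_iff]
    intro k
    rw [Polygon.boundary, image_iUnion]
    exact measure_eq_zero_iff_ae_notMem.1
      (measure_iUnion_null fun i => B.volume_image_tangential_segment _ _)
  have hvert : ∀ᵐ t : E2, ∀ k, ν k = 0 → t ∉ B.tangential '' (C.face k).region := by
    rw [ae_all_iff]
    intro k
    by_cases hk : ν k = 0
    · filter_upwards [measure_eq_zero_iff_ae_notMem.1
        ((C.face k).frame.volume_image_tangential_eq_zero B (C.face k).region_subset_plane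
          (by rwa [hνf]))] with t ht _
      exact ht
    · exact Eventually.of_forall fun t h => absurd h hk
  -- Fundamental theorem of calculus on a generic vertical line: one signed boundary value for each
  -- face over `t`.
  have hline : ∀ᵐ t : E2, ∫ z in B.fiber C.carrier t, V' (B.chart (t, z)) =
      ∑ k, (B.tangential '' (C.face k).region).indicator
        (fun t => Real.sign (ν k) * V (B.chart (t, a k t))) t := by
    filter_upwards [hedge, hvert, B.integrableOn_fiber C.isCompact hint] with t h1 h2 h3
    have hin : ∀ k, ν k ≠ 0 → t ∈ B.tangential '' (C.face k).region →
        B.chart (t, a k t) ∈ intrinsicInterior ℝ (C.face k).region := by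
      intro k hk ht
      have := hpt k hk t ht
      rw [← (C.face k).boundary_union_intrinsicInterior] at this
      refine this.resolve_left fun h => h1 k ⟨_, h, by simp⟩
    have hfib : ∀ z, B.chart (t, z) ∈ frontier C.carrier →
        ∃ k, t ∈ B.tangential '' (C.face k).region ∧ a k t = z := by
      intro z hz
      rw [C.frontier_eq] at hz
      obtain ⟨k, hk⟩ := mem_iUnion.1 hz
      have ht : t ∈ B.tangential '' (C.face k).region := ⟨_, hk, by simp⟩
      refine ⟨k, ht, ?_⟩
      have hk0 : ν k ≠ 0 := fun h => h2 k h ht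
      exact (((C.face k).frame.chart_mem_plane_iff B (by rwa [hνf]) t z).1
        ((C.face k).region_subset_plane hk)).symm
    rw [setIntegral_eq_sum_indexed_endpoints
      (Finset.univ.filter fun k => t ∈ B.tangential '' (C.face k).region) (fun k => a k t)
      (fun k => Real.sign (ν k)) (f := fun z => V (B.chart (t, z))) ?_
      (B.isCompact_fiber C.isCompact t) ?_ ?_ ?_ ?_ h3]
    · rw [Finset.sum_filter]
      exact Finset.sum_congr rfl fun k _ => by rw [indicator_apply]
    -- Two faces crossed at the same height would share a relative interior point, so they coincide.
    · intro j hj k hk hjk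
      simp only [Finset.coe_filter, Finset.mem_univ, true_and, mem_ofPred_eq] at hj hk hjk
      have hj0 : ν j ≠ 0 := fun h => h2 j h hj
      have hk0 : ν k ≠ 0 := fun h => h2 k h hk
      have h := hpt k hk0 t hk
      rw [← hjk] at h
      exact C.eq_of_mem_of_mem (hpt j hj0 t hj) h ((C.face j).notMem_boundary (hin j hj0 hj))
    · intro z hz
      obtain ⟨k, hk, hk'⟩ := hfib z ((B.continuous_chart_fiber t).frontier_preimage_subset _ hz)
      exact ⟨k, by simpa using hk, hk'⟩
    · intro k hk
      simp only [Finset.mem_filter, Finset.mem_univ, true_and] at hk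
      have hk0 : ν k ≠ 0 := fun h => h2 k h hk
      exact C.isEndpoint_fiber B k (hin k hk0 hk) hk0
    · exact hV.comp (B.continuous_chart_fiber t).continuousOn fun z hz => hz
    · intro z hz hzk
      have hzi : B.chart (t, z) ∈ interior C.carrier := by
        by_contra h
        obtain ⟨k, hk, hk'⟩ := hfib z (by rw [C.isCompact.isClosed.frontier_eq]; exact ⟨hz, h⟩)
        exact hzk k (by simpa using hk) hk'
      have h := hV' _ hzi
      have h' : HasDerivAt (fun s : ℝ => s - z) 1 z := (hasDerivAt_id z).sub_const z
      rw [← sub_self z] at h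
      have := HasDerivAt.scomp (h := fun s : ℝ => s - z) z h h'
      simp only [one_smul] at this
      refine this.congr_of_eventuallyEq (Eventually.of_forall fun s => ?_)
      simp only [Function.comp_apply]
      congr 1
      simp only [Frame.chart]
      module
  have hcompact : ∀ k, IsCompact (B.tangential '' (C.face k).region) := fun k =>
    (C.face k).isCompact.image B.continuous_tangential
  rw [B.setIntegral_eq_integral_fiber C.isCompact hint, integral_congr_ae hline, integral_finsetSum]
  · refine Finset.sum_congr rfl fun k _ => ?_
    rw [integral_indicator (hcompact k).measurableSet, integral_const_mul]
    -- A vertical face contributes zero on both sides, since `Real.sign 0 = 0`. Otherwise the area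
    -- formula supplies the factor `|ν k|`, which the sign turns into `ν k`.
    by_cases hk : ν k = 0
    · rw [hk, Real.sign_zero, zero_mul, show inner ℝ (C.face k).normal (B.basis 2) = (0 : ℝ) from hk,
        zero_mul]
    · rw [ha, (C.face k).frame.setIntegral_image_tangential B (by rwa [hνf])
        (C.face k).region_subset_plane (C.face k).measurableSet_region, hνf, ← mul_assoc]
      rw [Real.sign_mul_abs_eq_self]
  · intro k _
    rw [integrable_indicator_iff (hcompact k).measurableSet]
    by_cases hk : ν k = 0
    · simp [hk]
    · refine ContinuousOn.integrableOn_compact (hcompact k) (continuousOn_const.mul ?_)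
      refine hV.comp (B.continuous_chart.comp (continuous_id.prodMk
        ((C.face k).frame.continuous_planeHeight B))).continuousOn fun t ht => ?_
      exact C.region_subset k (hpt k hk t ht)

end Polyhedron

/-! ### A differentiable step function -/

/-- A nonnegative continuous bump with integral one, supported in `[0, 1]`. -/
def stepDensity (s : ℝ) : ℝ := 6 * max 0 (s * (1 - s))

/-- A differentiable step function, equal to `1` for `s ≤ 0` and to `0` for `1 ≤ s`. -/
def smoothStep (s : ℝ) : ℝ := 1 - ∫ r in (0 : ℝ)..s, stepDensity r

theorem continuous_stepDensity : Continuous stepDensity := by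
  unfold stepDensity; fun_prop

theorem stepDensity_nonneg (s : ℝ) : 0 ≤ stepDensity s :=
  mul_nonneg (by norm_num) (le_max_left _ _)

theorem stepDensity_le (s : ℝ) : stepDensity s ≤ 2 := by
  have : max 0 (s * (1 - s)) ≤ 1 / 3 := max_le (by norm_num) (by nlinarith [sq_nonneg (s - 1 / 2)])
  unfold stepDensity
  linarith

theorem stepDensity_of_nonpos {s : ℝ} (hs : s ≤ 0) : stepDensity s = 0 := by
  rw [stepDensity, max_eq_left (by nlinarith), mul_zero]

theorem stepDensity_of_one_le {s : ℝ} (hs : 1 ≤ s) : stepDensity s = 0 := by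
  rw [stepDensity, max_eq_left (by nlinarith), mul_zero]

theorem hasDerivAt_smoothStep (s : ℝ) : HasDerivAt smoothStep (-stepDensity s) s :=
  (intervalIntegral.integral_hasDerivAt_right (continuous_stepDensity.intervalIntegrable _ _)
    (continuous_stepDensity.stronglyMeasurableAtFilter _ _)
    continuous_stepDensity.continuousAt).const_sub 1

theorem continuous_smoothStep : Continuous smoothStep :=
  continuous_iff_continuousAt.2 fun s => (hasDerivAt_smoothStep s).continuousAt

theorem smoothStep_of_nonpos {s : ℝ} (hs : s ≤ 0) : smoothStep s = 1 := by
  have : ∫ r in (0 : ℝ)..s, stepDensity r = ∫ r in (0 : ℝ)..s, (0 : ℝ) := by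
    refine intervalIntegral.integral_congr fun r hr => stepDensity_of_nonpos ?_
    rw [uIcc_of_ge hs] at hr
    exact hr.2
  simp [smoothStep, this]

theorem smoothStep_of_one_le {s : ℝ} (hs : 1 ≤ s) : smoothStep s = 0 := by
  have h1 : ∫ r in (0 : ℝ)..1, stepDensity r = 1 := by
    have : ∫ r in (0 : ℝ)..1, stepDensity r = ∫ r in (0 : ℝ)..1, (6 * r - 6 * r ^ 2) := by
      refine intervalIntegral.integral_congr fun r hr => ?_
      rw [uIcc_of_le zero_le_one] at hr
      simp only [stepDensity]
      rw [max_eq_right (mul_nonneg hr.1 (by linarith [hr.2]))]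
      ring
    rw [this, intervalIntegral.integral_sub
        (Continuous.intervalIntegrable (by fun_prop) _ _)
        (Continuous.intervalIntegrable (by fun_prop) _ _),
      intervalIntegral.integral_const_mul, intervalIntegral.integral_const_mul, integral_id,
      integral_pow]
    norm_num
  have h2 : ∫ r in (1 : ℝ)..s, stepDensity r = ∫ r in (1 : ℝ)..s, (0 : ℝ) := by
    refine intervalIntegral.integral_congr fun r hr => stepDensity_of_one_le ?_
    rw [uIcc_of_le hs] at hr
    exact hr.1
  have h3 := intervalIntegral.integral_add_adjacent_intervals
    (continuous_stepDensity.intervalIntegrable (μ := volume) 0 1)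
    (continuous_stepDensity.intervalIntegrable 1 s)
  rw [smoothStep, ← h3, h1, h2]
  simp

theorem antitone_smoothStep : Antitone smoothStep :=
  antitone_of_deriv_nonpos (fun s => (hasDerivAt_smoothStep s).differentiableAt) fun s => by
    rw [(hasDerivAt_smoothStep s).deriv]
    linarith [stepDensity_nonneg s]

theorem smoothStep_nonneg (s : ℝ) : 0 ≤ smoothStep s := by
  rw [← smoothStep_of_one_le (le_max_right s 1)]
  exact antitone_smoothStep (le_max_left _ _)

theorem smoothStep_le_one (s : ℝ) : smoothStep s ≤ 1 := by
  rw [← smoothStep_of_nonpos (min_le_right s 0)]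
  exact antitone_smoothStep (min_le_left _ _)

/-- The step equals 1 up to and including 0, so the limit is exactly the indicator of the closed
condition `r ≤ 0`; the zero level needs no exception. -/
theorem tendsto_smoothStep_div (r : ℝ) :
    Tendsto (fun ε : ℝ => smoothStep (r / ε)) (𝓝[>] 0) (𝓝 (if r ≤ 0 then 1 else 0)) := by
  refine tendsto_const_nhds.congr' ?_
  split_ifs with hr
  · filter_upwards [self_mem_nhdsWithin] with ε hε
    exact (smoothStep_of_nonpos (div_nonpos_of_nonpos_of_nonneg hr (le_of_lt hε))).symm
  · filter_upwards [self_mem_nhdsWithin, nhdsWithin_le_nhds (Iio_mem_nhds (not_le.1 hr))]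
      with ε hε hεr
    exact (smoothStep_of_one_le ((one_le_div hε).2 (le_of_lt hεr))).symm

/-- Rescaled densities of the values of an increasing function concentrate at its zero. -/
theorem tendsto_integral_stepDensity {q q' w : ℝ → ℝ} {z₀ ρ c : ℝ} (hρ : 0 < ρ) (hc : 0 < c)
    (hq : ∀ z ∈ Icc z₀ (z₀ + ρ), HasDerivAt q (q' z) z) (hq' : ContinuousOn q' (Icc z₀ (z₀ + ρ)))
    (hcq : ∀ z ∈ Icc z₀ (z₀ + ρ), c ≤ q' z) (hw : ContinuousOn w (Icc z₀ (z₀ + ρ)))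
    (h0 : q z₀ = 0) :
    Tendsto (fun ε : ℝ => ∫ z in z₀..(z₀ + ρ), ε⁻¹ * stepDensity (q z / ε) * w z) (𝓝[>] 0)
      (𝓝 (w z₀ / q' z₀)) := by
  have hle : z₀ ≤ z₀ + ρ := by linarith
  have hmem₀ : z₀ ∈ Icc z₀ (z₀ + ρ) := left_mem_Icc.2 hle
  have hqc : ContinuousOn q (Icc z₀ (z₀ + ρ)) := fun z hz => (hq z hz).continuousAt.continuousWithinAt
  have hgrow : ∀ z ∈ Icc z₀ (z₀ + ρ), c * (z - z₀) ≤ q z := by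
    intro z hz
    have := (convex_Icc z₀ (z₀ + ρ)).mul_sub_le_image_sub_of_le_deriv hqc
      (fun y hy => (hq y (interior_subset hy)).differentiableAt.differentiableWithinAt)
      (C := c) (fun y hy => by
        rw [(hq y (interior_subset hy)).deriv]; exact hcq y (interior_subset hy)) z₀ hmem₀ z hz hz.1
    linarith
  -- The weight is written as `w = (k + g) q'` with `g z₀ = 0`. The factor `q'` makes the density
  -- below a derivative, and only the small function `g` has to be estimated.
  set k := w z₀ / q' z₀ with hk
  set g : ℝ → ℝ := fun z => w z / q' z - k with hg
  have hgc : ContinuousOn g (Icc z₀ (z₀ + ρ)) :=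
    (hw.div hq' fun z hz => (hc.trans_le (hcq z hz)).ne').sub continuousOn_const
  have hg0 : g z₀ = 0 := by simp [hg, hk]
  rw [Metric.tendsto_nhds]
  intro η hη
  have hnear : ∀ᶠ z in 𝓝[Icc z₀ (z₀ + ρ)] z₀, |g z| < η / 2 := by
    have := (hgc z₀ hmem₀).abs
    rw [ContinuousWithinAt, hg0, abs_zero] at this
    exact this.eventually (Iio_mem_nhds (by linarith))
  obtain ⟨r, hr, hnear⟩ := Metric.eventually_nhds_iff.1 (eventually_nhdsWithin_iff.1 hnear)
  have hcr : 0 < c * r := mul_pos hc hr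
  have hcρ : 0 < c * ρ := mul_pos hc hρ
  -- As `q z ≥ c (z - z₀)`, the condition `ε < c r` makes the density vanish at distance at least
  -- `r` from `z₀`, and `ε < c ρ` makes its total mass equal to 1.
  filter_upwards [self_mem_nhdsWithin, nhdsWithin_le_nhds (Iio_mem_nhds hcr),
    nhdsWithin_le_nhds (Iio_mem_nhds hcρ)] with ε hε hεr hερ
  simp only [mem_Ioi, mem_Iio] at hε hεr hερ
  set D : ℝ → ℝ := fun z => ε⁻¹ * stepDensity (q z / ε) * q' z with hD
  have hDc : ContinuousOn D (Icc z₀ (z₀ + ρ)) :=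
    (continuousOn_const.mul (continuous_stepDensity.comp_continuousOn (hqc.div_const ε))).mul hq'
  have hDi : IntervalIntegrable D volume z₀ (z₀ + ρ) :=
    ContinuousOn.intervalIntegrable (by rwa [uIcc_of_le hle])
  have hgDi : IntervalIntegrable (fun z => g z * D z) volume z₀ (z₀ + ρ) :=
    ContinuousOn.intervalIntegrable (by rw [uIcc_of_le hle]; exact hgc.mul hDc)
  have hD0 : ∀ z ∈ Icc z₀ (z₀ + ρ), 0 ≤ D z := fun z hz =>
    mul_nonneg (mul_nonneg (inv_nonneg.2 hε.le) (stepDensity_nonneg _)) (hc.le.trans (hcq z hz))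
  have hDint : ∫ z in z₀..(z₀ + ρ), D z = 1 := by
    have h := intervalIntegral.integral_eq_sub_of_hasDerivAt (a := z₀) (b := z₀ + ρ)
      (f := fun z => -smoothStep (q z / ε)) (f' := D) (fun z hz => ?_) hDi
    · rw [h, h0, zero_div, smoothStep_of_nonpos le_rfl, smoothStep_of_one_le]
      · ring
      · rw [one_le_div hε]
        have := hgrow (z₀ + ρ) (right_mem_Icc.2 hle)
        rw [add_sub_cancel_left] at this
        linarith
    · rw [uIcc_of_le hle] at hz
      refine (((hasDerivAt_smoothStep (q z / ε)).comp z ((hq z hz).div_const ε)).neg).congr_deriv ?_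
      simp only [hD]
      field_simp
  have hsplit : ∫ z in z₀..(z₀ + ρ), ε⁻¹ * stepDensity (q z / ε) * w z =
      k + ∫ z in z₀..(z₀ + ρ), g z * D z := by
    calc _ = ∫ z in z₀..(z₀ + ρ), (k * D z + g z * D z) := by
          refine intervalIntegral.integral_congr fun z hz => ?_
          rw [uIcc_of_le hle] at hz
          have : q' z ≠ 0 := (hc.trans_le (hcq z hz)).ne'
          simp only [hg, hD]
          field_simp
          ring
      _ = _ := by
          rw [intervalIntegral.integral_add (hDi.const_mul k) hgDi,
            intervalIntegral.integral_const_mul, hDint, mul_one]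
  rw [hsplit, dist_eq_norm, add_sub_cancel_left]
  calc ‖∫ z in z₀..(z₀ + ρ), g z * D z‖ ≤ ∫ z in z₀..(z₀ + ρ), η / 2 * D z := by
        refine intervalIntegral.norm_integral_le_of_norm_le hle
          (Eventually.of_forall fun z hz => ?_) (hDi.const_mul _)
        have hz' := Ioc_subset_Icc_self hz
        rw [norm_mul, Real.norm_of_nonneg (hD0 z hz')]
        by_cases hzr : z - z₀ < r
        · refine mul_le_mul_of_nonneg_right ?_ (hD0 z hz')
          refine (hnear ?_ hz').le
          rw [Real.dist_eq, abs_of_nonneg (by linarith [hz'.1])]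
          exact hzr
        · have : D z = 0 := by
            simp only [hD]
            rw [stepDensity_of_one_le, mul_zero, zero_mul]
            rw [one_le_div hε]
            have := hgrow z hz'
            nlinarith
          simp [this]
    _ = η / 2 := by rw [intervalIntegral.integral_const_mul, hDint, mul_one]
    _ < η := by linarith

/-! ### The divergence theorem for a radial field -/

theorem Polyhedron.setIntegral_lineDeriv_of_norm (C : Polyhedron) {e : E3} (he : ‖e‖ = 1)
    {V V' : E3 → ℝ} (hV : ContinuousOn V C.carrier)
    (hV' : ∀ x ∈ interior C.carrier, HasDerivAt (fun s : ℝ => V (x + s • e)) (V' x) 0)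
    (hint : IntegrableOn V' C.carrier) :
    ∫ x in C.carrier, V' x = ∑ k, inner ℝ (C.face k).normal e *
      ∫ x in (C.face k).region, V x ∂(μHE[2] : Measure E3) := by
  have h : Orthonormal ℝ (({2} : Set (Fin 3)).domRestrict fun _ => e) :=
    ⟨fun _ => he, fun i j hij => absurd (Subsingleton.elim i j) hij⟩
  obtain ⟨b, hb⟩ := h.exists_orthonormalBasis_extension_of_card_eq (by simp)
  have hb2 : b 2 = e := hb 2 rfl
  rw [← hb2] at hV' ⊢
  exact C.setIntegral_lineDeriv ⟨0, b⟩ hV hV' hint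

theorem PolygonalFace.integrableOn (F : PolygonalFace) {V : E3 → ℝ} (hV : ContinuousOn V F.region) :
    IntegrableOn V F.region (μHE[2] : Measure E3) :=
  hV.integrableOn_of_subset_isCompact F.isCompact F.measurableSet_region subset_rfl
    F.hausdorffMeasure_region_lt_top.ne

/-- The formula for a constant direction is applied to `u(x) ⟨b i, x - xref⟩` for each basis vector.
Summed over `i`, the derivatives give `3 u + u' (x - xref)`, and the face terms combine to `⟨x -
xref, n_k⟩`, a constant on the face. -/
theorem Polyhedron.setIntegral_radial (C : Polyhedron) (xref : E3) {u : E3 → ℝ}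
    {u' : E3 → E3 →L[ℝ] ℝ} (hu : ContinuousOn u C.carrier)
    (hu' : ∀ x ∈ interior C.carrier, HasFDerivAt u (u' x) x)
    (hint : ∀ v, IntegrableOn (fun x => u' x v) C.carrier) :
    (3 * ∫ x in C.carrier, u x) + ∫ x in C.carrier, u' x (x - xref) =
      ∑ k, inner ℝ ((C.face k).first - xref) (C.face k).normal *
        ∫ x in (C.face k).region, u x ∂(μHE[2] : Measure E3) := by
  set b := EuclideanSpace.basisFun (Fin 3) ℝ with hb
  have hint' : ∀ i, IntegrableOn (fun x => u' x (b i) * inner ℝ (b i) (x - xref)) C.carrier :=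
    fun i => (hint (b i)).mul_continuousOn (by fun_prop) C.isCompact
  have huint : IntegrableOn u C.carrier := hu.integrableOn_compact C.isCompact
  have h : ∀ i, ∫ x in C.carrier, (u' x (b i) * inner ℝ (b i) (x - xref) + u x) =
      ∑ k, inner ℝ (C.face k).normal (b i) *
        ∫ x in (C.face k).region, u x * inner ℝ (b i) (x - xref) ∂(μHE[2] : Measure E3) := by
    intro i
    refine C.setIntegral_lineDeriv_of_norm (b.orthonormal.1 i) (hu.mul (by fun_prop)) ?_
      ((hint' i).add huint)
    intro x hx
    have h1 : HasDerivAt (fun s : ℝ => x + s • b i) (b i) 0 := by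
      simpa using ((hasDerivAt_id (0 : ℝ)).smul_const (b i)).const_add x
    have h2 : HasDerivAt (fun s : ℝ => u (x + s • b i)) (u' x (b i)) 0 := by
      have h3 : HasFDerivAt u (u' x) (x + (0 : ℝ) • b i) := by simpa using hu' x hx
      exact h3.comp_hasDerivAt 0 h1
    have h4 : HasDerivAt (fun s : ℝ => (inner ℝ (b i) (x + s • b i - xref) : ℝ)) 1 0 := by
      refine ((innerSL ℝ (b i)).hasFDerivAt.comp_hasDerivAt 0 (h1.sub_const xref)).congr_deriv ?_
      simp [b.orthonormal.1 i]
    refine (h2.mul h4).congr_deriv ?_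
    simp
  have hdot : ∀ x, ∑ i, u' x (b i) * inner ℝ (b i) (x - xref) = u' x (x - xref) := by
    intro x
    conv_rhs => rw [← b.sum_repr' (x - xref), map_sum]
    exact Finset.sum_congr rfl fun i _ => by rw [map_smul, smul_eq_mul, mul_comm]
  have hsum : ∀ x : E3, ∑ i, (u' x (b i) * inner ℝ (b i) (x - xref) + u x) =
      3 * u x + u' x (x - xref) := by
    intro x
    rw [Finset.sum_add_distrib, hdot]
    simp only [Finset.sum_const, Finset.card_univ, Fintype.card_fin, nsmul_eq_mul]
    push_cast
    ring
  have hint3 : IntegrableOn (fun x => u' x (x - xref)) C.carrier := by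
    simp only [← hdot]
    exact integrable_finsetSum _ fun i _ => hint' i
  calc (3 * ∫ x in C.carrier, u x) + ∫ x in C.carrier, u' x (x - xref)
      = ∫ x in C.carrier, ∑ i, (u' x (b i) * inner ℝ (b i) (x - xref) + u x) := by
        simp only [hsum]
        rw [integral_add (huint.const_mul 3) hint3, integral_const_mul]
    _ = ∑ i, ∑ k, inner ℝ (C.face k).normal (b i) *
        ∫ x in (C.face k).region, u x * inner ℝ (b i) (x - xref) ∂(μHE[2] : Measure E3) := by
        rw [← Finset.sum_congr rfl fun i _ => h i]
        exact integral_finsetSum _ fun i _ => (hint' i).add huint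
    _ = _ := by
        rw [Finset.sum_comm]
        refine Finset.sum_congr rfl fun k _ => ?_
        have huk : ContinuousOn u (C.face k).region := hu.mono (C.region_subset k)
        simp only [← integral_const_mul]
        rw [← integral_finsetSum]
        · refine setIntegral_congr_fun (C.face k).measurableSet_region fun x hx => ?_
          rw [← (C.face k).inner_sub_normal hx, real_inner_comm,
            ← b.sum_inner_mul_inner, Finset.sum_mul]
          exact Finset.sum_congr rfl fun i _ => by ring
        · intro i _
          exact (((C.face k).integrableOn (huk.mul (by fun_prop)))).const_mul _

/-! ### Level sets that are graphs over the plane of a frame -/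

namespace IsGraphPatch

variable {B : Frame} {φ : E3 → ℝ} {h : E2 → ℝ} {A : Set E3}

theorem graphMap_mem (g : IsGraphPatch B φ h A) {t : E2} (ht : t ∈ B.graphBase φ A) :
    B.chart (t, h t) ∈ patch φ A := by
  rw [g.eq_graph]
  exact ⟨t, ht, rfl⟩

/-- This is the vertical line test: the patch has at most one point over each `t`. -/
theorem mem_graphBase_iff (g : IsGraphPatch B φ h A) {t : E2} {z : ℝ} :
    B.chart (t, z) ∈ patch φ A ↔ t ∈ B.graphBase φ A ∧ z = h t := by
  constructor
  · intro hx
    refine ⟨⟨_, hx, by simp⟩, ?_⟩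
    rw [g.eq_graph] at hx
    obtain ⟨t', _, h'⟩ := hx
    have h1 : B.tangential (B.chart (t', h t')) = B.tangential (B.chart (t, z)) :=
      congrArg B.tangential h'
    have h2 : B.height (B.chart (t', h t')) = B.height (B.chart (t, z)) := congrArg B.height h'
    simp only [Frame.tangential_chart, Frame.height_chart] at h1 h2
    rw [← h2, h1]
  · rintro ⟨ht, rfl⟩
    exact g.graphMap_mem ht

theorem isClosed_patch (g : IsGraphPatch B φ h A) (hA : IsCompact A) : IsClosed (patch φ A) :=
  g.continuousOn.preimage_isClosed_of_isClosed hA.isClosed (isClosed_singleton (x := (0 : ℝ)))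

theorem isCompact_patch (g : IsGraphPatch B φ h A) (hA : IsCompact A) : IsCompact (patch φ A) :=
  hA.of_isClosed_subset (g.isClosed_patch hA) fun _ hx => hx.1

theorem isCompact_graphBase (g : IsGraphPatch B φ h A) (hA : IsCompact A) :
    IsCompact (B.graphBase φ A) :=
  (g.isCompact_patch hA).image B.continuous_tangential

theorem measurableSet_immersed (g : IsGraphPatch B φ h A) (hA : IsCompact A) :
    MeasurableSet (immersed φ A) :=
  (g.continuousOn.preimage_isClosed_of_isClosed hA.isClosed (isClosed_Iic (a := (0 : ℝ)))).measurableSet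

/-- The orientation hypothesis enters the proof only through this sign. It implies in particular
that the gradient of `φ` does not vanish on the patch. -/
theorem fderiv_normal_pos (g : IsGraphPatch B φ h A) {x : E3} (hx : x ∈ patch φ A) :
    0 < fderiv ℝ φ x (B.basis 2) := by
  have h1 := g.oriented x hx
  rw [unitNormal, real_inner_smul_left, inner_gradient_left] at h1
  exact pos_of_mul_pos_right h1 (inv_nonneg.2 (norm_nonneg _))

/-- Near the patch the level-set function increases uniformly in the direction of the frame normal,
and the points of small level on a vertical line are close to each other. -/
theorem exists_uniform (g : IsGraphPatch B φ h A) (hA : IsCompact A) :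
    ∃ c > 0, ∃ M, ∃ η > 0, ∃ δ > 0,
      (∀ x ∈ A, |φ x| < δ → ∀ y ∈ Metric.ball x η,
        ContDiffAt ℝ 1 φ y ∧ c ≤ fderiv ℝ φ y (B.basis 2) ∧ ‖fderiv ℝ φ y‖ ≤ M) ∧
      ∀ t z z', B.chart (t, z) ∈ A → B.chart (t, z') ∈ A → |φ (B.chart (t, z))| < δ →
        |φ (B.chart (t, z'))| < δ → |z - z'| < η := by
  have hcd : ∀ x ∈ patch φ A, ContDiffAt ℝ 1 φ x := fun x hx =>
    (g.contDiffAt x hx).of_le (by norm_num)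
  have hcont : ∀ x ∈ patch φ A, ContinuousAt (fderiv ℝ φ) x := fun x hx =>
    ((hcd x hx).fderiv_right (m := 0) (by norm_num)).continuousAt
  have hcont2 : ∀ x ∈ patch φ A, ContinuousAt (fun y => fderiv ℝ φ y (B.basis 2)) x :=
    fun x hx => (hcont x hx).clm_apply continuousAt_const
  obtain ⟨c, hc, hcle⟩ := (g.isCompact_patch hA).exists_forall_le'
    (f := fun y => fderiv ℝ φ y (B.basis 2))
    (fun x hx => (hcont2 x hx).continuousWithinAt) (a := 0) fun x hx => g.fderiv_normal_pos hx
  obtain ⟨M, hM⟩ := (g.isCompact_patch hA).exists_bound_of_continuousOn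
    (f := fderiv ℝ φ) (fun x hx => (hcont x hx).continuousWithinAt)
  -- The bounds hold on the patch with `c` and `M`; relaxed to `c / 2` and `M + 1` they hold on a
  -- neighbourhood, which by compactness contains an `r`-thickening of the patch.
  set U : Set E3 := {y | ContDiffAt ℝ 1 φ y ∧ c / 2 ≤ fderiv ℝ φ y (B.basis 2) ∧
    ‖fderiv ℝ φ y‖ ≤ M + 1} with hU
  have hpU : patch φ A ⊆ interior U := by
    intro x hx
    rw [mem_interior_iff_mem_nhds]
    filter_upwards [(hcd x hx).eventually (by simp),
      (hcont2 x hx).eventually_const_le (show c / 2 < _ by linarith [hcle x hx]),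
      (hcont x hx).norm.eventually_le_const (show _ < M + 1 by linarith [hM x hx])] with y h1 h2 h3
    exact ⟨h1, h2, h3⟩
  obtain ⟨r, hr, hrU⟩ := (g.isCompact_patch hA).exists_thickening_subset_open isOpen_interior hpU
  -- Outside the `r / 2`-thickening `|φ|` has a positive lower bound. A point of smaller level is
  -- therefore within `r / 2` of the patch, and the ball of radius `r / 2` around it stays in the
  -- `r`-thickening.
  obtain ⟨δ₁, hδ₁, h₁⟩ := (hA.diff (Metric.isOpen_thickening (δ := r / 2)
    (E := patch φ A))).exists_forall_le' (f := fun x => |φ x|)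
    (g.continuousOn.mono sdiff_subset).abs (a := 0) fun x hx => by
      rw [abs_pos]
      intro h0
      exact hx.2 (Metric.self_subset_thickening (half_pos hr) _ ⟨hx.1, h0⟩)
  -- Pairs of points of one vertical line at distance at least `r / 2` form a compact set. By the
  -- vertical line test `φ` never vanishes at both points, so the larger of the two levels is
  -- bounded below.
  have hQ : IsCompact ((A ×ˢ A) ∩ {p : E3 × E3 | B.tangential p.1 = B.tangential p.2 ∧
      r / 2 ≤ |B.height p.1 - B.height p.2|}) := by
    refine (hA.prod hA).inter_right ?_
    have h1 : IsClosed {p : E3 × E3 | B.tangential p.1 = B.tangential p.2} :=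
      isClosed_eq (B.continuous_tangential.comp continuous_fst)
        (B.continuous_tangential.comp continuous_snd)
    have h2 : IsClosed {p : E3 × E3 | r / 2 ≤ |B.height p.1 - B.height p.2|} :=
      isClosed_le continuous_const ((B.continuous_height.comp continuous_fst).sub
        (B.continuous_height.comp continuous_snd)).abs
    exact h1.inter h2
  obtain ⟨δ₂, hδ₂, h₂⟩ := hQ.exists_forall_le' (f := fun p => max |φ p.1| |φ p.2|)
    (ContinuousOn.sup (f := fun p : E3 × E3 => |φ p.1|) (g := fun p : E3 × E3 => |φ p.2|)
      (g.continuousOn.comp (f := Prod.fst) continuousOn_fst fun p hp => hp.1.1).abs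
      (g.continuousOn.comp (f := Prod.snd) continuousOn_snd fun p hp => hp.1.2).abs) (a := 0) fun p hp => by
      by_contra hle
      rw [not_lt, max_le_iff, abs_nonpos_iff, abs_nonpos_iff] at hle
      obtain ⟨⟨hp1, hp2⟩, hpt, hph⟩ := hp
      have e1 : B.chart (B.tangential p.1, B.height p.1) ∈ patch φ A := by
        rw [B.chart_coordinates]; exact ⟨hp1, hle.1⟩
      have e2 : B.chart (B.tangential p.2, B.height p.2) ∈ patch φ A := by
        rw [B.chart_coordinates]; exact ⟨hp2, hle.2⟩
      rw [g.mem_graphBase_iff] at e1 e2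
      rw [e1.2, e2.2, hpt, sub_self, abs_zero] at hph
      linarith
  refine ⟨c / 2, half_pos hc, M + 1, r / 2, half_pos hr, min δ₁ δ₂, lt_min hδ₁ hδ₂, ?_, ?_⟩
  · intro x hx hφ y hy
    have hxt : x ∈ Metric.thickening (r / 2) (patch φ A) := by
      by_contra hn
      exact absurd (h₁ x ⟨hx, hn⟩) (not_le.2 (hφ.trans_le (min_le_left _ _)))
    have hyU : y ∈ interior U := by
      apply hrU
      rw [Metric.mem_thickening_iff] at hxt ⊢
      obtain ⟨p, hp, hxp⟩ := hxt
      refine ⟨p, hp, (dist_triangle y x p).trans_lt ?_⟩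
      linarith [Metric.mem_ball.1 hy]
    exact (interior_subset hyU : y ∈ U)
  · intro t z z' hz hz' hφ hφ'
    by_contra hn
    have := h₂ (B.chart (t, z), B.chart (t, z')) ⟨⟨hz, hz'⟩, by simp, by simpa using hn⟩
    exact absurd this (not_le.2 (max_lt (hφ.trans_le (min_le_right _ _))
      (hφ'.trans_le (min_le_right _ _))))

/-- The derivative of the level-set function vanishes on tangent vectors of the graph. -/
theorem fderiv_tangent_eq_zero (g : IsGraphPatch B φ h A)
    (hreg : closure (interior (B.graphBase φ A)) = B.graphBase φ A) {t : E2}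
    (ht : t ∈ B.graphBase φ A) (v : E2) :
    fderiv ℝ φ (B.chart (t, h t))
      (v 0 • B.basis 0 + v 1 • B.basis 1 + fderiv ℝ h t v • B.basis 2) = 0 := by
  set S := B.graphBase φ A with hS
  set L : E2 → E3 := fun t => v 0 • B.basis 0 + v 1 • B.basis 1 + fderiv ℝ h t v • B.basis 2 with hL
  have hgraph : ∀ t ∈ S, HasFDerivAt (fun t => B.chart (t, h t))
      (((EuclideanSpace.proj 0 : E2 →L[ℝ] ℝ).smulRight (B.basis 0) +
        (EuclideanSpace.proj 1 : E2 →L[ℝ] ℝ).smulRight (B.basis 1)) +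
        (fderiv ℝ h t).smulRight (B.basis 2)) t := by
    intro t ht
    have hh : HasFDerivAt h (fderiv ℝ h t) t :=
      ((g.height_contDiffAt t ht).differentiableAt (by norm_num)).hasFDerivAt
    have h0 := ((EuclideanSpace.proj 0 : E2 →L[ℝ] ℝ).hasFDerivAt (x := t)).smul_const (B.basis 0)
    have h1 := ((EuclideanSpace.proj 1 : E2 →L[ℝ] ℝ).hasFDerivAt (x := t)).smul_const (B.basis 1)
    exact ((h0.add h1).const_add B.base).add (hh.smul_const (B.basis 2))
  -- Over interior points of the base, `φ` vanishes identically along the graph and the chain rule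
  -- applies. The identity extends to the boundary of the base by continuity, because the base is
  -- regular closed.
  have hEq : EqOn (fun t => fderiv ℝ φ (B.chart (t, h t)) (L t)) (fun _ => 0) (interior S) := by
    intro t ht
    have htS := interior_subset ht
    have hφ : HasFDerivAt φ (fderiv ℝ φ (B.chart (t, h t))) (B.chart (t, h t)) :=
      ((g.contDiffAt _ (g.graphMap_mem htS)).differentiableAt (by norm_num)).hasFDerivAt
    have hcomp := hφ.comp t (hgraph t htS)
    have hzero : (φ ∘ fun t => B.chart (t, h t)) =ᶠ[𝓝 t] fun _ => 0 := by
      filter_upwards [mem_interior_iff_mem_nhds.1 ht] with s hs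
      exact (g.graphMap_mem hs).2
    have := hcomp.unique ((hasFDerivAt_const (0 : ℝ) t).congr_of_eventuallyEq hzero)
    have := congrArg (fun l : E2 →L[ℝ] ℝ => l v) this
    simpa [hL] using this
  have hcont : ContinuousOn (fun t => fderiv ℝ φ (B.chart (t, h t)) (L t)) S := by
    intro t ht
    have h1 : ContinuousAt (fun t => fderiv ℝ φ (B.chart (t, h t))) t :=
      ContinuousAt.comp (g := fderiv ℝ φ) (f := fun t => B.chart (t, h t))
        ((g.contDiffAt _ (g.graphMap_mem ht)).fderiv_right (m := 0) (by norm_num)).continuousAt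
        (hgraph t ht).continuousAt
    have h2 : ContinuousAt (fderiv ℝ h) t :=
      ((g.height_contDiffAt t ht).fderiv_right (m := 0) (by norm_num)).continuousAt
    refine (h1.clm_apply ?_).continuousWithinAt
    exact continuousAt_const.add ((h2.clm_apply continuousAt_const).smul continuousAt_const)
  exact hEq.of_subset_closure hcont continuousOn_const interior_subset hreg.ge ht

theorem gradient_apply (f : E2 → ℝ) (t : E2) (i : Fin 2) :
    (gradient f t) i = fderiv ℝ f t (EuclideanSpace.single i 1) := by
  rw [← inner_gradient_left, EuclideanSpace.inner_single_right]
  simp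

/-- On the graph, the radial derivative of the level-set function is the reduced height, up to the
factor `∂φ / ∂n₀`. -/
theorem fderiv_radial (g : IsGraphPatch B φ h A)
    (hreg : closure (interior (B.graphBase φ A)) = B.graphBase φ A) {t : E2}
    (ht : t ∈ B.graphBase φ A) (xref : E3) :
    fderiv ℝ φ (B.chart (t, h t)) (B.chart (t, h t) - xref) =
      fderiv ℝ φ (B.chart (t, h t)) (B.basis 2) * B.reducedHeight h xref t := by
  set l := fderiv ℝ φ (B.chart (t, h t)) with hl
  -- The tangent vector `τ₁ + ∂₁h n₀` is annihilated by `Dφ`; the same holds for `τ₂`. So all of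
  -- `Dφ` is a multiple of the normal derivative.
  have h0 : l (B.basis 0) = -(gradient h t 0) * l (B.basis 2) := by
    have := g.fderiv_tangent_eq_zero hreg ht (EuclideanSpace.single 0 1)
    rw [← gradient_apply] at this
    simp at this
    linarith
  have h1 : l (B.basis 1) = -(gradient h t 1) * l (B.basis 2) := by
    have := g.fderiv_tangent_eq_zero hreg ht (EuclideanSpace.single 1 1)
    rw [← gradient_apply] at this
    simp at this
    linarith
  have hx : B.chart (t, h t) - xref =
      (t 0 + inner ℝ (B.basis 0) (B.base - xref)) • B.basis 0 +
        (t 1 + inner ℝ (B.basis 1) (B.base - xref)) • B.basis 1 +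
        (h t + inner ℝ (B.basis 2) (B.base - xref)) • B.basis 2 := by
    have := B.sum_inner_basis (B.base - xref)
    calc B.chart (t, h t) - xref = (B.base - xref) + (t 0 • B.basis 0 + t 1 • B.basis 1 +
          h t • B.basis 2) := by simp only [Frame.chart]; abel
      _ = _ := by
          nth_rewrite 1 [← this]
          module
  have hin : (inner ℝ (gradient h t) t : ℝ) = gradient h t 0 * t 0 + gradient h t 1 * t 1 := by
    rw [PiLp.inner_apply, Fin.sum_univ_two]
    simp [mul_comm]
  rw [hx, map_add, map_add, map_smul, map_smul, map_smul, h0, h1, Frame.reducedHeight, hin,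
    inner_sub_right (B.base - xref), inner_add_right, real_inner_smul_right,
    real_inner_smul_right, real_inner_comm (B.basis 0), real_inner_comm (B.basis 1), real_inner_comm (B.basis 2)]
  simp only [smul_eq_mul]
  ring

end IsGraphPatch

/-! ### Smoothed indicators of a sublevel set and their derivatives -/

theorem stepDensity_div_eq_zero {s ε : ℝ} (hε : 0 < ε) (hs : s ≤ 0 ∨ ε ≤ s) :
    stepDensity (s / ε) = 0 := by
  rcases hs with hs | hs
  · exact stepDensity_of_nonpos (div_nonpos_of_nonpos_of_nonneg hs hε.le)
  · exact stepDensity_of_one_le ((one_le_div hε).2 hs)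

/-- The derivative of `smoothStep (φ / ε)`. -/
def stepDeriv (φ : E3 → ℝ) (ε : ℝ) (x : E3) : E3 →L[ℝ] ℝ :=
  (-(ε⁻¹ * stepDensity (φ x / ε))) • fderiv ℝ φ x

theorem stepDeriv_eq_zero {φ : E3 → ℝ} {ε : ℝ} {x : E3} (hε : 0 < ε) (hx : φ x ≤ 0 ∨ ε ≤ φ x) :
    stepDeriv φ ε x = 0 := by
  simp [stepDeriv, stepDensity_div_eq_zero hε hx]

theorem stepDeriv_apply (φ : E3 → ℝ) (ε : ℝ) (x v : E3) :
    stepDeriv φ ε x v = -(ε⁻¹ * stepDensity (φ x / ε) * fderiv ℝ φ x v) := by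
  simp [stepDeriv]

/-- Uniform behaviour of a level-set function near its zeros: its derivative in the direction of
the frame normal is bounded below, and points of small level on a vertical line are close. -/
structure UniformLevel (B : Frame) (φ : E3 → ℝ) (A : Set E3) (c M η δ : ℝ) : Prop where
  c_pos : 0 < c
  eta_pos : 0 < η
  delta_pos : 0 < δ
  near : ∀ x ∈ A, |φ x| < δ → ∀ y ∈ Metric.ball x η,
    ContDiffAt ℝ 1 φ y ∧ c ≤ fderiv ℝ φ y (B.basis 2) ∧ ‖fderiv ℝ φ y‖ ≤ M
  close : ∀ t z z', B.chart (t, z) ∈ A → B.chart (t, z') ∈ A → |φ (B.chart (t, z))| < δ →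
    |φ (B.chart (t, z'))| < δ → |z - z'| < η

theorem Frame.dist_chart_fiber (B : Frame) (t : E2) (z z' : ℝ) :
    dist (B.chart (t, z)) (B.chart (t, z')) = |z - z'| := by
  have : B.chart (t, z) - B.chart (t, z') = (z - z') • B.basis 2 := by
    simp only [Frame.chart]; module
  rw [dist_eq_norm, this, norm_smul, B.basis.orthonormal.1 2, mul_one, Real.norm_eq_abs]

theorem Frame.hasDerivAt_fiber (B : Frame) {φ : E3 → ℝ} {t : E2} {z : ℝ}
    (hφ : DifferentiableAt ℝ φ (B.chart (t, z))) :
    HasDerivAt (fun z => φ (B.chart (t, z))) (fderiv ℝ φ (B.chart (t, z)) (B.basis 2)) z := by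
  have h : HasDerivAt (fun z => B.chart (t, z)) (B.basis 2) z := by
    refine (((hasDerivAt_id z).smul_const (B.basis 2)).const_add
      (B.base + (t 0 • B.basis 0 + t 1 • B.basis 1))).congr_deriv ?_
    rw [one_smul]
  exact hφ.hasFDerivAt.comp_hasDerivAt z h

namespace UniformLevel

variable {B : Frame} {φ : E3 → ℝ} {A : Set E3} {c M η δ : ℝ}

theorem near_self (U : UniformLevel B φ A c M η δ) {x : E3} (hx : x ∈ A) (hφ : |φ x| < δ) :
    ContDiffAt ℝ 1 φ x ∧ c ≤ fderiv ℝ φ x (B.basis 2) ∧ ‖fderiv ℝ φ x‖ ≤ M :=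
  U.near x hx hφ x (Metric.mem_ball_self U.eta_pos)

/-- `close` places the whole segment between the two points in a ball where the normal derivative is
at least `c`, even where that segment leaves `A`; then the mean value inequality applies. -/
theorem mul_sub_le (U : UniformLevel B φ A c M η δ) {t : E2} {z z' : ℝ}
    (hz : B.chart (t, z) ∈ A) (hz' : B.chart (t, z') ∈ A) (hφ : |φ (B.chart (t, z))| < δ)
    (hφ' : |φ (B.chart (t, z'))| < δ) (hle : z ≤ z') :
    c * (z' - z) ≤ φ (B.chart (t, z')) - φ (B.chart (t, z)) := by
  have hclose := U.close t z' z hz' hz hφ' hφ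
  rw [abs_of_nonneg (by linarith)] at hclose
  have hball : ∀ y ∈ Icc z z', B.chart (t, y) ∈ Metric.ball (B.chart (t, z)) η := by
    intro y hy
    rw [Metric.mem_ball, B.dist_chart_fiber, abs_of_nonneg (by linarith [hy.1])]
    linarith [hy.2]
  have hd : ∀ y ∈ Icc z z', HasDerivAt (fun z => φ (B.chart (t, z)))
      (fderiv ℝ φ (B.chart (t, y)) (B.basis 2)) y := fun y hy =>
    B.hasDerivAt_fiber ((U.near _ hz hφ _ (hball y hy)).1.differentiableAt (by norm_num))
  exact (convex_Icc z z').mul_sub_le_image_sub_of_le_deriv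
    (fun y hy => (hd y hy).continuousAt.continuousWithinAt)
    (fun y hy => (hd y (interior_subset hy)).differentiableAt.differentiableWithinAt)
    (fun y hy => by
      rw [(hd y (interior_subset hy)).deriv]
      exact (U.near _ hz hφ _ (hball y (interior_subset hy))).2.1)
    z (left_mem_Icc.2 hle) z' (right_mem_Icc.2 hle) hle

/-- Away from the patch `φ` is merely continuous. Where `|φ| < δ` the chain rule is available;
elsewhere `ε < δ` makes the step locally constant, in agreement with `stepDeriv = 0`. -/
theorem hasFDerivAt_smoothStep (U : UniformLevel B φ A c M η δ) (hφ : ContinuousOn φ A) {ε : ℝ}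
    (hε : 0 < ε) (hεδ : ε < δ) {x : E3} (hx : x ∈ interior A) :
    HasFDerivAt (fun x => smoothStep (φ x / ε)) (stepDeriv φ ε x) x := by
  have hxA := interior_subset hx
  have hcont : ContinuousAt φ x := hφ.continuousAt (mem_interior_iff_mem_nhds.1 hx)
  by_cases h : |φ x| < δ
  · have hd := ((U.near_self hxA h).1.differentiableAt (by norm_num)).hasFDerivAt
    have h1 : HasFDerivAt (fun x => φ x / ε) (ε⁻¹ • fderiv ℝ φ x) x := by
      simpa only [div_eq_inv_mul] using hd.const_mul ε⁻¹
    refine ((hasDerivAt_smoothStep (φ x / ε)).comp_hasFDerivAt x h1).congr_fderiv ?_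
    rw [stepDeriv, smul_smul]
    congr 1
    ring
  · rcases le_abs.1 (not_lt.1 h) with h | h
    · rw [stepDeriv_eq_zero hε (Or.inr (by linarith))]
      refine (hasFDerivAt_const (0 : ℝ) x).congr_of_eventuallyEq ?_
      filter_upwards [hcont.eventually_const_le (show ε < φ x by linarith)] with y hy
      exact smoothStep_of_one_le ((one_le_div hε).2 hy)
    · rw [stepDeriv_eq_zero hε (Or.inl (by linarith [U.delta_pos]))]
      refine (hasFDerivAt_const (1 : ℝ) x).congr_of_eventuallyEq ?_
      filter_upwards [hcont.eventually_le_const (show φ x < 0 by linarith [U.delta_pos])] with y hy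
      exact smoothStep_of_nonpos (div_nonpos_of_nonpos_of_nonneg hy hε.le)

theorem norm_stepDeriv_le (U : UniformLevel B φ A c M η δ) {ε : ℝ} (hε : 0 < ε) (hεδ : ε < δ)
    {x : E3} (hx : x ∈ A) : ‖stepDeriv φ ε x‖ ≤ ε⁻¹ * (2 * |M|) := by
  have h0 : 0 ≤ ε⁻¹ := inv_nonneg.2 hε.le
  by_cases h : φ x ≤ 0 ∨ ε ≤ φ x
  · rw [stepDeriv_eq_zero hε h, norm_zero]
    positivity
  · rw [not_or, not_le, not_le] at h
    have hM := (U.near_self hx (by rw [abs_of_pos h.1]; linarith)).2.2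
    rw [stepDeriv, norm_smul, norm_neg, norm_mul, Real.norm_of_nonneg h0,
      Real.norm_of_nonneg (stepDensity_nonneg _), mul_assoc]
    gcongr
    · exact stepDensity_le _
    · exact hM.trans (le_abs_self M)

theorem integrableOn_stepDeriv (U : UniformLevel B φ A c M η δ) (hA : IsCompact A)
    (hφ : ContinuousOn φ A) {ε : ℝ} (hε : 0 < ε) (hεδ : ε < δ) (v : E3) :
    IntegrableOn (fun x => stepDeriv φ ε x v) A := by
  refine IntegrableOn.of_bound hA.measure_lt_top ?_ (ε⁻¹ * (2 * |M|) * ‖v‖) ?_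
  · simp only [stepDeriv_apply]
    refine (AEStronglyMeasurable.mul (AEStronglyMeasurable.const_mul ?_ _) ?_).neg
    · exact (continuous_stepDensity.comp_continuousOn (hφ.div_const ε)).aestronglyMeasurable
        hA.measurableSet
    · exact (measurable_fderiv_apply_const ℝ φ v).aestronglyMeasurable
  · filter_upwards [ae_restrict_mem hA.measurableSet] with x hx
    exact (ContinuousLinearMap.le_opNorm _ _).trans
      (mul_le_mul_of_nonneg_right (U.norm_stepDeriv_le hε hεδ hx) (norm_nonneg v))

theorem integrableOn_stepDeriv_radial (U : UniformLevel B φ A c M η δ) (hA : IsCompact A)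
    (hφ : ContinuousOn φ A) {ε : ℝ} (hε : 0 < ε) (hεδ : ε < δ) (xref : E3) :
    IntegrableOn (fun x => stepDeriv φ ε x (x - xref)) A := by
  have h : (fun x => stepDeriv φ ε x (x - xref)) = fun x => ∑ i, stepDeriv φ ε x (B.basis i) *
      inner ℝ (B.basis i) (x - xref) := by
    funext x
    conv_lhs => rw [← B.basis.sum_repr' (x - xref), map_sum]
    exact Finset.sum_congr rfl fun i _ => by rw [map_smul, smul_eq_mul, mul_comm]
  rw [h]
  exact integrable_finsetSum _ fun i _ =>
    (U.integrableOn_stepDeriv hA hφ hε hεδ (B.basis i)).mul_continuousOn (by fun_prop) hA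

/-- This is the majorant for dominated convergence. Heights with level in `(0, ε)` differ by less
than `ε / c`, so an integrand of size `2|M||R| / ε` lives on a length of at most `2ε / c`, and `ε`
cancels. -/
theorem norm_integral_fiber_le (U : UniformLevel B φ A c M η δ) (hA : IsCompact A) {ε R : ℝ}
    (hε : 0 < ε) (hεδ : ε < δ) (xref : E3) (hR : ∀ x ∈ A, ‖x - xref‖ ≤ R) (t : E2) :
    ‖∫ z in B.fiber A t, stepDeriv φ ε (B.chart (t, z)) (B.chart (t, z) - xref)‖ ≤
      (B.tangential '' A).indicator (fun _ => 4 * |M| * |R| / c) t := by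
  have hc := U.c_pos
  by_cases hne : ∃ z₁ ∈ B.fiber A t, 0 < φ (B.chart (t, z₁)) ∧ φ (B.chart (t, z₁)) < ε
  · obtain ⟨z₁, hz₁, hpos, hlt⟩ := hne
    have htA : t ∈ B.tangential '' A := ⟨_, hz₁, by simp⟩
    rw [indicator_of_mem htA]
    have hm := B.measurableSet_fiber hA t
    have hsub : ∀ z ∈ B.fiber A t, z ∉ B.fiber A t ∩ Icc (z₁ - ε / c) (z₁ + ε / c) →
        stepDeriv φ ε (B.chart (t, z)) (B.chart (t, z) - xref) = 0 := by
      intro z hz hz'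
      by_contra h0
      have h1 : ¬ (φ (B.chart (t, z)) ≤ 0 ∨ ε ≤ φ (B.chart (t, z))) := fun h => h0 (by
        rw [stepDeriv_eq_zero hε h]; rfl)
      rw [not_or, not_le, not_le] at h1
      refine hz' ⟨hz, ?_⟩
      have e1 : |φ (B.chart (t, z))| < δ := by rw [abs_of_pos h1.1]; linarith [h1.2]
      have e2 : |φ (B.chart (t, z₁))| < δ := by rw [abs_of_pos hpos]; linarith
      have e3 : c * (ε / c) = ε := by field_simp
      rcases le_total z z₁ with hle | hle
      · have := U.mul_sub_le hz hz₁ e1 e2 hle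
        have h0' : z₁ - z < ε / c := by rw [lt_div_iff₀ hc]; nlinarith
        have : 0 < ε / c := div_pos hε hc
        exact ⟨by linarith, by linarith⟩
      · have := U.mul_sub_le hz₁ hz e2 e1 hle
        have h0' : z - z₁ < ε / c := by rw [lt_div_iff₀ hc]; nlinarith
        have : 0 < ε / c := div_pos hε hc
        exact ⟨by linarith, by linarith⟩
    rw [setIntegral_eq_of_subset_of_forall_sdiff_eq_zero hm
      (inter_subset_left (t := Icc (z₁ - ε / c) (z₁ + ε / c))) fun z hz => hsub z hz.1 hz.2]
    have hvol : volume.real (B.fiber A t ∩ Icc (z₁ - ε / c) (z₁ + ε / c)) ≤ 2 * (ε / c) := by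
      refine (measureReal_mono inter_subset_right measure_Icc_lt_top.ne).trans ?_
      rw [Real.volume_real_Icc_of_le (by linarith [div_pos hε hc])]
      linarith
    have hK : 0 ≤ ε⁻¹ * (2 * |M|) * |R| := by positivity
    calc _ ≤ ε⁻¹ * (2 * |M|) * |R| *
          volume.real (B.fiber A t ∩ Icc (z₁ - ε / c) (z₁ + ε / c)) := by
          refine norm_setIntegral_le_of_norm_le_const
            ((measure_mono inter_subset_right).trans_lt measure_Icc_lt_top) fun z hz => ?_
          refine (ContinuousLinearMap.le_opNorm _ _).trans ?_
          gcongr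
          · exact U.norm_stepDeriv_le hε hεδ hz.1
          · exact (hR _ hz.1).trans (le_abs_self R)
      _ ≤ ε⁻¹ * (2 * |M|) * |R| * (2 * (ε / c)) := mul_le_mul_of_nonneg_left hvol hK
      _ = 4 * |M| * |R| / c := by field_simp; ring
  · have h0 : ∫ z in B.fiber A t, stepDeriv φ ε (B.chart (t, z)) (B.chart (t, z) - xref) = 0 := by
      refine setIntegral_eq_zero_of_forall_eq_zero fun z hz => ?_
      have : φ (B.chart (t, z)) ≤ 0 ∨ ε ≤ φ (B.chart (t, z)) := by
        by_contra h
        rw [not_or, not_le, not_le] at h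
        exact hne ⟨z, hz, h⟩
      rw [stepDeriv_eq_zero hε this]
      rfl
    rw [h0, norm_zero]
    exact indicator_nonneg (fun _ _ => by positivity) t

/-- Near an interior point the fibre contains `[z₀, z₀ + ρ]`. For `ε < c ρ` monotonicity confines
all levels in `(0, ε)` to that interval, so `tendsto_integral_stepDensity` gives the limit; the sign
comes from the decreasing step. -/
theorem tendsto_integral_fiber_of_mem_interior (U : UniformLevel B φ A c M η δ) (hA : IsCompact A)
    (xref : E3) {t : E2} {z₀ : ℝ} (hx : B.chart (t, z₀) ∈ interior A)
    (h0 : φ (B.chart (t, z₀)) = 0) :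
    Tendsto (fun ε => ∫ z in B.fiber A t,
      stepDeriv φ ε (B.chart (t, z)) (B.chart (t, z) - xref)) (𝓝[>] 0)
      (𝓝 (-(fderiv ℝ φ (B.chart (t, z₀)) (B.chart (t, z₀) - xref) /
        fderiv ℝ φ (B.chart (t, z₀)) (B.basis 2)))) := by
  have hc := U.c_pos
  have hxA := interior_subset hx
  have hδ0 : |φ (B.chart (t, z₀))| < δ := by rw [h0, abs_zero]; exact U.delta_pos
  obtain ⟨r, hr, hrA⟩ := Metric.isOpen_iff.1 isOpen_interior _ hx
  set ρ := min r η / 2 with hρdef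
  have hmin : 0 < min r η := lt_min hr U.eta_pos
  have hρ : 0 < ρ := half_pos hmin
  have hball : ∀ z ∈ Icc z₀ (z₀ + ρ), dist (B.chart (t, z)) (B.chart (t, z₀)) < min r η := by
    intro z hz
    rw [B.dist_chart_fiber, abs_of_nonneg (by linarith [hz.1])]
    linarith [hz.2]
  have hmem : ∀ z ∈ Icc z₀ (z₀ + ρ), B.chart (t, z) ∈ A := fun z hz =>
    interior_subset (hrA (Metric.mem_ball.2 ((hball z hz).trans_le (min_le_left _ _))))
  have hnear : ∀ z ∈ Icc z₀ (z₀ + ρ), ContDiffAt ℝ 1 φ (B.chart (t, z)) ∧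
      c ≤ fderiv ℝ φ (B.chart (t, z)) (B.basis 2) ∧ ‖fderiv ℝ φ (B.chart (t, z))‖ ≤ M := fun z hz =>
    U.near _ hxA hδ0 _ (Metric.mem_ball.2 ((hball z hz).trans_le (min_le_right _ _)))
  have hfc : ContinuousOn (fun z => fderiv ℝ φ (B.chart (t, z))) (Icc z₀ (z₀ + ρ)) := by
    intro z hz
    exact (ContinuousAt.comp (g := fderiv ℝ φ) (f := fun z => B.chart (t, z))
      ((hnear z hz).1.fderiv_right (m := 0) (by norm_num)).continuousAt
      (B.continuous_chart_fiber t).continuousAt).continuousWithinAt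
  have key := tendsto_integral_stepDensity (q := fun z => φ (B.chart (t, z)))
    (w := fun z => fderiv ℝ φ (B.chart (t, z)) (B.chart (t, z) - xref)) hρ hc
    (fun z hz => B.hasDerivAt_fiber ((hnear z hz).1.differentiableAt (by norm_num)))
    (hfc.clm_apply continuousOn_const) (fun z hz => (hnear z hz).2.1)
    (hfc.clm_apply ((B.continuous_chart_fiber t).continuousOn.sub continuousOn_const)) h0
  refine key.neg.congr' ?_
  filter_upwards [self_mem_nhdsWithin, nhdsWithin_le_nhds (Iio_mem_nhds U.delta_pos),
    nhdsWithin_le_nhds (Iio_mem_nhds (mul_pos hc hρ))] with ε hε hεδ hερ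
  simp only [mem_Ioi, mem_Iio] at hε hεδ hερ
  rw [intervalIntegral.integral_of_le (by linarith), ← integral_neg]
  simp only [stepDeriv_apply]
  refine (setIntegral_eq_of_subset_of_forall_sdiff_eq_zero (B.measurableSet_fiber hA t)
    (fun z hz => hmem z (Ioc_subset_Icc_self hz)) fun z hz => ?_).symm
  by_cases h : φ (B.chart (t, z)) ≤ 0 ∨ ε ≤ φ (B.chart (t, z))
  · rw [stepDensity_div_eq_zero hε h]
    ring
  · rw [not_or, not_le, not_le] at h
    have e1 : |φ (B.chart (t, z))| < δ := by rw [abs_of_pos h.1]; linarith [h.2]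
    exfalso
    rcases le_or_gt z z₀ with hle | hle
    · have := U.mul_sub_le hz.1 hxA e1 hδ0 hle
      rw [h0] at this
      nlinarith [h.1]
    · have := U.mul_sub_le hxA hz.1 hδ0 e1 hle.le
      rw [h0] at this
      refine hz.2 ⟨hle, ?_⟩
      nlinarith [h.2]

end UniformLevel

/-! ### The volume formula with an integral over the graph base -/

namespace IsGraphPatch

variable {B : Frame} {φ : E3 → ℝ} {h : E2 → ℝ}

/-- Projection preserves null sets of a plane, so almost no graph point lies on a face. This is the
use of the zero-area hypothesis. -/
theorem ae_mem_interior {C : Polyhedron} (g : IsGraphPatch B φ h C.carrier)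
    (null : MeetsFacesInNullSets C φ) :
    ∀ᵐ t : E2, t ∈ B.graphBase φ C.carrier → B.chart (t, h t) ∈ interior C.carrier := by
  have h1 : ∀ᵐ t : E2, ∀ k, t ∉ B.tangential '' patch φ (C.face k).region := by
    rw [ae_all_iff]
    intro k
    exact measure_eq_zero_iff_ae_notMem.1 ((C.face k).frame.volume_image_tangential_null B
      (fun x hx => (C.face k).region_subset_plane hx.1) (null k))
  filter_upwards [h1] with t ht htS
  have hp := g.graphMap_mem htS
  by_contra hn
  have hf : B.chart (t, h t) ∈ frontier C.carrier := by
    rw [C.isCompact.isClosed.frontier_eq]; exact ⟨hp.1, hn⟩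
  rw [C.frontier_eq] at hf
  obtain ⟨k, hk⟩ := mem_iUnion.1 hf
  exact ht k ⟨_, ⟨hk, hp.2⟩, by simp⟩

/-- Dominated convergence over the fibres. Over the base the factor `∂φ / ∂n₀` of `fderiv_radial`
cancels the one from the one-dimensional concentration, leaving `-ĥ`. Over other points `|φ|` is
bounded below on the compact fibre, so the integral is eventually zero. -/
theorem tendsto_integral_stepDeriv {C : Polyhedron} (g : IsGraphPatch B φ h C.carrier)
    (null : MeetsFacesInNullSets C φ)
    (hreg : closure (interior (B.graphBase φ C.carrier)) = B.graphBase φ C.carrier) (xref : E3) :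
    Tendsto (fun ε => ∫ x in C.carrier, stepDeriv φ ε x (x - xref)) (𝓝[>] 0)
      (𝓝 (-∫ t in B.graphBase φ C.carrier, B.reducedHeight h xref t)) := by
  obtain ⟨c, hc, M, η, hη, δ, hδ, hnear, hclose⟩ := g.exists_uniform C.isCompact
  have U : UniformLevel B φ C.carrier c M η δ := ⟨hc, hη, hδ, hnear, hclose⟩
  have hS := (g.isCompact_graphBase C.isCompact).measurableSet
  obtain ⟨R, hR⟩ := C.isCompact.exists_bound_of_continuousOn (f := fun x => x - xref)
    (by fun_prop)
  have hsmall : ∀ᶠ ε in 𝓝[>] (0 : ℝ), 0 < ε ∧ ε < δ := by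
    filter_upwards [self_mem_nhdsWithin, nhdsWithin_le_nhds (Iio_mem_nhds hδ)] with ε h1 h2
    exact ⟨h1, h2⟩
  have hcT : IsCompact (B.tangential '' C.carrier) := C.isCompact.image B.continuous_tangential
  rw [← integral_neg, ← integral_indicator hS]
  have key : Tendsto (fun ε => ∫ t : E2, ∫ z in B.fiber C.carrier t,
      stepDeriv φ ε (B.chart (t, z)) (B.chart (t, z) - xref)) (𝓝[>] 0)
      (𝓝 (∫ t : E2, (B.graphBase φ C.carrier).indicator (fun t => -B.reducedHeight h xref t) t)) := by
    refine tendsto_integral_filter_of_dominated_convergence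
      ((B.tangential '' C.carrier).indicator fun _ => 4 * |M| * |R| / c) ?_ ?_ ?_ ?_
    · filter_upwards [hsmall] with ε hε
      exact (B.integrable_integral_fiber C.isCompact (U.integrableOn_stepDeriv_radial C.isCompact
        g.continuousOn hε.1 hε.2 xref)).aestronglyMeasurable
    · filter_upwards [hsmall] with ε hε
      exact Eventually.of_forall fun t =>
        U.norm_integral_fiber_le C.isCompact hε.1 hε.2 xref hR t
    · rw [integrable_indicator_iff hcT.measurableSet]
      exact continuousOn_const.integrableOn_compact hcT
    · filter_upwards [g.ae_mem_interior null] with t ht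
      by_cases htS : t ∈ B.graphBase φ C.carrier
      · rw [indicator_of_mem htS]
        have hp := g.graphMap_mem htS
        have := U.tendsto_integral_fiber_of_mem_interior C.isCompact xref (ht htS) hp.2
        rwa [g.fderiv_radial hreg htS, mul_div_cancel_left₀ _ (g.fderiv_normal_pos hp).ne'] at this
      · rw [indicator_of_notMem htS]
        obtain ⟨r, hr, hle⟩ := (B.isCompact_fiber C.isCompact t).exists_forall_le'
          (f := fun z => |φ (B.chart (t, z))|)
          (g.continuousOn.comp (B.continuous_chart_fiber t).continuousOn fun z hz => hz).abs (a := 0)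
          fun z hz => by
            rw [abs_pos]
            exact fun h0 => htS ⟨_, ⟨hz, h0⟩, by simp⟩
        refine tendsto_const_nhds.congr' ?_
        filter_upwards [self_mem_nhdsWithin, nhdsWithin_le_nhds (Iio_mem_nhds hr)] with ε hε hεr
        refine (setIntegral_eq_zero_of_forall_eq_zero fun z hz => ?_).symm
        rw [stepDeriv_eq_zero hε]
        · rfl
        · rcases le_abs.1 (hle z hz) with h1 | h1
          · exact Or.inr ((le_of_lt hεr).trans h1)
          · exact Or.inl (by linarith)
  refine key.congr' ?_
  filter_upwards [hsmall] with ε hε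
  exact (B.setIntegral_eq_integral_fiber C.isCompact (U.integrableOn_stepDeriv_radial C.isCompact
        g.continuousOn hε.1 hε.2 xref)).symm

/-- The measure is arbitrary so that the same argument serves the volume of the polyhedron and the
area of its faces. -/
theorem tendsto_integral_smoothStep {X : Type*} [MeasurableSpace X] {μ : Measure X} {f : X → ℝ}
    {A : Set X} (hA : MeasurableSet A) (hμ : μ A ≠ ⊤) (hf : AEStronglyMeasurable f (μ.restrict A))
    (hm : MeasurableSet {x ∈ A | f x ≤ 0}) :
    Tendsto (fun ε => ∫ x in A, smoothStep (f x / ε) ∂μ) (𝓝[>] 0)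
      (𝓝 (μ.real {x ∈ A | f x ≤ 0})) := by
  have hlim : ∫ x in A, (if f x ≤ 0 then (1 : ℝ) else 0) ∂μ = μ.real {x ∈ A | f x ≤ 0} := by
    have : ∫ x in A, (if f x ≤ 0 then (1 : ℝ) else 0) ∂μ =
        ∫ x in A, ({x ∈ A | f x ≤ 0}).indicator (fun _ => (1 : ℝ)) x ∂μ := by
      refine setIntegral_congr_fun hA fun x hx => ?_
      by_cases h : f x ≤ 0 <;> simp [h, hx]
    rw [this, setIntegral_indicator hm, setIntegral_const, smul_eq_mul, mul_one,
      inter_eq_self_of_subset_right fun x hx => hx.1]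
  rw [← hlim]
  refine tendsto_integral_filter_of_dominated_convergence (fun _ => 1) ?_ ?_ ?_ ?_
  · exact Eventually.of_forall fun ε => by
      refine (continuous_smoothStep.comp_aestronglyMeasurable (hf.mul_const ε⁻¹)).congr
        (Eventually.of_forall fun x => ?_)
      simp only [div_eq_mul_inv]
  · refine Eventually.of_forall fun ε => Eventually.of_forall fun x => ?_
    rw [Real.norm_of_nonneg (smoothStep_nonneg _)]
    exact smoothStep_le_one _
  · exact integrableOn_const hμ
  · exact Eventually.of_forall fun x => tendsto_smoothStep_div (f x)

/-- Volume of the immersed part of a polyhedron, with the contribution of the patch written as an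
integral over the graph base. -/
theorem three_mul_volume_immersed {C : Polyhedron} (g : IsGraphPatch B φ h C.carrier)
    (null : MeetsFacesInNullSets C φ)
    (hreg : closure (interior (B.graphBase φ C.carrier)) = B.graphBase φ C.carrier) (xref : E3) :
    3 * volume.real (immersed φ C.carrier) =
      ∑ k, inner ℝ ((C.face k).first - xref) (C.face k).normal *
        (μHE[2] : Measure E3).real (immersed φ (C.face k).region) +
      ∫ t in B.graphBase φ C.carrier, B.reducedHeight h xref t := by
  obtain ⟨c, hc, M, η, hη, δ, hδ, hnear, hclose⟩ := g.exists_uniform C.isCompact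
  have U : UniformLevel B φ C.carrier c M η δ := ⟨hc, hη, hδ, hnear, hclose⟩
  have hu : ∀ ε, ContinuousOn (fun x => smoothStep (φ x / ε)) C.carrier := fun ε =>
    continuous_smoothStep.comp_continuousOn (g.continuousOn.div_const ε)
  have h1 : Tendsto (fun ε => ∫ x in C.carrier, smoothStep (φ x / ε)) (𝓝[>] 0)
      (𝓝 (volume.real (immersed φ C.carrier))) :=
    tendsto_integral_smoothStep C.isCompact.measurableSet C.isCompact.measure_lt_top.ne
      (g.continuousOn.aestronglyMeasurable C.isCompact.measurableSet)
      (g.measurableSet_immersed C.isCompact)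
  have h2 : ∀ k, Tendsto (fun ε => ∫ x in (C.face k).region, smoothStep (φ x / ε)
      ∂(μHE[2] : Measure E3)) (𝓝[>] 0)
      (𝓝 ((μHE[2] : Measure E3).real (immersed φ (C.face k).region))) := by
    intro k
    have hφ := g.continuousOn.mono (C.region_subset k)
    exact tendsto_integral_smoothStep (C.face k).measurableSet_region
      (C.face k).hausdorffMeasure_region_lt_top.ne
      (hφ.aestronglyMeasurable (C.face k).measurableSet_region)
      (hφ.preimage_isClosed_of_isClosed (C.face k).isCompact.isClosed
        (isClosed_Iic (a := (0 : ℝ)))).measurableSet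
  have hL := (h1.const_mul 3).add (g.tendsto_integral_stepDeriv null hreg xref)
  have hRR := tendsto_finsetSum Finset.univ fun k _ =>
    (h2 k).const_mul (inner ℝ ((C.face k).first - xref) (C.face k).normal)
  have heq : ∀ᶠ ε in 𝓝[>] (0 : ℝ), (3 * ∫ x in C.carrier, smoothStep (φ x / ε)) +
      ∫ x in C.carrier, stepDeriv φ ε x (x - xref) =
      ∑ k, inner ℝ ((C.face k).first - xref) (C.face k).normal *
        ∫ x in (C.face k).region, smoothStep (φ x / ε) ∂(μHE[2] : Measure E3) := by
    filter_upwards [self_mem_nhdsWithin, nhdsWithin_le_nhds (Iio_mem_nhds hδ)] with ε hε hεδ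
    exact C.setIntegral_radial xref (hu ε)
      (fun x hx => U.hasFDerivAt_smoothStep g.continuousOn hε hεδ hx)
      (fun v => U.integrableOn_stepDeriv C.isCompact g.continuousOn hε hεδ v)
  have := tendsto_nhds_unique hL (hRR.congr' (heq.mono fun ε h => h.symm))
  linarith

end IsGraphPatch

/-! ### The area formula on the line, with multiplicities -/

/-- The set where the derivative does not vanish splits into countably many measurable pieces on
which the function is injective. -/
theorem exists_injOn_partition {g g' : ℝ → ℝ} {O : Set ℝ} (hO : IsOpen O)
    (hg : ∀ s ∈ O, HasDerivAt g (g' s) s) (hc : ContinuousOn g' O) :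
    ∃ A : ℕ → Set ℝ, (∀ n, MeasurableSet (A n)) ∧ Pairwise (Function.onFun Disjoint A) ∧
      (∀ n, InjOn g (A n)) ∧ ⋃ n, A n = {s ∈ O | g' s ≠ 0} := by
  classical
  have hW : IsOpen {s ∈ O | g' s ≠ 0} := hc.isOpen_inter_preimage hO isOpen_ne
  -- Intervals with rational ends keep the cover countable; inadmissible ones are replaced by `∅`,
  -- and `disjointed` makes the pieces disjoint.
  set u : ℚ × ℚ → Set ℝ := fun p =>
    if InjOn g (Ioo p.1 p.2) ∧ Ioo (p.1 : ℝ) p.2 ⊆ {s ∈ O | g' s ≠ 0} then Ioo (p.1 : ℝ) p.2 else ∅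
    with hu
  have hum : ∀ p, MeasurableSet (u p) := fun p => by
    simp only [hu]; split_ifs <;> measurability
  have huinj : ∀ p, InjOn g (u p) := fun p => by
    simp only [hu]
    split_ifs with h
    · exact h.1
    · exact injOn_empty _
  have husub : ∀ p, u p ⊆ {s ∈ O | g' s ≠ 0} := fun p => by
    simp only [hu]
    split_ifs with h
    · exact h.2
    · exact empty_subset _
  have hcov : ∀ s ∈ {s ∈ O | g' s ≠ 0}, ∃ p, s ∈ u p := by
    intro s hs
    -- A `C¹` function is injective near a point of nonzero derivative, by the inverse function
    -- theorem.
    have hst : HasStrictDerivAt g (g' s) s := by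
      refine hasStrictDerivAt_of_hasDerivAt_of_continuousAt ?_
        (hc.continuousAt (hO.mem_nhds hs.1))
      filter_upwards [hO.mem_nhds hs.1] with y hy
      exact hg y hy
    have hsF := hst.hasStrictFDerivAt_equiv hs.2
    set e := hsF.toOpenPartialHomeomorph g with he
    have hnhds : e.source ∩ {s ∈ O | g' s ≠ 0} ∈ 𝓝 s :=
      inter_mem (e.open_source.mem_nhds hsF.mem_toOpenPartialHomeomorph_source) (hW.mem_nhds hs)
    obtain ⟨a, b, hab, hsub⟩ := mem_nhds_iff_exists_Ioo_subset.1 hnhds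
    obtain ⟨p, hp1, hp2⟩ := exists_rat_btwn hab.1
    obtain ⟨q, hq1, hq2⟩ := exists_rat_btwn hab.2
    have hpq : Ioo (p : ℝ) q ⊆ e.source ∩ {s ∈ O | g' s ≠ 0} :=
      (Ioo_subset_Ioo hp1.le hq2.le).trans hsub
    refine ⟨(p, q), ?_⟩
    have hinj : InjOn g (Ioo (p : ℝ) q) := by
      have := e.injOn.mono (hpq.trans inter_subset_left)
      rwa [he, hsF.toOpenPartialHomeomorph_coe] at this
    simp only [hu]
    rw [if_pos ⟨hinj, hpq.trans inter_subset_right⟩]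
    exact ⟨hp2, hq1⟩
  obtain ⟨f, hf⟩ := exists_surjective_nat (ℚ × ℚ)
  refine ⟨disjointed (u ∘ f), fun n => MeasurableSet.disjointed (fun k => hum _) n,
    disjoint_disjointed _, fun n => (huinj (f n)).mono (disjointed_le (u ∘ f) n), ?_⟩
  rw [iUnion_disjointed]
  refine Subset.antisymm (iUnion_subset fun n => husub _) fun s hs => ?_
  obtain ⟨p, hp⟩ := hcov s hs
  obtain ⟨n, rfl⟩ := hf p
  exact mem_iUnion.2 ⟨n, hp⟩

/-- The area formula for a finite family of functions: the sum over the fibres has the integral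
`∑ ∫ F |g'|`. -/
theorem integral_sum_fiber {ι : Type*} [Fintype ι] {O : Set ℝ} (hO : IsOpen O)
    {g g' F : ι → ℝ → ℝ} (hg : ∀ a, ∀ s ∈ O, HasDerivAt (g a) (g' a s) s)
    (hc : ∀ a, ContinuousOn (g' a) O) (hF : ∀ a, IntegrableOn (fun s => |g' a s| * F a s) O)
    {N : ℝ → ℝ}
    (hN : ∀ᵐ y, ∃ T : Finset ((_ : ι) × ℝ), (∀ p, p ∈ T ↔ p.2 ∈ O ∧ g p.1 p.2 = y) ∧
      (∀ p ∈ T, g' p.1 p.2 ≠ 0) ∧ N y = ∑ p ∈ T, F p.1 p.2) :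
    ∫ y, N y = ∑ a, ∫ s in O, |g' a s| * F a s := by
  classical
  choose A hAm hAd hAi hAu using fun a => exists_injOn_partition hO (hg a) (hc a)
  have hAO : ∀ a n, A a n ⊆ O := fun a n s hs =>
    ((hAu a).le (mem_iUnion.2 ⟨n, hs⟩)).1
  have hAg : ∀ a n, ∀ s ∈ A a n, HasDerivWithinAt (g a) (g' a s) (A a n) s := fun a n s hs =>
    (hg a s (hAO a n hs)).hasDerivWithinAt
  set inv : ι × ℕ → ℝ → ℝ := fun p => Function.invFunOn (g p.1) (A p.1 p.2) with hinv
  have hinv_eq : ∀ a n, ∀ s ∈ A a n, inv (a, n) (g a s) = s := fun a n s hs =>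
    (hAi a n).leftInvOn_invFunOn hs
  -- The contribution of one injective piece to the fibre sum, to which the ordinary change of
  -- variables applies.
  set G : ι × ℕ → ℝ → ℝ := fun p =>
    (g p.1 '' A p.1 p.2).indicator fun y => F p.1 (inv p y) with hG
  have hmeas : ∀ p : ι × ℕ, MeasurableSet (g p.1 '' A p.1 p.2) := fun p =>
    (hAm p.1 p.2).image_of_continuousOn_injOn
      (fun s hs => (hAg p.1 p.2 s hs).continuousWithinAt) (hAi p.1 p.2)
  have hint : ∀ p : ι × ℕ, IntegrableOn (fun s => |g' p.1 s| * F p.1 s) (A p.1 p.2) := fun p =>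
    (hF p.1).mono_set (hAO p.1 p.2)
  have hGint : ∀ p, Integrable (G p) := by
    intro p
    rw [hG, integrable_indicator_iff (hmeas p), integrableOn_image_iff_integrableOn_abs_deriv_smul
      (hAm p.1 p.2) (hAg p.1 p.2) (hAi p.1 p.2)]
    refine (hint p).congr_fun (fun s hs => ?_) (hAm p.1 p.2)
    simp only [smul_eq_mul]
    rw [hinv_eq p.1 p.2 s hs]
  have hGI : ∀ p, ∫ y, G p y = ∫ s in A p.1 p.2, |g' p.1 s| * F p.1 s := by
    intro p
    rw [hG, integral_indicator (hmeas p), integral_image_eq_integral_abs_deriv_smul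
      (hAm p.1 p.2) (hAg p.1 p.2) (hAi p.1 p.2)]
    refine setIntegral_congr_fun (hAm p.1 p.2) fun s hs => ?_
    simp only [smul_eq_mul]
    rw [hinv_eq p.1 p.2 s hs]
  have hGN : ∀ p, ∫ y, ‖G p y‖ = ∫ s in A p.1 p.2, ‖|g' p.1 s| * F p.1 s‖ := by
    intro p
    have : ∀ y, ‖G p y‖ = (g p.1 '' A p.1 p.2).indicator (fun y => ‖F p.1 (inv p y)‖) y := fun y =>
      norm_indicator_eq_indicator_norm _ _
    simp only [this]
    rw [integral_indicator (hmeas p), integral_image_eq_integral_abs_deriv_smul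
      (hAm p.1 p.2) (hAg p.1 p.2) (hAi p.1 p.2)]
    refine setIntegral_congr_fun (hAm p.1 p.2) fun s hs => ?_
    simp only [smul_eq_mul, norm_mul, Real.norm_eq_abs, abs_abs]
    rw [hinv_eq p.1 p.2 s hs]
  have hW : ∀ a, MeasurableSet {s ∈ O | g' a s ≠ 0} := fun a =>
    ((hc a).isOpen_inter_preimage hO isOpen_ne).measurableSet
  -- Points with `g' = 0` belong to no piece, but the factor `|g'|` removes them from the integral
  -- as well.
  have hsum : ∀ a, HasSum (fun n => ∫ s in A a n, |g' a s| * F a s)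
      (∫ s in O, |g' a s| * F a s) := by
    intro a
    have := hasSum_integral_iUnion (hAm a) (hAd a) ((hF a).mono_set (iUnion_subset (hAO a)))
    rwa [hAu, ← setIntegral_eq_of_subset_of_forall_sdiff_eq_zero hO.measurableSet
      (fun s hs => hs.1) (fun s hs => by
        have : g' a s = 0 := by
          by_contra h
          exact hs.2 ⟨hs.1, h⟩
        simp [this])] at this
  have hsummable : Summable fun p => ∫ y, ‖G p y‖ := by
    simp only [hGN]
    rw [summable_prod_of_nonneg fun p => integral_nonneg fun s => norm_nonneg _]
    refine ⟨fun a => ?_, Summable.of_finite⟩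
    exact (hasSum_integral_iUnion (hAm a) (hAd a)
      (IntegrableOn.mono_set (hF a).norm (iUnion_subset (hAO a)))).summable
  have key := hasSum_integral_of_summable_integral_norm hGint hsummable
  -- Over a generic `y` all fibre points have nonzero derivative, so each lies in exactly one piece,
  -- and the series is a finite sum.
  have hNG : ∀ᵐ y, ∑' p, G p y = N y := by
    filter_upwards [hN] with y hy
    obtain ⟨T, hT, hT0, hTN⟩ := hy
    have hidx : ∀ p ∈ T, ∃ n, p.2 ∈ A p.1 n := fun p hp => by
      have : p.2 ∈ {s ∈ O | g' p.1 s ≠ 0} := ⟨((hT p).1 hp).1, hT0 p hp⟩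
      rw [← hAu] at this
      exact mem_iUnion.1 this
    choose! idx hidx using hidx
    have hval : ∀ p ∈ T, G (p.1, idx p) y = F p.1 p.2 := by
      intro p hp
      have hgy := ((hT p).1 hp).2
      simp only [hG]
      rw [indicator_of_mem (show y ∈ g p.1 '' A p.1 (idx p) from ⟨p.2, hidx p hp, hgy⟩), ← hgy, hinv_eq p.1 (idx p) p.2 (hidx p hp)]
    have hinj : Set.InjOn (fun p : (_ : ι) × ℝ => (p.1, idx p)) T := by
      rintro ⟨a, s⟩ hp ⟨a', s'⟩ hp' h
      simp only [Prod.mk.injEq] at h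
      obtain ⟨rfl, h⟩ := h
      have h1 := hidx _ hp
      have h2 := hidx _ hp'
      rw [← h] at h2
      have := hAi a _ h1 h2 (((hT _).1 hp).2.trans ((hT _).1 hp').2.symm)
      simp only at this
      rw [this]
    rw [hTN, tsum_eq_sum (s := T.image fun p => (p.1, idx p)), Finset.sum_image hinj]
    · exact Finset.sum_congr rfl hval
    · rintro ⟨a, n⟩ hp
      simp only [hG]
      refine indicator_of_notMem ?_ _
      rintro ⟨s, hs, hsy⟩
      refine hp (Finset.mem_image.2 ?_)
      have hmem : (⟨a, s⟩ : (_ : ι) × ℝ) ∈ T := (hT _).2 ⟨hAO a n hs, hsy⟩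
      refine ⟨⟨a, s⟩, hmem, ?_⟩
      simp only [Prod.mk.injEq, true_and]
      by_contra hne
      exact (hAd a hne).le_bot ⟨hidx _ hmem, hs⟩
  rw [← integral_congr_ae hNG, ← key.tsum_eq, key.summable.tsum_prod]
  rw [tsum_fintype]
  refine Finset.sum_congr rfl fun a _ => ?_
  simp only [hGI]
  exact (hsum a).tsum_eq

/-! ### Piecewise `C¹` boundaries near a point of an arc -/

theorem exists_equiv_of_orthogonal {v n : E2} (hv : v ≠ 0) (hn : ‖n‖ = 1)
    (hnv : inner ℝ n v = (0 : ℝ)) :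
    ∃ L : (ℝ × ℝ) ≃L[ℝ] E2, ∀ p, L p = p.1 • v + p.2 • n := by
  set l : (ℝ × ℝ) →ₗ[ℝ] E2 := (LinearMap.fst ℝ ℝ ℝ).smulRight v +
    (LinearMap.snd ℝ ℝ ℝ).smulRight n with hl
  have hlp : ∀ p, l p = p.1 • v + p.2 • n := fun p => rfl
  have hinj : Function.Injective l := by
    rw [← LinearMap.ker_eq_bot, LinearMap.ker_eq_bot']
    intro p hp
    rw [hlp] at hp
    have h2 : p.2 = 0 := by
      have := congrArg (fun w => (inner ℝ n w : ℝ)) hp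
      simpa [inner_add_right, inner_smul_right, hnv, real_inner_self_eq_norm_sq, hn] using this
    rw [h2, zero_smul, add_zero, smul_eq_zero] at hp
    exact Prod.ext (hp.resolve_right hv) h2
  refine ⟨(LinearEquiv.ofInjectiveOfFinrankEq l hinj (by simp)).toContinuousLinearEquiv,
    fun p => rfl⟩

theorem eventually_pos_of_hasDerivAt {r : ℝ → ℝ} {d : ℝ} (h : HasDerivAt r d 0) (h0 : r 0 = 0)
    (hd : 0 < d) : ∀ᶠ x in 𝓝[>] (0 : ℝ), 0 < r x := by
  have h1 := (hasDerivAt_iff_tendsto_slope.1 h).eventually (lt_mem_nhds hd)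
  have h2 : ∀ᶠ x in 𝓝[>] (0 : ℝ), 0 < slope r 0 x :=
    h1.filter_mono (nhdsWithin_mono _ fun x hx => ne_of_gt hx)
  filter_upwards [h2, self_mem_nhdsWithin] with x hx hx0
  rw [slope_def_field, h0, sub_zero, sub_zero] at hx
  exact (div_pos_iff_of_pos_right hx0).1 hx

namespace PiecewiseBoundary

theorem isClosed {S : Set E2} {N : ℕ} {piece : Fin N → Set E2} (D : PiecewiseBoundary S piece) :
    IsClosed S := by
  rw [← D.regular]
  exact isClosed_closure

variable {S : Set E2} {N : ℕ} {piece : Fin N → Set E2} (D : PiecewiseBoundary S piece)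

theorem contDiffAt_arc (k : Fin N) (m : Fin (D.count k)) {s : ℝ} (hs : s ∈ Ioo (0 : ℝ) 1) :
    ContDiffAt ℝ 1 (D.arc k m) s :=
  (D.contDiffOn k m).contDiffAt (Icc_mem_nhds hs.1 hs.2)

theorem hasStrictDerivAt_arc (k : Fin N) (m : Fin (D.count k)) {s : ℝ} (hs : s ∈ Ioo (0 : ℝ) 1) :
    HasStrictDerivAt (D.arc k m) (deriv (D.arc k m) s) s :=
  (D.contDiffAt_arc k m hs).hasStrictDerivAt (by norm_num)

theorem deriv_arc_ne_zero (k : Fin N) (m : Fin (D.count k)) {s : ℝ} (hs : s ∈ Ioo (0 : ℝ) 1) :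
    deriv (D.arc k m) s ≠ 0 := by
  rw [← derivWithin_of_mem_nhds (Icc_mem_nhds hs.1 hs.2)]
  exact D.deriv_ne_zero k m s (Ioo_subset_Icc_self hs)

theorem continuousOn_deriv_arc (k : Fin N) (m : Fin (D.count k)) :
    ContinuousOn (deriv (D.arc k m)) (Ioo 0 1) := by
  refine ((D.contDiffOn k m).mono Ioo_subset_Icc_self).continuousOn_deriv_of_isOpen isOpen_Ioo ?_
  norm_num

theorem exists_norm_deriv_arc_le (k : Fin N) (m : Fin (D.count k)) :
    ∃ K, ∀ s ∈ Ioo (0 : ℝ) 1, ‖deriv (D.arc k m) s‖ ≤ K := by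
  obtain ⟨K, hK⟩ := isCompact_Icc.exists_bound_of_continuousOn
    ((D.contDiffOn k m).continuousOn_derivWithin (uniqueDiffOn_Icc zero_lt_one) (by norm_num))
  refine ⟨K, fun s hs => ?_⟩
  rw [← derivWithin_of_mem_nhds (Icc_mem_nhds hs.1 hs.2)]
  exact hK s (Ioo_subset_Icc_self hs)

theorem arc_mem_frontier (k : Fin N) (m : Fin (D.count k)) {s : ℝ} (hs : s ∈ Icc (0 : ℝ) 1) :
    D.arc k m s ∈ frontier S := by
  rw [D.cover]
  exact mem_iUnion.2 ⟨k, mem_iUnion.2 ⟨m, s, hs, rfl⟩⟩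

theorem arc_mem_set (k : Fin N) (m : Fin (D.count k)) {s : ℝ} (hs : s ∈ Icc (0 : ℝ) 1) :
    D.arc k m s ∈ S :=
  D.isClosed.frontier_subset (D.arc_mem_frontier k m hs)

/-- Near an inner point of an arc, all points of the frontier lie on the arc. -/
theorem eventually_mem_frontier (k : Fin N) (m : Fin (D.count k)) {s₀ : ℝ}
    (hs₀ : s₀ ∈ Ioo (0 : ℝ) 1) {δ : ℝ} (hδ : 0 < δ) :
    ∀ᶠ x in 𝓝 (D.arc k m s₀), x ∈ frontier S → ∃ s ∈ Ioo (s₀ - δ) (s₀ + δ), D.arc k m s = x := by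
  classical
  -- `Z` is the union of all arcs without a parameter window around `s₀`. It is compact and, the
  -- arcs being simple, misses the point.
  set Z : Set E2 := ⋃ a : (k : Fin N) × Fin (D.count k),
    D.arc a.1 a.2 '' (Icc 0 1 \ (if a = ⟨k, m⟩ then Ioo (s₀ - δ) (s₀ + δ) else ∅)) with hZ
  have hZc : IsCompact Z := by
    refine isCompact_iUnion fun a => IsCompact.image_of_continuousOn ?_
      ((D.contDiffOn a.1 a.2).continuousOn.mono sdiff_subset)
    exact isCompact_Icc.diff (by split_ifs; exacts [isOpen_Ioo, isOpen_empty])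
  have hp : D.arc k m s₀ ∉ Z := by
    intro h
    obtain ⟨a, s, hs, hsa⟩ := mem_iUnion.1 h
    obtain ⟨h1, h2⟩ := D.simple k m a.1 a.2 s₀ hs₀ s hs.1 hsa.symm
    refine hs.2 ?_
    rw [if_pos h1.symm, ← h2]
    exact ⟨by linarith, by linarith⟩
  filter_upwards [hZc.isClosed.isOpen_compl.mem_nhds hp] with x hx hxf
  rw [D.cover] at hxf
  obtain ⟨k', hk'⟩ := mem_iUnion.1 hxf
  obtain ⟨m', s, hs, hsx⟩ := mem_iUnion.1 hk'
  by_contra hn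
  refine hx (mem_iUnion.2 ⟨⟨k', m'⟩, s, ⟨hs, ?_⟩, hsx⟩)
  split_ifs with h
  · cases h
    exact fun hsI => hn ⟨s, hsI, hsx⟩
  · exact notMem_empty s

/-- Coordinates that straighten the boundary near an inner point of an arc. -/
theorem exists_straightening (k : Fin N) (m : Fin (D.count k)) {s₀ : ℝ}
    (hs₀ : s₀ ∈ Ioo (0 : ℝ) 1) :
    ∃ e : OpenPartialHomeomorph (ℝ × ℝ) E2,
      (∀ p, e p = D.arc k m p.1 + p.2 • D.normal (D.arc k m s₀)) ∧ (s₀, (0 : ℝ)) ∈ e.source ∧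
      (∃ L : (ℝ × ℝ) ≃L[ℝ] E2,
        (∀ p, L p = p.1 • deriv (D.arc k m) s₀ + p.2 • D.normal (D.arc k m s₀)) ∧
        HasFDerivAt e.symm (L.symm : E2 →L[ℝ] ℝ × ℝ) (D.arc k m s₀)) ∧
      ∀ᶠ p in 𝓝 (s₀, (0 : ℝ)), (0 < p.2 → e p ∉ S) ∧ (p.2 < 0 → e p ∈ S) := by
  set n := D.normal (D.arc k m s₀) with hn
  obtain ⟨L, hL⟩ := exists_equiv_of_orthogonal (D.deriv_arc_ne_zero k m hs₀)
    (D.norm_normal k m s₀ hs₀) (D.normal_orthogonal k m s₀ hs₀)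
  -- The inverse function theorem is applied to arc parameter and offset along the fixed normal at
  -- `s₀`; tangent and normal are independent, so the derivative is invertible.
  set Θ : ℝ × ℝ → E2 := fun p => D.arc k m p.1 + p.2 • n with hΘ
  have hst : HasStrictFDerivAt Θ (L : (ℝ × ℝ) →L[ℝ] E2) (s₀, 0) := by
    have h1 := (D.hasStrictDerivAt_arc k m hs₀).hasStrictFDerivAt.comp (s₀, (0 : ℝ))
      (hasStrictFDerivAt_fst (𝕜 := ℝ) (E := ℝ) (F := ℝ))
    have h2 := (hasStrictFDerivAt_snd (𝕜 := ℝ) (E := ℝ) (F := ℝ) (p := (s₀, (0 : ℝ)))).smul_const n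
    refine (h1.add h2).congr_fderiv ?_
    ext p <;> simp [hL, hn]
  set e := hst.toOpenPartialHomeomorph Θ with he
  have hsrc : (s₀, (0 : ℝ)) ∈ e.source := hst.mem_toOpenPartialHomeomorph_source
  have hec : ∀ p, e p = Θ p := fun p => rfl
  have he0 : e (s₀, 0) = D.arc k m s₀ := by simp [hec, hΘ]
  have htgt : D.arc k m s₀ ∈ e.target := he0 ▸ e.map_source hsrc
  have hsymm : e.symm (D.arc k m s₀) = (s₀, 0) := by rw [← he0, e.left_inv hsrc]
  refine ⟨e, hec, hsrc, ⟨L, hL, e.hasFDerivAt_symm htgt ?_⟩, ?_⟩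
  · rw [hsymm]
    exact hst.hasFDerivAt
  have hnear : ∀ᶠ p in 𝓝 (s₀, (0 : ℝ)), p ∈ e.source ∧ p.1 ∈ Ioo (0 : ℝ) 1 := by
    filter_upwards [e.open_source.mem_nhds hsrc,
      continuous_fst.continuousAt (isOpen_Ioo.mem_nhds hs₀)] with p h1 h2
    exact ⟨h1, h2⟩
  obtain ⟨r₀, hr₀, hball₀⟩ := Metric.eventually_nhds_iff_ball.1 hnear
  have hfr : ∀ᶠ p in 𝓝 (s₀, (0 : ℝ)), e p ∈ frontier S →
      ∃ s ∈ Ioo (s₀ - r₀) (s₀ + r₀), D.arc k m s = e p := by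
    have hc := (e.continuousAt hsrc).tendsto
    rw [he0] at hc
    exact hc.eventually (D.eventually_mem_frontier k m hs₀ hr₀)
  obtain ⟨r₁, hr₁, hball₁⟩ := Metric.eventually_nhds_iff_ball.1 hfr
  set r := min r₀ r₁ with hr
  have hr0 : 0 < r := lt_min hr₀ hr₁
  have hsub₀ : Metric.ball (s₀, (0 : ℝ)) r ⊆ Metric.ball (s₀, (0 : ℝ)) r₀ :=
    Metric.ball_subset_ball (min_le_left _ _)
  have hsub₁ : Metric.ball (s₀, (0 : ℝ)) r ⊆ Metric.ball (s₀, (0 : ℝ)) r₁ :=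
    Metric.ball_subset_ball (min_le_right _ _)
  -- A frontier point in the box is some `arc k m s = e (s, 0)` with `|s - s₀| < r₀`. Both
  -- parameters lie in the domain of injectivity, so the offset is 0.
  have hzero : ∀ p ∈ Metric.ball (s₀, (0 : ℝ)) r, e p ∈ frontier S → p.2 = 0 := by
    intro p hp hpf
    obtain ⟨s, hs, hsp⟩ := hball₁ p (hsub₁ hp) hpf
    have hs' : (s, (0 : ℝ)) ∈ Metric.ball (s₀, (0 : ℝ)) r₀ := by
      rw [← ball_prod_same]
      refine ⟨?_, Metric.mem_ball_self hr₀⟩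
      rw [Real.ball_eq_Ioo]
      exact hs
    have hes : e (s, 0) = e p := by
      rw [← hsp]; simp [hec, hΘ]
    exact (congrArg Prod.snd (e.injOn (hball₀ _ hs').1 (hball₀ _ (hsub₀ hp)).1 hes)).symm
  have hT : ∀ σ : ℝ, IsPreconnected (e '' (Metric.ball (s₀, (0 : ℝ)) r ∩ {p | 0 < σ * p.2})) := by
    intro σ
    refine IsPreconnected.image ?_ _ (e.continuousOn.mono fun p hp => (hball₀ p (hsub₀ hp.1)).1)
    refine ((convex_ball _ _).inter ?_).isPreconnected
    have : Convex ℝ ((σ • LinearMap.snd ℝ ℝ ℝ) ⁻¹' Ioi 0) := (convex_Ioi 0).linear_preimage _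
    exact this
  have hd : ∀ σ : ℝ, Disjoint (e '' (Metric.ball (s₀, (0 : ℝ)) r ∩ {p | 0 < σ * p.2}))
      (frontier S) := by
    intro σ
    rw [Set.disjoint_left]
    rintro _ ⟨p, ⟨hp, hp2⟩, rfl⟩ hf
    simp [hzero p hp hf] at hp2
  have hU : e '' Metric.ball (s₀, (0 : ℝ)) r ∈ 𝓝 (D.arc k m s₀) := by
    rw [← he0]
    exact e.image_mem_nhds hsrc (Metric.ball_mem_nhds _ hr0)
  have key := disjoint_and_subset_interior_of_sides D.regular
    (D.arc_mem_set k m (Ioo_subset_Icc_self hs₀)) hU ?_ (hT 1) (hT (-1)) (hd 1) (hd (-1)) ?_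
  · filter_upwards [Metric.ball_mem_nhds (s₀, (0 : ℝ)) hr0] with p hp
    refine ⟨fun h hS => ?_, fun h => ?_⟩
    · exact key.1.le_bot ⟨⟨p, ⟨hp, by simpa using h⟩, rfl⟩, hS⟩
    · exact interior_subset (key.2 ⟨p, ⟨hp, by simpa using h⟩, rfl⟩)
  · rintro _ ⟨p, hp, rfl⟩
    rcases lt_trichotomy p.2 0 with h | h | h
    · exact Or.inl (Or.inr ⟨p, ⟨hp, by simpa using h⟩, rfl⟩)
    · refine Or.inr ?_
      have : e p = D.arc k m p.1 := by simp [hec, hΘ, h]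
      rw [this]
      exact D.arc_mem_frontier k m (Ioo_subset_Icc_self (hball₀ p (hsub₀ hp)).2)
    · exact Or.inl (Or.inl ⟨p, ⟨hp, by simpa using h⟩, rfl⟩)
  · obtain ⟨ε, ⟨h1, h2⟩, h3⟩ := (((D.outward k m s₀ hs₀).and
      (nhdsWithin_le_nhds (Iio_mem_nhds hr0))).and self_mem_nhdsWithin).exists
    have h3 : 0 < ε := h3
    refine ⟨e (s₀, ε), ⟨(s₀, ε), ⟨?_, by simpa using h3⟩, rfl⟩, h1⟩
    rw [← ball_prod_same]
    refine ⟨Metric.mem_ball_self hr0, ?_⟩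
    rw [Metric.mem_ball, Real.dist_eq, sub_zero, abs_of_pos h3]
    exact h2

/-- A line that crosses the boundary transversally in an inner point of an arc enters or leaves the
domain there. -/
theorem eventually_line (k : Fin N) (m : Fin (D.count k)) {s : ℝ} (hs : s ∈ Ioo (0 : ℝ) 1) (v : E2)
    {σ : ℝ} (hσ : 0 < σ * inner ℝ (D.normal (D.arc k m s)) v) :
    ∀ᶠ ε in 𝓝[>] (0 : ℝ), D.arc k m s + (σ * ε) • v ∉ S ∧ D.arc k m s - (σ * ε) • v ∈ S := by
  obtain ⟨e, he, hsrc, ⟨L, hL, hsymm⟩, hbox⟩ := D.exists_straightening k m hs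
  set n := D.normal (D.arc k m s) with hn
  set p := D.arc k m s with hp
  have he0 : e (s, 0) = p := by simp [he, hp]
  have htgt : p ∈ e.target := he0 ▸ e.map_source hsrc
  have hes : e.symm p = (s, 0) := by rw [← he0, e.left_inv hsrc]
  -- The offset coordinate changes at the rate `⟨n, v⟩` along `v`, hence grows strictly in the
  -- direction `σ v`.
  have hLn : (L.symm v).2 = inner ℝ n v := by
    have h := hL (L.symm v)
    rw [L.apply_symm_apply] at h
    conv_rhs => rw [h]
    rw [inner_add_right, inner_smul_right, inner_smul_right, D.normal_orthogonal k m s hs,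
      real_inner_self_eq_norm_sq, D.norm_normal k m s hs]
    ring
  have main : ∀ τ : ℝ, HasDerivAt (fun ε : ℝ => (e.symm (p + (τ * ε) • v)).2)
      (τ * inner ℝ n v) 0 ∧ ∀ᶠ ε in 𝓝 (0 : ℝ), p + (τ * ε) • v ∈ e.target ∧
        ((0 < (e.symm (p + (τ * ε) • v)).2 → p + (τ * ε) • v ∉ S) ∧
          ((e.symm (p + (τ * ε) • v)).2 < 0 → p + (τ * ε) • v ∈ S)) := by
    intro τ
    have hl : HasDerivAt (fun ε : ℝ => p + (τ * ε) • v) (τ • v) 0 := by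
      have := (((hasDerivAt_id (0 : ℝ)).const_mul τ).smul_const v).const_add p
      simpa using this
    have hl0 : p + (τ * 0) • v = p := by simp
    refine ⟨?_, ?_⟩
    · have h1 := (hsymm.snd).comp_hasDerivAt_of_eq (0 : ℝ) hl hl0.symm
      refine h1.congr_deriv ?_
      simp [hLn]
    · have hc : Tendsto (fun ε : ℝ => p + (τ * ε) • v) (𝓝 0) (𝓝 p) := by
        have := hl.continuousAt.tendsto
        rwa [hl0] at this
      have hc2 : Tendsto (fun ε : ℝ => e.symm (p + (τ * ε) • v)) (𝓝 0) (𝓝 (s, 0)) := by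
        have := (e.symm.continuousAt htgt).tendsto
        rw [hes] at this
        exact this.comp hc
      filter_upwards [hc (e.open_target.mem_nhds htgt), hc2.eventually hbox] with ε h1 h2
      refine ⟨h1, ?_⟩
      have h3 : e (e.symm (p + (τ * ε) • v)) = p + (τ * ε) • v := e.right_inv h1
      simpa only [h3] using h2
  have hz : ∀ τ : ℝ, (e.symm (p + (τ * 0) • v)).2 = 0 := fun τ => by simp [hes]
  have h1 := eventually_pos_of_hasDerivAt (main σ).1 (hz σ) hσ
  have h2 := eventually_pos_of_hasDerivAt (main (-σ)).1.neg (by simp [hes]) (by linarith)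
  filter_upwards [h1, h2, nhdsWithin_le_nhds (main σ).2, nhdsWithin_le_nhds (main (-σ)).2]
    with ε h1 h2 h3 h4
  refine ⟨h3.2.1 h1, ?_⟩
  have := h4.2.2 (by simpa using h2)
  rwa [neg_mul, neg_smul, ← sub_eq_add_neg] at this

/-- The unit normal of an arc that is obtained by rotation of the tangent. -/
def rotatedTangent (k : Fin N) (m : Fin (D.count k)) (s : ℝ) : E2 :=
  ‖deriv (D.arc k m) s‖⁻¹ • !₂[-(deriv (D.arc k m) s) 1, (deriv (D.arc k m) s) 0]

theorem normal_eq_smul_rotatedTangent (k : Fin N) (m : Fin (D.count k)) {s : ℝ}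
    (hs : s ∈ Ioo (0 : ℝ) 1) :
    D.normal (D.arc k m s) =
      (inner ℝ (D.normal (D.arc k m s)) (D.rotatedTangent k m s) : ℝ) • D.rotatedTangent k m s := by
  have h1 := D.normal_orthogonal k m s hs
  have h2 := norm_pos_iff.2 (D.deriv_arc_ne_zero k m hs)
  set n := D.normal (D.arc k m s)
  have h3 := EuclideanSpace.real_norm_sq_eq (deriv (D.arc k m) s)
  rw [Fin.sum_univ_two] at h3
  rw [PiLp.inner_apply, Fin.sum_univ_two] at h1
  unfold rotatedTangent
  set w := deriv (D.arc k m) s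
  simp only [RCLike.inner_apply, conj_trivial] at h1
  have h4 : ‖w‖ ≠ 0 := h2.ne'
  ext i
  rw [PiLp.inner_apply, Fin.sum_univ_two]
  fin_cases i
  · simp
    field_simp
    rw [h3]
    linear_combination w 0 * h1
  · simp
    field_simp
    rw [h3]
    linear_combination w 1 * h1

theorem norm_rotatedTangent (k : Fin N) (m : Fin (D.count k)) {s : ℝ} (hs : s ∈ Ioo (0 : ℝ) 1) :
    ‖D.rotatedTangent k m s‖ = 1 := by
  have h2 := norm_pos_iff.2 (D.deriv_arc_ne_zero k m hs)
  have h3 : ‖(!₂[-(deriv (D.arc k m) s) 1, (deriv (D.arc k m) s) 0] : E2)‖ =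
      ‖deriv (D.arc k m) s‖ := by
    rw [← sq_eq_sq₀ (norm_nonneg _) (norm_nonneg _), EuclideanSpace.real_norm_sq_eq,
      EuclideanSpace.real_norm_sq_eq, Fin.sum_univ_two, Fin.sum_univ_two]
    simp
    ring
  rw [rotatedTangent, norm_smul, norm_inv, norm_norm, h3, inv_mul_cancel₀ h2.ne']

theorem continuousOn_rotatedTangent (k : Fin N) (m : Fin (D.count k)) :
    ContinuousOn (D.rotatedTangent k m) (Ioo 0 1) := by
  have h := D.continuousOn_deriv_arc k m
  refine ContinuousOn.smul (h.norm.inv₀ fun s hs =>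
    norm_ne_zero_iff.2 (D.deriv_arc_ne_zero k m hs)) ?_
  refine (PiLp.continuous_toLp 2 _).comp_continuousOn (continuousOn_pi.2 fun i => ?_)
  fin_cases i <;> simp <;> fun_prop

/-- The outer unit normal is continuous along the arcs. -/
theorem continuousOn_normal (k : Fin N) (m : Fin (D.count k)) :
    ContinuousOn (fun s => D.normal (D.arc k m s)) (Ioo 0 1) := by
  intro s₀ hs₀
  -- The normal is `σ s = ±1` times the continuous rotated tangent, so it suffices that `σ` is
  -- locally constant.
  set σ : ℝ → ℝ := fun s => inner ℝ (D.normal (D.arc k m s)) (D.rotatedTangent k m s) with hσ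
  have hσ1 : ∀ s ∈ Ioo (0 : ℝ) 1, σ s * σ s = 1 := by
    intro s hs
    have h1 := congrArg norm (D.normal_eq_smul_rotatedTangent k m hs)
    rw [norm_smul, D.norm_rotatedTangent k m hs, D.norm_normal k m s hs, mul_one,
      Real.norm_eq_abs] at h1
    rw [← abs_mul_abs_self, hσ]
    simp only
    rw [← h1, mul_one]
  have hinner : ∀ s ∈ Ioo (0 : ℝ) 1, inner ℝ (D.normal (D.arc k m s)) (D.normal (D.arc k m s₀)) =
      σ s * σ s₀ * (inner ℝ (D.rotatedTangent k m s) (D.rotatedTangent k m s₀) : ℝ) := by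
    intro s hs
    rw [D.normal_eq_smul_rotatedTangent k m hs, D.normal_eq_smul_rotatedTangent k m hs₀,
      inner_smul_left, inner_smul_right]
    simp only [hσ, conj_trivial]
    ring
  have hpos : ∀ᶠ s in 𝓝[Ioo 0 1] s₀,
      (0 : ℝ) < inner ℝ (D.rotatedTangent k m s) (D.rotatedTangent k m s₀) := by
    have h := ((D.continuousOn_rotatedTangent k m) s₀ hs₀).inner (𝕜 := ℝ)
      (continuousWithinAt_const (b := D.rotatedTangent k m s₀))
    refine h.eventually (lt_mem_nhds ?_)
    simp only
    rw [real_inner_self_eq_norm_sq, D.norm_rotatedTangent k m hs₀]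
    norm_num
  obtain ⟨e, he, -, -, hbox⟩ := D.exists_straightening k m hs₀
  rw [nhds_prod_eq] at hbox
  have hside := hbox.curry
  have hconst : ∀ᶠ s in 𝓝[Ioo 0 1] s₀, σ s = σ s₀ := by
    filter_upwards [hpos, nhdsWithin_le_nhds hside, self_mem_nhdsWithin] with s h1 h2 hs
    -- If the normal flipped, a small step from `arc s` along the normal at `s₀` would enter `S`,
    -- whereas in the straightened box at `s₀` it leads outside.
    have hnn : ¬ (inner ℝ (D.normal (D.arc k m s)) (D.normal (D.arc k m s₀)) < (0 : ℝ)) := by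
      intro hneg
      obtain ⟨ε, ⟨h3, h4⟩, h5⟩ := (((D.eventually_line k m hs (D.normal (D.arc k m s₀)) (σ := -1)
        (by linarith)).and (nhdsWithin_le_nhds h2)).and self_mem_nhdsWithin).exists
      refine h4.1 h5 ?_
      rw [he]
      simpa using h3.2
    rw [hinner s hs, not_lt] at hnn
    have h3 : 0 ≤ σ s * σ s₀ := nonneg_of_mul_nonneg_left hnn h1
    have h4 := hσ1 s hs
    have h5 := hσ1 s₀ hs₀
    rcases mul_self_eq_one_iff.1 h4 with h | h <;> rcases mul_self_eq_one_iff.1 h5 with h' | h' <;>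
      rw [h, h'] at h3 ⊢ <;> norm_num at h3
  have hcont : ContinuousWithinAt (fun s => σ s₀ • D.rotatedTangent k m s) (Ioo 0 1) s₀ :=
    ((D.continuousOn_rotatedTangent k m) s₀ hs₀).const_smul (σ s₀)
  refine hcont.congr_of_eventuallyEq ?_ (D.normal_eq_smul_rotatedTangent k m hs₀)
  filter_upwards [hconst, self_mem_nhdsWithin] with s h1 hs
  rw [← h1]
  exact D.normal_eq_smul_rotatedTangent k m hs

end PiecewiseBoundary

/-! ### Coordinate lines in the plane -/

/-- The point with `j`-th coordinate `p.1` and `i`-th coordinate `p.2`. -/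
def planePoint (i j : Fin 2) (p : ℝ × ℝ) : E2 :=
  EuclideanSpace.single j p.1 + EuclideanSpace.single i p.2

theorem planePoint_apply_left {i j : Fin 2} (hij : i ≠ j) (p : ℝ × ℝ) :
    planePoint i j p i = p.2 := by
  simp [planePoint, hij]

theorem planePoint_apply_right {i j : Fin 2} (hij : i ≠ j) (p : ℝ × ℝ) :
    planePoint i j p j = p.1 := by
  simp [planePoint, hij.symm]

theorem sum_eq_add_of_ne {i j : Fin 2} (hij : i ≠ j) (f : Fin 2 → ℝ) :
    ∑ l, f l = f i + f j := by
  rw [Fin.sum_univ_two]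
  fin_cases i <;> fin_cases j <;> simp_all [add_comm]

theorem planePoint_eq {i j : Fin 2} (hij : i ≠ j) (x : E2) : planePoint i j (x j, x i) = x := by
  ext l
  have : l = i ∨ l = j := by
    fin_cases i <;> fin_cases j <;> fin_cases l <;> simp_all
  rcases this with rfl | rfl
  · exact planePoint_apply_left hij _
  · exact planePoint_apply_right hij _

theorem planePoint_add (i j : Fin 2) (y z d : ℝ) :
    planePoint i j (y, z + d) = planePoint i j (y, z) + d • EuclideanSpace.single i 1 := by
  ext l
  simp [planePoint]
  split_ifs <;> ring

theorem continuous_planePoint (i j : Fin 2) : Continuous (planePoint i j) := by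
  have : planePoint i j = fun p : ℝ × ℝ =>
      p.1 • (EuclideanSpace.single j 1 : E2) + p.2 • EuclideanSpace.single i 1 := by
    funext p
    ext l
    simp [planePoint]
  rw [this]
  fun_prop

theorem measurePreserving_planePoint {i j : Fin 2} (hij : i ≠ j) :
    MeasurePreserving (planePoint i j) := by
  have h : MeasurePreserving (fun p : ℝ × ℝ => (!₂[p.1, p.2] : E2)) :=
    (PiLp.volume_preserving_toLp (Fin 2)).comp (volume_preserving_finTwoArrow ℝ).symm
  fin_cases i <;> fin_cases j
  · exact absurd rfl hij
  · refine (congrArg (fun f => MeasurePreserving f volume volume) (funext fun p => ?_)).mpr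
      (h.comp Measure.measurePreserving_swap)
    ext l
    fin_cases l <;> simp [planePoint]
  · refine (congrArg (fun f => MeasurePreserving f volume volume) (funext fun p => ?_)).mpr h
    ext l
    fin_cases l <;> simp [planePoint]
  · exact absurd rfl hij

theorem measurableEmbedding_planePoint {i j : Fin 2} (hij : i ≠ j) :
    MeasurableEmbedding (planePoint i j) := by
  refine (continuous_planePoint i j).measurableEmbedding fun p q h => ?_
  have h1 := congrArg (fun x : E2 => x j) h
  have h2 := congrArg (fun x : E2 => x i) h
  simp only [planePoint_apply_left hij, planePoint_apply_right hij] at h1 h2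
  exact Prod.ext h1 h2

theorem setIntegral_eq_integral_line {i j : Fin 2} (hij : i ≠ j) {S : Set E2} (hS : IsClosed S)
    {g : E2 → ℝ} (hg : IntegrableOn g S) :
    ∫ x in S, g x = ∫ y : ℝ, ∫ z in {z | planePoint i j (y, z) ∈ S}, g (planePoint i j (y, z)) := by
  have hm : MeasurableSet (planePoint i j ⁻¹' S) :=
    (hS.preimage (continuous_planePoint i j)).measurableSet
  rw [← (measurePreserving_planePoint hij).setIntegral_preimage_emb
    (measurableEmbedding_planePoint hij), ← integral_indicator hm, Measure.volume_eq_prod,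
    integral_prod]
  · congr 1 with y
    have hmy : MeasurableSet {z | planePoint i j (y, z) ∈ S} :=
      (hS.preimage ((continuous_planePoint i j).comp (by fun_prop :
        Continuous fun z : ℝ => (y, z)))).measurableSet
    rw [← integral_indicator hmy]
    rfl
  · exact (integrable_indicator_iff hm).2
      (((measurePreserving_planePoint hij).integrableOn_comp_preimage
        (measurableEmbedding_planePoint hij)).2 hg)

/-! ### The divergence theorem in a planar domain with piecewise `C¹` boundary -/

namespace PiecewiseBoundary

variable {S : Set E2} {N : ℕ} {piece : Fin N → Set E2} (D : PiecewiseBoundary S piece)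

/-- In the plane the unit normal is a rotated unit tangent, up to sign. So the size of the flux
density in direction `i` is the Jacobian of the projection of the arc to the other axis. -/
theorem abs_normal_mul_norm_deriv (k : Fin N) (m : Fin (D.count k)) {s : ℝ}
    (hs : s ∈ Ioo (0 : ℝ) 1) {i j : Fin 2} (hij : i ≠ j) :
    |D.normal (D.arc k m s) i| * ‖deriv (D.arc k m) s‖ = |deriv (D.arc k m) s j| := by
  have h1 := D.normal_orthogonal k m s hs
  have h2 := D.norm_normal k m s hs
  have h3 := EuclideanSpace.real_norm_sq_eq (deriv (D.arc k m) s)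
  have h4 := EuclideanSpace.real_norm_sq_eq (D.normal (D.arc k m s))
  rw [PiLp.inner_apply, sum_eq_add_of_ne hij] at h1
  rw [sum_eq_add_of_ne hij] at h3 h4
  simp only [RCLike.inner_apply, conj_trivial] at h1
  rw [h2] at h4
  rw [← abs_norm (deriv (D.arc k m) s), ← abs_mul, ← sq_eq_sq_iff_abs_eq_abs, mul_pow, h3]
  linear_combination (D.normal (D.arc k m s) i * deriv (D.arc k m) s i -
    D.normal (D.arc k m s) j * deriv (D.arc k m) s j) * h1 - deriv (D.arc k m) s j ^ 2 * h4

theorem integrableOn_normal_mul (k : Fin N) (m : Fin (D.count k)) {V : E2 → ℝ}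
    (hV : ContinuousOn V S) (i : Fin 2) :
    IntegrableOn (fun s => V (D.arc k m s) * D.normal (D.arc k m s) i * ‖deriv (D.arc k m) s‖)
      (Ioo 0 1) := by
  obtain ⟨K, hK⟩ := D.exists_norm_deriv_arc_le k m
  have hVa : ContinuousOn (fun s => V (D.arc k m s)) (Icc 0 1) :=
    hV.comp (D.contDiffOn k m).continuousOn fun s hs => D.arc_mem_set k m hs
  obtain ⟨R, hR⟩ := isCompact_Icc.exists_bound_of_continuousOn hVa
  refine IntegrableOn.of_bound measure_Ioo_lt_top ?_ (R * 1 * K) ?_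
  · refine ContinuousOn.aestronglyMeasurable ?_ measurableSet_Ioo
    refine ((hVa.mono Ioo_subset_Icc_self).mul ?_).mul (D.continuousOn_deriv_arc k m).norm
    exact (EuclideanSpace.proj i : E2 →L[ℝ] ℝ).continuous.comp_continuousOn
      (D.continuousOn_normal k m)
  · filter_upwards [ae_restrict_mem measurableSet_Ioo] with s hs
    have h1 := hR s (Ioo_subset_Icc_self hs)
    have h2 : ‖D.normal (D.arc k m s) i‖ ≤ 1 := by
      rw [← D.norm_normal k m s hs]
      exact PiLp.norm_apply_le _ i
    rw [norm_mul, norm_mul, norm_norm]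
    have := hK s hs
    have h0 : 0 ≤ R := (norm_nonneg _).trans h1
    gcongr

/-- One-dimensional Sard: the critical values of a coordinate along an arc form a null set. The two
end points exclude only two further values per arc. -/
theorem ae_transversal (j : Fin 2) : ∀ᵐ y : ℝ, ∀ k m, ∀ s ∈ Icc (0 : ℝ) 1, D.arc k m s j = y →
    s ∈ Ioo (0 : ℝ) 1 ∧ deriv (D.arc k m) s j ≠ 0 := by
  rw [ae_all_iff]
  intro k
  rw [ae_all_iff]
  intro m
  have hcrit : volume ((fun s => D.arc k m s j) ''
      {s ∈ Ioo (0 : ℝ) 1 | deriv (D.arc k m) s j = 0}) = 0 := by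
    refine addHaar_image_eq_zero_of_det_fderivWithin_eq_zero volume
      (f' := fun s => ContinuousLinearMap.toSpanSingleton ℝ (deriv (D.arc k m) s j))
      (fun s hs => ?_) fun s hs => ?_
    · have h := (D.hasStrictDerivAt_arc k m hs.1).hasDerivAt
      exact ((EuclideanSpace.proj j : E2 →L[ℝ] ℝ).hasFDerivAt.comp_hasDerivAt s
        h).hasFDerivAt.hasFDerivWithinAt
    · rw [ContinuousLinearMap.det_toSpanSingleton, hs.2]
  filter_upwards [measure_eq_zero_iff_ae_notMem.1 hcrit,
    measure_eq_zero_iff_ae_notMem.1 (measure_singleton (μ := volume) (D.arc k m 0 j)),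
    measure_eq_zero_iff_ae_notMem.1 (measure_singleton (μ := volume) (D.arc k m 1 j))]
    with y h1 h2 h3 s hs hsy
  have hs' : s ∈ Ioo (0 : ℝ) 1 := by
    refine ⟨lt_of_le_of_ne hs.1 ?_, lt_of_le_of_ne hs.2 ?_⟩
    · rintro rfl
      exact h2 hsy.symm
    · rintro rfl
      exact h3 hsy.symm
  exact ⟨hs', fun h0 => h1 ⟨s, ⟨hs', h0⟩, hsy⟩⟩

/-- An infinite fibre would accumulate in the compact parameter interval, at a point of the same
value. There the derivative is nonzero by `hy`, so this value is taken in isolation. -/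
theorem finite_fiber (k : Fin N) (m : Fin (D.count k)) {j : Fin 2} {y : ℝ}
    (hy : ∀ s ∈ Icc (0 : ℝ) 1, D.arc k m s j = y →
      s ∈ Ioo (0 : ℝ) 1 ∧ deriv (D.arc k m) s j ≠ 0) :
    {s ∈ Ioo (0 : ℝ) 1 | D.arc k m s j = y}.Finite := by
  by_contra hinf
  obtain ⟨s, hs, hacc⟩ := Set.Infinite.exists_accPt_of_subset_isCompact hinf
    (isCompact_Icc (a := (0 : ℝ)) (b := 1)) fun s hs => Ioo_subset_Icc_self hs.1
  rw [accPt_iff_frequently_nhdsNE] at hacc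
  have hc : ContinuousOn (fun s => D.arc k m s j) (Icc 0 1) :=
    (EuclideanSpace.proj j : E2 →L[ℝ] ℝ).continuous.comp_continuousOn
      (D.contDiffOn k m).continuousOn
  have hcl : IsClosed (Icc (0 : ℝ) 1 ∩ (fun s => D.arc k m s j) ⁻¹' {y}) :=
    hc.preimage_isClosed_of_isClosed isClosed_Icc isClosed_singleton
  have hsy : s ∈ Icc (0 : ℝ) 1 ∩ (fun s => D.arc k m s j) ⁻¹' {y} := by
    rw [← hcl.closure_eq, mem_closure_iff_frequently]
    exact (hacc.filter_mono nhdsWithin_le_nhds).mono fun x hx => ⟨Ioo_subset_Icc_self hx.1, hx.2⟩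
  obtain ⟨hsI, hd⟩ := hy s hsy.1 hsy.2
  have h : HasDerivAt (fun s => D.arc k m s j) (deriv (D.arc k m) s j) s :=
    (EuclideanSpace.proj j : E2 →L[ℝ] ℝ).hasFDerivAt.comp_hasDerivAt s
      (D.hasStrictDerivAt_arc k m hsI).hasDerivAt
  exact hacc ((h.eventually_ne hd).mono fun x hx hx' => hx hx'.2)

/-- The divergence theorem for a field in a coordinate direction. -/
theorem setIntegral_partial (hS : IsCompact S) {V : E2 → ℝ} (hV : ∀ t ∈ S, ContDiffAt ℝ 1 V t)
    (i : Fin 2) :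
    ∫ t in S, fderiv ℝ V t (EuclideanSpace.single i 1) =
      ∑ a : (k : Fin N) × Fin (D.count k), ∫ s in Ioo (0 : ℝ) 1,
        V (D.arc a.1 a.2 s) * D.normal (D.arc a.1 a.2 s) i * ‖deriv (D.arc a.1 a.2) s‖ := by
  classical
  obtain ⟨j, hij⟩ : ∃ j : Fin 2, i ≠ j := ⟨i + 1, by fin_cases i <;> simp⟩
  have hVc : ContinuousOn V S := fun t ht => (hV t ht).continuousAt.continuousWithinAt
  have hV'c : ContinuousOn (fun t => fderiv ℝ V t (EuclideanSpace.single i 1)) S := fun t ht =>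
    (((hV t ht).fderiv_right (m := 0) (by norm_num)).continuousAt.clm_apply
      continuousAt_const).continuousWithinAt
  have hline : ∀ y : ℝ, Continuous fun z : ℝ => planePoint i j (y, z) := fun y =>
    (continuous_planePoint i j).comp (by fun_prop)
  have hsign : ∀ (a : (k : Fin N) × Fin (D.count k)), ∀ s ∈ Ioo (0 : ℝ) 1,
      |deriv (D.arc a.1 a.2) s j| *
        (Real.sign (D.normal (D.arc a.1 a.2 s) i) * V (D.arc a.1 a.2 s)) =
      V (D.arc a.1 a.2 s) * D.normal (D.arc a.1 a.2 s) i * ‖deriv (D.arc a.1 a.2) s‖ := by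
    intro a s hs
    rw [← D.abs_normal_mul_norm_deriv a.1 a.2 hs hij]
    have := Real.sign_mul_abs_eq_self (D.normal (D.arc a.1 a.2 s) i)
    linear_combination (‖deriv (D.arc a.1 a.2) s‖ * V (D.arc a.1 a.2 s)) * this
  -- For almost every `y`, the line of direction `i` gives a signed sum over its crossings with the
  -- arcs; the area formula with multiplicities turns the integral of these sums into arc integrals.
  rw [setIntegral_eq_integral_line hij D.isClosed (hV'c.integrableOn_compact hS),
    integral_sum_fiber (ι := (k : Fin N) × Fin (D.count k)) isOpen_Ioo
      (g := fun a s => D.arc a.1 a.2 s j) (g' := fun a s => deriv (D.arc a.1 a.2) s j)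
      (F := fun a s => Real.sign (D.normal (D.arc a.1 a.2 s) i) * V (D.arc a.1 a.2 s))]
  · exact Finset.sum_congr rfl fun a _ => setIntegral_congr_fun measurableSet_Ioo (hsign a)
  · intro a s hs
    exact (EuclideanSpace.proj j : E2 →L[ℝ] ℝ).hasFDerivAt.comp_hasDerivAt s
      (D.hasStrictDerivAt_arc a.1 a.2 hs).hasDerivAt
  · intro a
    exact (EuclideanSpace.proj j : E2 →L[ℝ] ℝ).continuous.comp_continuousOn
      (D.continuousOn_deriv_arc a.1 a.2)
  · intro a
    exact (D.integrableOn_normal_mul a.1 a.2 hVc i).congr_fun (fun s hs => (hsign a s hs).symm)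
      measurableSet_Ioo
  · filter_upwards [D.ae_transversal j] with y hy
    have hfin := fun a : (k : Fin N) × Fin (D.count k) => D.finite_fiber a.1 a.2 (hy a.1 a.2)
    set T : Finset ((_ : (k : Fin N) × Fin (D.count k)) × ℝ) :=
      Finset.univ.sigma fun a => (hfin a).toFinset with hT
    have hTmem : ∀ p, p ∈ T ↔ p.2 ∈ Ioo (0 : ℝ) 1 ∧ D.arc p.1.1 p.1.2 p.2 j = y := by
      intro p
      simp [hT]
    have hpt : ∀ p ∈ T, planePoint i j (y, D.arc p.1.1 p.1.2 p.2 i) = D.arc p.1.1 p.1.2 p.2 := by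
      intro p hp
      rw [← ((hTmem p).1 hp).2, planePoint_eq hij]
    have hfr : ∀ z, planePoint i j (y, z) ∈ frontier S →
        ∃ p ∈ T, D.arc p.1.1 p.1.2 p.2 i = z := by
      intro z hz
      rw [D.cover] at hz
      obtain ⟨k, hk⟩ := mem_iUnion.1 hz
      obtain ⟨m, s, hs, hsz⟩ := mem_iUnion.1 hk
      have hj : D.arc k m s j = y := by rw [hsz, planePoint_apply_right hij]
      refine ⟨⟨⟨k, m⟩, s⟩, (hTmem _).2 ⟨(hy k m s hs hj).1, hj⟩, ?_⟩
      simp only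
      rw [hsz, planePoint_apply_left hij]
    have hK : IsCompact {z | planePoint i j (y, z) ∈ S} := by
      refine (hS.image (EuclideanSpace.proj i : E2 →L[ℝ] ℝ).continuous).of_isClosed_subset
        (D.isClosed.preimage (hline y)) fun z hz => ⟨_, hz, planePoint_apply_left hij _⟩
    refine ⟨T, hTmem, fun p hp => ?_, ?_⟩
    · have := (hTmem p).1 hp
      exact (hy p.1.1 p.1.2 p.2 (Ioo_subset_Icc_self this.1) this.2).2
    rw [setIntegral_eq_sum_indexed_endpoints T (fun p => D.arc p.1.1 p.1.2 p.2 i)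
      (fun p => Real.sign (D.normal (D.arc p.1.1 p.1.2 p.2) i))
      (f := fun z => V (planePoint i j (y, z))) ?_ hK ?_ ?_ ?_ ?_ ?_]
    · exact Finset.sum_congr rfl fun p hp => by rw [hpt p hp]
    · rintro ⟨a, s⟩ hp ⟨a', s'⟩ hp' h
      have h1 := hpt _ hp
      have h2 := hpt _ hp'
      simp only at h h1 h2
      rw [h, h2] at h1
      obtain ⟨h3, h4⟩ := D.simple a.1 a.2 a'.1 a'.2 s ((hTmem _).1 hp).1 s'
        (Ioo_subset_Icc_self ((hTmem _).1 hp').1) h1.symm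
      have h3 : a = a' := h3
      rw [h3, h4]
    · intro z hz
      exact hfr z ((hline y).frontier_preimage_subset _ hz)
    · intro p hp
      obtain ⟨hs, -⟩ := (hTmem p).1 hp
      have hd := (hy p.1.1 p.1.2 p.2 (Ioo_subset_Icc_self hs) ((hTmem p).1 hp).2).2
      set ν := D.normal (D.arc p.1.1 p.1.2 p.2) i with hν
      have hν0 : ν ≠ 0 := by
        intro h0
        have := D.abs_normal_mul_norm_deriv p.1.1 p.1.2 hs hij
        rw [← hν, h0, abs_zero, zero_mul] at this
        exact hd (abs_eq_zero.1 this.symm)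
      refine ⟨(Real.sign_apply_eq_of_ne_zero ν hν0).symm, ?_⟩
      have hin : inner ℝ (D.normal (D.arc p.1.1 p.1.2 p.2)) (EuclideanSpace.single i (1 : ℝ)) = ν := by
        rw [EuclideanSpace.inner_single_right]
        simp [hν]
      filter_upwards [D.eventually_line p.1.1 p.1.2 hs (EuclideanSpace.single i (1 : ℝ))
        (σ := Real.sign ν) (by rw [hin]; exact Real.sign_mul_pos_of_ne_zero ν hν0)] with ε hε
      rw [planePoint_add, sub_eq_add_neg, planePoint_add, hpt p hp, neg_smul, ← sub_eq_add_neg]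
      exact hε
    · exact hVc.comp (hline y).continuousOn fun z hz => hz
    · intro z hz _
      have h1 : HasDerivAt (fun z : ℝ => planePoint i j (y, z)) (EuclideanSpace.single i 1) z := by
        have := (((hasDerivAt_id z).sub_const z).smul_const
          (EuclideanSpace.single i (1 : ℝ) : E2)).const_add (planePoint i j (y, z))
        rw [one_smul] at this
        refine this.congr_of_eventuallyEq (Eventually.of_forall fun w => ?_)
        simp only [id]
        rw [← planePoint_add, add_sub_cancel]
      exact ((hV _ hz).differentiableAt (by norm_num)).hasFDerivAt.comp_hasDerivAt z h1
    · exact (hV'c.comp (hline y).continuousOn fun z hz => hz).integrableOn_compact hK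

/-- The divergence theorem in a compact planar domain with piecewise `C¹` boundary. -/
theorem setIntegral_planarDiv (hS : IsCompact S) {H : E2 → E2} (hH : ∀ t ∈ S, ContDiffAt ℝ 1 H t) :
    ∫ t in S, planarDiv H t = ∑ k, D.lineIntegral k fun t => inner ℝ (H t) (D.normal t) := by
  have hV : ∀ i : Fin 2, ∀ t ∈ S, ContDiffAt ℝ 1 (fun t => H t i) t := fun i t ht =>
    (EuclideanSpace.proj i : E2 →L[ℝ] ℝ).contDiff.contDiffAt.comp t (hH t ht)
  have hdiv : ∀ t ∈ S, planarDiv H t =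
      ∑ i, fderiv ℝ (fun t => H t i) t (EuclideanSpace.single i 1) := by
    intro t ht
    refine Finset.sum_congr rfl fun i _ => ?_
    have h := ((EuclideanSpace.proj i : E2 →L[ℝ] ℝ).hasFDerivAt.comp t
      ((hH t ht).differentiableAt (by norm_num)).hasFDerivAt).fderiv
    have h' : fderiv ℝ (fun t => H t i) t = _ := h
    rw [h']
    rfl
  have hVc : ∀ i : Fin 2, ContinuousOn (fun t => H t i) S := fun i t ht =>
    (hV i t ht).continuousAt.continuousWithinAt
  rw [setIntegral_congr_fun D.isClosed.measurableSet hdiv, integral_finsetSum]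
  · simp only [D.setIntegral_partial hS (hV _)]
    rw [Finset.sum_comm, Fintype.sum_sigma]
    refine Finset.sum_congr rfl fun k _ => ?_
    rw [lineIntegral]
    refine Finset.sum_congr rfl fun m _ => ?_
    rw [intervalIntegral.integral_of_le zero_le_one, integral_Ioc_eq_integral_Ioo,
      ← integral_finsetSum]
    · refine integral_congr_ae (Eventually.of_forall fun s => ?_)
      simp only [PiLp.inner_apply, RCLike.inner_apply, conj_trivial, Finset.sum_mul]
      exact Finset.sum_congr rfl fun i _ => by ring
    · exact fun i _ => D.integrableOn_normal_mul k m (hVc i) i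
  · intro i _
    refine ContinuousOn.integrableOn_compact hS fun t ht => ?_
    exact (((hV i t ht).fderiv_right (m := 0) (by norm_num)).continuousAt.clm_apply
      continuousAt_const).continuousWithinAt

end PiecewiseBoundary

/-! ### Existence of planar primitives of the reduced height -/

open Convolution in
/-- The primitive of a compactly supported `C¹` function in one variable is jointly `C¹`. -/
theorem contDiff_integral_Iic {G : ℝ × ℝ → ℝ} (hG : ContDiff ℝ 1 G) (hc : HasCompactSupport G) :
    ContDiff ℝ 1 fun q : ℝ × ℝ => ∫ y in Iic q.2, G (q.1, y) := by
  -- The primitive is the convolution in the second variable with the Heaviside function, and such a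
  -- convolution inherits joint smoothness from its compactly supported factor.
  have hf : LocallyIntegrable ((Ici (0 : ℝ)).indicator fun _ => (1 : ℝ)) volume :=
    continuous_const.locallyIntegrable.indicator measurableSet_Ici
  have h := contDiffOn_convolution_right_with_param (𝕜 := ℝ) (n := 1) (μ := volume)
    (ContinuousLinearMap.mul ℝ ℝ) (g := fun p y => G (p, y)) (s := univ)
    (k := Prod.snd '' tsupport G) isOpen_univ (hc.image continuous_snd)
    (fun p x _ hx => by
      by_contra h0
      exact hx ⟨(p, x), subset_tsupport _ h0, rfl⟩) hf hG.contDiffOn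
  rw [univ_prod_univ, contDiffOn_univ] at h
  refine (congrArg (ContDiff ℝ 1) (funext fun q => ?_)).mp h
  rw [convolution_mul_swap, ← integral_indicator measurableSet_Iic]
  congr 1
  ext y
  by_cases hy : y ≤ q.2 <;> simp [indicator, hy]

theorem hasDerivAt_integral_Iic {g : ℝ → ℝ} (hg : Continuous g) (hi : Integrable g) (x : ℝ) :
    HasDerivAt (fun x => ∫ y in Iic x, g y) (g x) x := by
  have h : (fun x => ∫ y in Iic x, g y) = fun x => (∫ y in Iic 0, g y) + ∫ y in (0 : ℝ)..x, g y := by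
    ext x
    rw [← intervalIntegral.integral_Iic_sub_Iic hi.integrableOn hi.integrableOn]
    ring
  rw [h]
  exact (intervalIntegral.integral_hasDerivAt_right (hg.intervalIntegrable _ _)
    (hg.stronglyMeasurableAtFilter _ _) hg.continuousAt).const_add _

/-- The field `(∫_{-∞}^{t₁} g(s, t₂) ds, 0)` works. The function `G` swaps the coordinates so that
the variable of integration comes second. -/
theorem exists_planarDiv_eq {g : E2 → ℝ} (hg : ContDiff ℝ 1 g) (hc : HasCompactSupport g) :
    ∃ H : E2 → E2, ContDiff ℝ 1 H ∧ ∀ t, planarDiv H t = g t := by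
  set G : ℝ × ℝ → ℝ := fun q => g !₂[q.2, q.1] with hGdef
  have hlin : ContDiff ℝ 1 fun q : ℝ × ℝ => (!₂[q.2, q.1] : E2) := by
    rw [contDiff_euclidean]
    intro i
    fin_cases i
    · exact contDiff_snd
    · exact contDiff_fst
  have hG : ContDiff ℝ 1 G := hg.comp hlin
  have hcoord : ContDiff ℝ 1 fun t : E2 => ((t 1, t 0) : ℝ × ℝ) :=
    (EuclideanSpace.proj 1 : E2 →L[ℝ] ℝ).contDiff.prodMk (EuclideanSpace.proj 0 : E2 →L[ℝ] ℝ).contDiff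
  have hGc : HasCompactSupport G := by
    refine HasCompactSupport.intro (hc.image hcoord.continuous) fun q hq => ?_
    by_contra h0
    exact hq ⟨!₂[q.2, q.1], subset_tsupport _ h0, by simp⟩
  have hF := contDiff_integral_Iic hG hGc
  set H : E2 → E2 := fun t => !₂[∫ y in Iic (t 0), G (t 1, y), 0] with hH
  have hHc : ContDiff ℝ 1 H := by
    rw [contDiff_euclidean]
    intro i
    fin_cases i
    · exact hF.comp hcoord
    · exact contDiff_const
  refine ⟨H, hHc, fun t => ?_⟩
  have hd : HasFDerivAt H (fderiv ℝ H t) t := (hHc.differentiable one_ne_zero t).hasFDerivAt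
  have hcomp : ∀ i, HasFDerivAt (fun t => H t i)
      ((EuclideanSpace.proj i : E2 →L[ℝ] ℝ).comp (fderiv ℝ H t)) t := fun i =>
    (EuclideanSpace.proj i : E2 →L[ℝ] ℝ).hasFDerivAt.comp t hd
  have h1 : (fderiv ℝ H t (EuclideanSpace.single 1 1)) 1 = 0 := by
    have := (hcomp 1).unique (hasFDerivAt_const (0 : ℝ) t)
    simpa using congrArg (fun l : E2 →L[ℝ] ℝ => l (EuclideanSpace.single 1 1)) this
  have h0 : (fderiv ℝ H t (EuclideanSpace.single 0 1)) 0 = g t := by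
    have hl := (hcomp 0).hasLineDerivAt (EuclideanSpace.single 0 1)
    have hcont : Continuous fun y => G (t 1, y) := hG.continuous.comp (by fun_prop)
    have hint : Integrable fun y => G (t 1, y) := by
      refine hcont.integrable_of_hasCompactSupport
        (HasCompactSupport.intro (hGc.image continuous_snd) fun y hy => ?_)
      by_contra h0
      exact hy ⟨(t 1, y), subset_tsupport _ h0, rfl⟩
    have hr : HasDerivAt (fun s : ℝ => ∫ y in Iic (t 0 + s), G (t 1, y)) (G (t 1, t 0 + 0)) 0 :=
      (hasDerivAt_integral_Iic hcont hint (t 0 + 0)).comp_const_add (t 0) 0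
    have hl' : HasDerivAt (fun s : ℝ => ∫ y in Iic (t 0 + s), G (t 1, y))
        ((fderiv ℝ H t (EuclideanSpace.single 0 1)) 0) 0 := by
      have := hl
      unfold HasLineDerivAt at this
      simpa [hH] using this
    have ht : (!₂[t 0 + 0, t 1] : E2) = t := by
      ext i
      fin_cases i <;> simp
    rw [hl'.unique hr, hGdef]
    exact congrArg g ht
  rw [planarDiv, Fin.sum_univ_two, h0, h1, add_zero]

open scoped Manifold in
-- As `g` is `C¹` only near `S`, it is multiplied by a cutoff that is 1 near `S` and supported where
-- `g` is `C¹`. The ball keeps the support compact.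
theorem exists_isPlanarPrimitive {S : Set E2} (hS : IsCompact S) {g : E2 → ℝ}
    (hg : ∀ t ∈ S, ContDiffAt ℝ 1 g t) : ∃ H, IsPlanarPrimitive S g H := by
  obtain ⟨R, hR⟩ := hS.isBounded.subset_ball (0 : E2)
  set T : Set E2 := {t | ContDiffAt ℝ 1 g t} ∩ Metric.ball 0 R with hT
  have hTS : S ⊆ interior T := fun t ht => by
    rw [mem_interior_iff_mem_nhds]
    exact inter_mem ((hg t ht).eventually (by simp)) (Metric.isOpen_ball.mem_nhds (hR ht))
  obtain ⟨V, hV, hSV, hVT⟩ := exists_compact_between hS isOpen_interior hTS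
  obtain ⟨χ, h1, h0, -⟩ := exists_contMDiffMap_one_nhds_of_subset_interior (n := 1) 𝓘(ℝ, E2)
    hS.isClosed hSV
  have hχ : ContDiff ℝ 1 χ := χ.contMDiff.contDiff
  have hsub : tsupport (fun t => χ t * g t) ⊆ V := by
    refine closure_minimal (fun t ht => ?_) hV.isClosed
    by_contra hn
    exact ht (by simp [h0 t hn])
  have hc : ContDiff ℝ 1 fun t => χ t * g t := by
    refine (contMDiff_of_tsupport fun t ht => ContDiffAt.contMDiffAt ?_).contDiff
    exact hχ.contDiffAt.mul (interior_subset (hVT (hsub ht))).1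
  obtain ⟨H, hH, hdiv⟩ := exists_planarDiv_eq hc (hV.of_isClosed_subset (isClosed_tsupport _) hsub)
  refine ⟨H, fun t ht => ⟨hH.contDiffAt, ?_⟩⟩
  rw [hdiv, h1.self_of_nhdsSet t ht, one_mul]

theorem contDiffAt_gradient_apply {h : E2 → ℝ} {t : E2} (hh : ContDiffAt ℝ 2 h t) (i : Fin 2) :
    ContDiffAt ℝ 1 (fun t => gradient h t i) t := by
  simp only [IsGraphPatch.gradient_apply]
  exact (hh.fderiv_right (m := 1) (by norm_num)).clm_apply contDiffAt_const

theorem Frame.reducedHeight_eq (B : Frame) (h : E2 → ℝ) (xref : E3) (t : E2) :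
    B.reducedHeight h xref t = h t - (gradient h t 0 * t 0 + gradient h t 1 * t 1) +
      (inner ℝ (B.base - xref) (B.basis 2) - (gradient h t 0 * inner ℝ (B.base - xref) (B.basis 0) +
        gradient h t 1 * inner ℝ (B.base - xref) (B.basis 1))) := by
  have hin : (inner ℝ (gradient h t) t : ℝ) = gradient h t 0 * t 0 + gradient h t 1 * t 1 := by
    rw [PiLp.inner_apply, Fin.sum_univ_two]
    simp [mul_comm]
  rw [reducedHeight, hin, inner_sub_right (B.base - xref), inner_add_right, real_inner_smul_right,
    real_inner_smul_right]

theorem Frame.contDiffAt_reducedHeight (B : Frame) {h : E2 → ℝ} {t : E2}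
    (hh : ContDiffAt ℝ 2 h t) (xref : E3) : ContDiffAt ℝ 1 (B.reducedHeight h xref) t := by
  rw [funext (B.reducedHeight_eq h xref)]
  have h0 := contDiffAt_gradient_apply hh 0
  have h1 := contDiffAt_gradient_apply hh 1
  have hp : ∀ i, ContDiffAt ℝ 1 (fun t : E2 => t i) t := fun i =>
    (EuclideanSpace.proj i : E2 →L[ℝ] ℝ).contDiff.contDiffAt
  have h2 : ContDiffAt ℝ 1 h t := hh.of_le (by norm_num)
  exact (h2.sub ((h0.mul (hp 0)).add (h1.mul (hp 1)))).add
    (contDiffAt_const.sub ((h0.mul contDiffAt_const).add (h1.mul contDiffAt_const)))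

/-! ### The osculating paraboloid as a graph patch -/

/-- The Hessian of `paraboloidHeight κ`. -/
def paraboloidForm (κ : Fin 2 → ℝ) : E2 →L[ℝ] E2 →L[ℝ] ℝ :=
  (κ 0 • (EuclideanSpace.proj 0 : E2 →L[ℝ] ℝ)).smulRight (EuclideanSpace.proj 0 : E2 →L[ℝ] ℝ) +
    (κ 1 • (EuclideanSpace.proj 1 : E2 →L[ℝ] ℝ)).smulRight (EuclideanSpace.proj 1 : E2 →L[ℝ] ℝ)

theorem paraboloidForm_apply (κ : Fin 2 → ℝ) (v w : E2) :
    paraboloidForm κ v w = κ 0 * v 0 * w 0 + κ 1 * v 1 * w 1 := by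
  simp [paraboloidForm]

theorem hasFDerivAt_paraboloidHeight (κ : Fin 2 → ℝ) (t : E2) :
    HasFDerivAt (paraboloidHeight κ) (paraboloidForm κ t) t := by
  have h0 := ((EuclideanSpace.proj 0 : E2 →L[ℝ] ℝ).hasFDerivAt (x := t)).pow 2
  have h1 := ((EuclideanSpace.proj 1 : E2 →L[ℝ] ℝ).hasFDerivAt (x := t)).pow 2
  have h := ((h0.const_mul (κ 0)).add (h1.const_mul (κ 1))).mul_const (2⁻¹ : ℝ)
  refine (h.congr_fderiv ?_).congr_of_eventuallyEq (Eventually.of_forall fun s => ?_)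
  · ext v
    rw [paraboloidForm_apply]
    simp
    ring
  · simp [paraboloidHeight, div_eq_mul_inv]

theorem contDiff_paraboloidHeight (κ : Fin 2 → ℝ) {n : WithTop ℕ∞} :
    ContDiff ℝ n (paraboloidHeight κ) := by
  have hp : ∀ i, ContDiff ℝ n (fun t : E2 => t i) := fun i =>
    (EuclideanSpace.proj i : E2 →L[ℝ] ℝ).contDiff
  exact ((contDiff_const.mul ((hp 0).pow 2)).add (contDiff_const.mul ((hp 1).pow 2))).div_const 2

theorem contDiff_paraboloidPrimitive (κ : Fin 2 → ℝ) {n : WithTop ℕ∞} :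
    ContDiff ℝ n (paraboloidPrimitive κ) := by
  have hp : ∀ i, ContDiff ℝ n (fun t : E2 => t i) := fun i =>
    (EuclideanSpace.proj i : E2 →L[ℝ] ℝ).contDiff
  rw [contDiff_euclidean]
  intro i
  fin_cases i
  · exact contDiff_const.mul ((contDiff_const.mul ((hp 0).pow 3)).add
      ((contDiff_const.mul (hp 0)).mul ((hp 1).pow 2)))
  · exact contDiff_const

theorem planarDiv_paraboloidPrimitive (κ : Fin 2 → ℝ) (t : E2) :
    planarDiv (paraboloidPrimitive κ) t = -(κ 0 * t 0 ^ 2 + κ 1 * t 1 ^ 2) / 2 := by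
  have hd : HasFDerivAt (paraboloidPrimitive κ) (fderiv ℝ (paraboloidPrimitive κ) t) t :=
    ((contDiff_paraboloidPrimitive κ (n := 1)).differentiable one_ne_zero t).hasFDerivAt
  have hcomp : ∀ i, HasFDerivAt (fun t => paraboloidPrimitive κ t i)
      ((EuclideanSpace.proj i : E2 →L[ℝ] ℝ).comp (fderiv ℝ (paraboloidPrimitive κ) t)) t := fun i =>
    (EuclideanSpace.proj i : E2 →L[ℝ] ℝ).hasFDerivAt.comp t hd
  have p0 := (EuclideanSpace.proj 0 : E2 →L[ℝ] ℝ).hasFDerivAt (x := t)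
  have p1 := (EuclideanSpace.proj 1 : E2 →L[ℝ] ℝ).hasFDerivAt (x := t)
  have h0 : HasFDerivAt (fun t => paraboloidPrimitive κ t 0) _ t :=
    (((p0.pow 3).const_mul (κ 0)).add ((p0.const_mul (3 * κ 1)).mul (p1.pow 2))).const_mul (-(1 / 6))
  have e1 : (fderiv ℝ (paraboloidPrimitive κ) t (EuclideanSpace.single 1 1)) 1 = 0 := by
    have := (hcomp 1).unique (hasFDerivAt_const (0 : ℝ) t)
    simpa using congrArg (fun l : E2 →L[ℝ] ℝ => l (EuclideanSpace.single 1 1)) this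
  have e0 := congrArg (fun l : E2 →L[ℝ] ℝ => l (EuclideanSpace.single 0 1)) ((hcomp 0).unique h0)
  simp at e0
  rw [planarDiv, Fin.sum_univ_two, e1, e0]
  ring

/-- By Euler's identity a quadratic form satisfies `⟨∇h̃, t⟩ = 2 h̃`, so with the base point as
reference the reduced height is `-h̃`, which is integrated in `t₁`. -/
theorem isPlanarPrimitive_paraboloidPrimitive (B : Frame) (κ : Fin 2 → ℝ) :
    IsPlanarPrimitive univ (B.reducedHeight (paraboloidHeight κ) B.base)
      (paraboloidPrimitive κ) := by
  intro t _
  refine ⟨(contDiff_paraboloidPrimitive κ).contDiffAt, ?_⟩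
  rw [planarDiv_paraboloidPrimitive, B.reducedHeight_eq, IsGraphPatch.gradient_apply,
    IsGraphPatch.gradient_apply, (hasFDerivAt_paraboloidHeight κ t).fderiv, paraboloidForm_apply,
    paraboloidForm_apply, paraboloidHeight]
  simp
  ring

theorem Frame.contDiff_tangential (B : Frame) {n : WithTop ℕ∞} : ContDiff ℝ n B.tangential := by
  rw [contDiff_euclidean]
  intro i
  fin_cases i
  · exact contDiff_const.inner ℝ (contDiff_id.sub contDiff_const)
  · exact contDiff_const.inner ℝ (contDiff_id.sub contDiff_const)

theorem contDiff_paraboloidLevel (B : Frame) (κ : Fin 2 → ℝ) {n : WithTop ℕ∞} :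
    ContDiff ℝ n (paraboloidLevel B κ) :=
  ((contDiff_id.sub contDiff_const).inner ℝ contDiff_const).sub
    ((contDiff_paraboloidHeight κ).comp B.contDiff_tangential)

theorem paraboloidLevel_chart (B : Frame) (κ : Fin 2 → ℝ) (t : E2) (z : ℝ) :
    paraboloidLevel B κ (B.chart (t, z)) = z - paraboloidHeight κ t := by
  have := B.height_chart (t, z)
  rw [Frame.height, real_inner_comm] at this
  rw [paraboloidLevel, this, B.tangential_chart]

theorem fderiv_paraboloidLevel_normal (B : Frame) (κ : Fin 2 → ℝ) (x : E3) :
    fderiv ℝ (paraboloidLevel B κ) x (B.basis 2) = 1 := by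
  have hd : HasFDerivAt (paraboloidLevel B κ) (fderiv ℝ (paraboloidLevel B κ) x) x :=
    ((contDiff_paraboloidLevel B κ (n := 1)).differentiable one_ne_zero x).hasFDerivAt
  have h1 := hd.hasLineDerivAt (B.basis 2)
  refine HasDerivAt.unique h1 ?_
  have hline : ∀ s : ℝ, x + s • B.basis 2 = B.chart (B.tangential x, B.height x + s) := by
    intro s
    conv_lhs => rw [← B.chart_coordinates x]
    simp only [Frame.chart]
    module
  simp only [hline, paraboloidLevel_chart]
  exact ((hasDerivAt_id (0 : ℝ)).const_add _).sub_const _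

/-- In the chart the level function is `z - h̃(t)`, with normal derivative 1; smoothness, graph
property and orientation are automatic in any set. -/
theorem isGraphPatch_paraboloid (B : Frame) (κ : Fin 2 → ℝ) (A : Set E3) :
    IsGraphPatch B (paraboloidLevel B κ) (paraboloidHeight κ) A where
  continuousOn := (contDiff_paraboloidLevel B κ (n := 0)).continuous.continuousOn
  contDiffAt _ _ := (contDiff_paraboloidLevel B κ).contDiffAt
  oriented x _ := by
    have h1 : inner ℝ (gradient (paraboloidLevel B κ) x) (B.basis 2) = (1 : ℝ) := by
      rw [inner_gradient_left, fderiv_paraboloidLevel_normal]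
    have h0 : gradient (paraboloidLevel B κ) x ≠ 0 := by
      intro h0
      simp [h0] at h1
    rw [unitNormal, real_inner_smul_left, h1, mul_one]
    exact inv_pos.2 (norm_pos_iff.2 h0)
  height_contDiffAt _ _ := (contDiff_paraboloidHeight κ).contDiffAt
  eq_graph := by
    have h : ∀ x ∈ patch (paraboloidLevel B κ) A,
        B.graphMap (paraboloidHeight κ) (B.tangential x) = x := by
      intro x hx
      have h0 : B.height x - paraboloidHeight κ (B.tangential x) = 0 := by
        rw [← paraboloidLevel_chart, B.chart_coordinates]
        exact hx.2
      have h1 : B.chart (B.tangential x, paraboloidHeight κ (B.tangential x)) = x := by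
        rw [← sub_eq_zero.1 h0, B.chart_coordinates]
      exact h1
    ext x
    constructor
    · intro hx
      exact ⟨_, ⟨x, hx, rfl⟩, h x hx⟩
    · rintro ⟨_, ⟨y, hy, rfl⟩, rfl⟩
      rwa [h y hy]

/-! ### Second-order contact at the base point -/

/-- The base point may project to the boundary of the graph base, so identities on the base can be
differentiated there only through limits from its interior. -/
theorem fderiv_eq_zero_of_regularClosed {S : Set E2} (hreg : closure (interior S) = S) {f : E2 → ℝ}
    (hf : ∀ t ∈ S, ContDiffAt ℝ 1 f t) (h0 : ∀ t ∈ S, f t = 0) {t : E2} (ht : t ∈ S) :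
    fderiv ℝ f t = 0 := by
  have hEq : EqOn (fderiv ℝ f) (fun _ => 0) (interior S) := by
    intro s hs
    have : f =ᶠ[𝓝 s] fun _ => 0 := by
      filter_upwards [mem_interior_iff_mem_nhds.1 hs] with r hr using h0 r hr
    rw [this.fderiv_eq]
    simp
  have hcont : ContinuousOn (fderiv ℝ f) S := fun s hs =>
    ((hf s hs).fderiv_right (m := 0) (by norm_num)).continuousAt.continuousWithinAt
  exact hEq.of_subset_closure hcont continuousOn_const interior_subset hreg.ge ht

theorem contDiffAt_unitNormal {φ : E3 → ℝ} {x : E3} (hφ : ContDiffAt ℝ 2 φ x)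
    (h0 : fderiv ℝ φ x ≠ 0) : ContDiffAt ℝ 1 (unitNormal φ) x := by
  have h1 : ContDiffAt ℝ 1 (gradient φ) x :=
    (InnerProductSpace.toDual ℝ E3).symm.toContinuousLinearEquiv.contDiff.contDiffAt.comp x
      (hφ.fderiv_right (m := 1) (by norm_num))
  have h2 : gradient φ x ≠ 0 := by
    simpa [gradient] using h0
  exact ((h1.norm ℝ h2).inv (norm_ne_zero_iff.2 h2)).smul h1

/-- A function with vanishing 2-jet at the origin. -/
theorem isLittleO_sq_of_fderiv {q : E2 → ℝ} (hq : ∀ᶠ t in 𝓝 0, DifferentiableAt ℝ q t)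
    (h0 : q 0 = 0) (h1 : (fderiv ℝ q) =o[𝓝 0] fun t => t) : q =o[𝓝 0] fun t => ‖t‖ ^ 2 := by
  rw [Asymptotics.isLittleO_iff] at h1 ⊢
  intro c hc
  obtain ⟨r, hr, hball⟩ := Metric.eventually_nhds_iff_ball.1 (hq.and (h1 hc))
  filter_upwards [Metric.ball_mem_nhds (0 : E2) hr] with t ht
  have hsub : ∀ s ∈ Metric.closedBall (0 : E2) ‖t‖, s ∈ Metric.ball (0 : E2) r := fun s hs => by
    rw [mem_ball_zero_iff] at ht ⊢
    exact (mem_closedBall_zero_iff.1 hs).trans_lt ht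
  -- On the ball of radius `‖t‖` the derivative is at most `c ‖t‖`, so the mean value inequality
  -- yields `c ‖t‖²`.
  have := (convex_closedBall (0 : E2) ‖t‖).norm_image_sub_le_of_norm_fderiv_le (𝕜 := ℝ)
    (f := q) (C := c * ‖t‖) (x := 0) (y := t) (fun s hs => (hball s (hsub s hs)).1)
    (fun s hs => ((hball s (hsub s hs)).2).trans
      (mul_le_mul_of_nonneg_left (mem_closedBall_zero_iff.1 hs) hc.le)) (by simp) (by simp)
  rw [h0, sub_zero, sub_zero] at this
  simpa [pow_two, mul_assoc] using this

namespace IsGraphPatch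

variable {B : Frame} {φ : E3 → ℝ} {h : E2 → ℝ} {A : Set E3}

theorem zero_mem_graphBase (g : IsGraphPatch B φ h A) (hb : B.base ∈ patch φ A) :
    (0 : E2) ∈ B.graphBase φ A ∧ h 0 = 0 := by
  have hc : B.chart ((0 : E2), 0) = B.base := by simp [Frame.chart]
  have := g.mem_graphBase_iff.1 (hc ▸ hb)
  exact ⟨this.1, this.2.symm⟩

/-- Tangency is written with the unit normal, so that differentiating it produces the Weingarten
map. -/
theorem inner_unitNormal_tangent (g : IsGraphPatch B φ h A)
    (hreg : closure (interior (B.graphBase φ A)) = B.graphBase φ A) {t : E2}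
    (ht : t ∈ B.graphBase φ A) (w : E2) :
    inner ℝ (unitNormal φ (B.chart (t, h t))) (w 0 • B.basis 0 + w 1 • B.basis 1) +
      fderiv ℝ h t w * inner ℝ (unitNormal φ (B.chart (t, h t))) (B.basis 2) = 0 := by
  have := g.fderiv_tangent_eq_zero hreg ht w
  rw [← inner_gradient_left, inner_add_right, real_inner_smul_right] at this
  rw [unitNormal, real_inner_smul_left, real_inner_smul_left]
  linear_combination ‖gradient φ (B.chart (t, h t))‖⁻¹ * this

theorem fderiv_zero (g : IsGraphPatch B φ h A)
    (hreg : closure (interior (B.graphBase φ A)) = B.graphBase φ A)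
    (hb : B.base ∈ patch φ A) (hn : B.basis 2 = unitNormal φ B.base) : fderiv ℝ h 0 = 0 := by
  obtain ⟨h0S, h0⟩ := g.zero_mem_graphBase hb
  have hc : B.chart ((0 : E2), 0) = B.base := by simp [Frame.chart]
  ext w
  have := g.inner_unitNormal_tangent hreg h0S w
  rw [h0, hc, ← hn, inner_add_right, real_inner_smul_right, real_inner_smul_right,
    B.inner_basis, B.inner_basis, B.inner_basis] at this
  simpa using this

theorem contDiffAt_graph (g : IsGraphPatch B φ h A) {t : E2} (ht : t ∈ B.graphBase φ A) :
    ContDiffAt ℝ 2 (fun t => B.chart (t, h t)) t := by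
  have hp : ∀ i, ContDiffAt ℝ 2 (fun t : E2 => t i) t := fun i =>
    (EuclideanSpace.proj i : E2 →L[ℝ] ℝ).contDiff.contDiffAt
  exact (contDiffAt_const.add (((hp 0).smul contDiffAt_const).add
    ((hp 1).smul contDiffAt_const))).add ((g.height_contDiffAt t ht).smul contDiffAt_const)

/-- The Hessian of the height function at the base point is the second fundamental form. -/
theorem fderiv_fderiv_zero (g : IsGraphPatch B φ h A)
    (hreg : closure (interior (B.graphBase φ A)) = B.graphBase φ A)
    (hb : B.base ∈ patch φ A) (hn : B.basis 2 = unitNormal φ B.base) {κ : Fin 2 → ℝ}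
    (hκ : IsPrincipal B φ κ) : fderiv ℝ (fderiv ℝ h) 0 = paraboloidForm κ := by
  obtain ⟨h0S, h0⟩ := g.zero_mem_graphBase hb
  have hc : B.chart ((0 : E2), 0) = B.base := by simp [Frame.chart]
  have hnd : ∀ x ∈ patch φ A, ContDiffAt ℝ 1 (unitNormal φ) x := fun x hx =>
    contDiffAt_unitNormal (g.contDiffAt x hx) fun hz => by
      have := g.fderiv_normal_pos hx
      simp [hz] at this
  ext v w
  set W : E3 := w 0 • B.basis 0 + w 1 • B.basis 1 with hW
  have hN : ∀ t ∈ B.graphBase φ A, ContDiffAt ℝ 1 (fun t => unitNormal φ (B.chart (t, h t))) t :=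
    fun t ht => ContDiffAt.comp (g := unitNormal φ) (f := fun t => B.chart (t, h t)) t
      (hnd _ (g.graphMap_mem ht)) ((g.contDiffAt_graph ht).of_le (by norm_num))
  have hdh : ∀ t ∈ B.graphBase φ A, ContDiffAt ℝ 1 (fderiv ℝ h) t := fun t ht =>
    (g.height_contDiffAt t ht).fderiv_right (m := 1) (by norm_num)
  have hz := fderiv_eq_zero_of_regularClosed hreg
    (f := fun t => inner ℝ (unitNormal φ (B.chart (t, h t))) W +
      fderiv ℝ h t w * inner ℝ (unitNormal φ (B.chart (t, h t))) (B.basis 2))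
    (fun t ht => ((hN t ht).inner ℝ contDiffAt_const).add
      (((hdh t ht).clm_apply contDiffAt_const).mul ((hN t ht).inner ℝ contDiffAt_const)))
    (fun t ht => g.inner_unitNormal_tangent hreg ht w) h0S
  have hnormal : HasFDerivAt (unitNormal φ) (fderiv ℝ (unitNormal φ) B.base)
      (B.chart ((0 : E2), h 0)) := by
    rw [h0, hc]
    exact ((hnd _ hb).differentiableAt one_ne_zero).hasFDerivAt
  have hh : HasFDerivAt h (0 : E2 →L[ℝ] ℝ) 0 := by
    rw [← g.fderiv_zero hreg hb hn]
    exact ((g.height_contDiffAt 0 h0S).differentiableAt (by norm_num)).hasFDerivAt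
  have hgr := (((((EuclideanSpace.proj 0 : E2 →L[ℝ] ℝ).hasFDerivAt (x := 0)).smul_const
    (B.basis 0)).add (((EuclideanSpace.proj 1 : E2 →L[ℝ] ℝ).hasFDerivAt (x := 0)).smul_const
    (B.basis 1))).const_add B.base).add (hh.smul_const (B.basis 2))
  have hNd := HasFDerivAt.comp (g := unitNormal φ) (f := fun t => B.chart (t, h t)) 0 hnormal hgr
  have hQ : HasFDerivAt (fderiv ℝ h) (fderiv ℝ (fderiv ℝ h) 0) 0 :=
    ((hdh 0 h0S).differentiableAt one_ne_zero).hasFDerivAt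
  have hF := (hNd.inner ℝ (hasFDerivAt_const W (0 : E2))).add
    ((hQ.clm_apply (hasFDerivAt_const w (0 : E2))).mul
      (hNd.inner ℝ (hasFDerivAt_const (B.basis 2) (0 : E2))))
  have key := congrArg (fun l : E2 →L[ℝ] ℝ => l v) (hF.fderiv.symm.trans hz)
  have k0 : fderiv ℝ (unitNormal φ) B.base (B.basis 0) = -(κ 0 • B.basis 0) := by
    rw [← hκ.1, neg_neg]
  have k1 : fderiv ℝ (unitNormal φ) B.base (B.basis 1) = -(κ 1 • B.basis 1) := by
    rw [← hκ.2, neg_neg]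
  -- At the origin `Dh = 0` and the normal is `n₀`, so the differentiated identity reduces to
  -- `⟨Dn(τv), τw⟩ + D²h(v, w) = 0`, and `Dn` is diagonal with entries `-κ`.
  simp [h0, hc, ← hn, g.fderiv_zero hreg hb hn, k0, k1, hW, inner_add_left, inner_add_right,
    real_inner_smul_left, real_inner_smul_right, B.inner_basis] at key
  rw [paraboloidForm_apply]
  linarith

/-- The osculating paraboloid agrees with the graph to second order. -/
theorem isLittleO_paraboloidHeight_sub (g : IsGraphPatch B φ h A)
    (hreg : closure (interior (B.graphBase φ A)) = B.graphBase φ A)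
    (hb : B.base ∈ patch φ A) (hn : B.basis 2 = unitNormal φ B.base) {κ : Fin 2 → ℝ}
    (hκ : IsPrincipal B φ κ) :
    (fun t => paraboloidHeight κ t - h t) =o[𝓝 0] fun t => ‖t‖ ^ 2 := by
  obtain ⟨h0S, h0⟩ := g.zero_mem_graphBase hb
  have hh : ∀ᶠ t in 𝓝 (0 : E2), DifferentiableAt ℝ h t :=
    ((g.height_contDiffAt 0 h0S).eventually (by simp)).mono fun t ht =>
      ht.differentiableAt (by norm_num)
  have hd : ∀ᶠ t in 𝓝 (0 : E2), HasFDerivAt (fun t => paraboloidHeight κ t - h t)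
      (paraboloidForm κ t - fderiv ℝ h t) t :=
    hh.mono fun t ht => (hasFDerivAt_paraboloidHeight κ t).sub ht.hasFDerivAt
  refine isLittleO_sq_of_fderiv (hd.mono fun t ht => ht.differentiableAt)
    (by simp [paraboloidHeight, h0]) ?_
  have hQ : HasFDerivAt (fderiv ℝ h) (paraboloidForm κ) 0 := by
    rw [← g.fderiv_fderiv_zero hreg hb hn hκ]
    exact (((g.height_contDiffAt 0 h0S).fderiv_right (m := 1)
      (by norm_num)).differentiableAt one_ne_zero).hasFDerivAt
  have := hQ.isLittleO.neg_left
  simp only [g.fderiv_zero hreg hb hn, sub_zero, neg_sub] at this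
  exact this.congr' (hd.mono fun t ht => ht.fderiv.symm) EventuallyEq.rfl

/-- The planar divergence theorem replaces the base integral in `three_mul_volume_immersed`. It is
stated for any graph patch, hence serves both the given patch and the paraboloid. -/
theorem volume_immersed {C : Polyhedron} (g : IsGraphPatch B φ h C.carrier)
    (null : MeetsFacesInNullSets C φ) (D : FaceBoundary C B φ h) (xref : E3) {H : E2 → E2}
    (hH : IsPlanarPrimitive (B.graphBase φ C.carrier) (B.reducedHeight h xref) H) :
    volume.real (immersed φ C.carrier) =
      1 / 3 * ∑ k, (inner ℝ ((C.face k).first - xref) (C.face k).normal *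
          (μHE[2] : Measure E3).real (immersed φ (C.face k).region) +
        D.lineIntegral k fun t => inner ℝ (H t) (D.normal t)) := by
  have hS := g.isCompact_graphBase C.isCompact
  have h1 := D.setIntegral_planarDiv hS fun t ht => (hH t ht).1
  rw [setIntegral_congr_fun hS.measurableSet fun t ht => (hH t ht).2] at h1
  have h3 := g.three_mul_volume_immersed null D.regular xref
  rw [Finset.sum_add_distrib, ← h1]
  linarith

end IsGraphPatch

end

theorem mainTheorem1 (C : Polyhedron) (B : Frame) (φ : E3 → ℝ) (h : E2 → ℝ)
    (base_mem : B.base ∈ patch φ C.carrier)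
    (base_normal : B.basis 2 = unitNormal φ B.base)
    (graph : IsGraphPatch B φ h C.carrier)
    (null : MeetsFacesInNullSets C φ)
    (D : FaceBoundary C B φ h) :
    (∀ xref : E3,
      (∃ H, IsPlanarPrimitive (B.graphBase φ C.carrier) (B.reducedHeight h xref) H) ∧
      ∀ H, IsPlanarPrimitive (B.graphBase φ C.carrier) (B.reducedHeight h xref) H →
        volume.real (immersed φ C.carrier) =
          1 / 3 * ∑ k, (inner ℝ ((C.face k).first - xref) (C.face k).normal *
              (μHE[2] : Measure E3).real (immersed φ (C.face k).region) +
            D.lineIntegral k fun t => inner ℝ (H t) (D.normal t))) ∧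
    (∀ κ : Fin 2 → ℝ, IsPrincipal B φ κ →
      ((fun t => paraboloidHeight κ t - h t) =o[𝓝 0] fun t => ‖t‖ ^ 2) ∧
      IsPlanarPrimitive univ (B.reducedHeight (paraboloidHeight κ) B.base)
        (paraboloidPrimitive κ) ∧
      (MeetsFacesInNullSets C (paraboloidLevel B κ) →
        ∀ D' : FaceBoundary C B (paraboloidLevel B κ) (paraboloidHeight κ),
          volume.real (immersed (paraboloidLevel B κ) C.carrier) =
            1 / 3 * ∑ k, (inner ℝ ((C.face k).first - B.base) (C.face k).normal *
                (μHE[2] : Measure E3).real (immersed (paraboloidLevel B κ) (C.face k).region) +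
              D'.lineIntegral k fun t =>
                -(1 / 6) * (κ 0 * t 0 ^ 3 + 3 * κ 1 * t 0 * t 1 ^ 2) * D'.normal t 0))) := by
  refine ⟨fun xref => ⟨?_, fun H hH => graph.volume_immersed null D xref hH⟩, fun κ hκ =>
    ⟨graph.isLittleO_paraboloidHeight_sub D.regular base_mem base_normal hκ,
      isPlanarPrimitive_paraboloidPrimitive B κ, fun null' D' => ?_⟩⟩
  · exact exists_isPlanarPrimitive (graph.isCompact_graphBase C.isCompact) fun t ht =>
      B.contDiffAt_reducedHeight (graph.height_contDiffAt t ht) xref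
  · have hin : ∀ t, inner ℝ (paraboloidPrimitive κ t) (D'.normal t) =
        -(1 / 6) * (κ 0 * t 0 ^ 3 + 3 * κ 1 * t 0 * t 1 ^ 2) * D'.normal t 0 := by
      intro t
      rw [PiLp.inner_apply, Fin.sum_univ_two]
      simp [paraboloidPrimitive]
      ring
    have := (isGraphPatch_paraboloid B κ C.carrier).volume_immersed null' D' B.base
      fun t _ => isPlanarPrimitive_paraboloidPrimitive B κ t (mem_univ t)
    simpa only [hin] using this
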